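/- Let $\mathcal D$ be a unitary multifusion category (UMFC), i.e. a finite semisimple $\mathbb C$-linear rigid monoidal $\dagger$-category (with orthogonal direct sums, unitary associator and unitors, $(f\otimes g)^\dagger=f^\dagger\otimes g^\dagger$, and $f^\dagger f=0\Rightarrow f=0$). Choose representatives $\operatorname{Irr}(\mathcal D)$ of the simple objects, the decomposition $\mathbf 1=\bigoplus_{i\in I}\mathbf 1_i$ of the unit into simple objects, and for each simple $a$ a dual $\bar a\in\operatorname{Irr}(\mathcal D)$ with cup $\mathbf 1\to a\otimes\bar a$ and cap $\bar a\otimes a\to\mathbf 1$ satisfying the zigzag equations, normalized so that the loop $\mathbf 1\to a\otimes\bar a\to\mathbf 1$ (cup, then its dagger) placed to the left of a strand $a$ and the loop $\mathbf 1\to\bar a\otimes a\to\mathbf 1$ (dagger of the cap, then the cap) placed to its right have the same value $d_a$, the quantum dimension. Choose also bases $\{\alpha\}$ of the spaces $\operatorname{Hom}(c,a\otimes b)$ with $\beta^\dagger\alpha=\delta_{\alpha\beta}Y_c^{ab}\,\mathrm{id}_c$, where $Y^{ab}_c=\sqrt{d_ad_b/d_c}$. Such choices exist. For any of them put $$\mathbf{Tube}({}_{\mathcal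 D}\mathcal D_{\mathcal D})=\bigoplus_{a,b,c,e,f,h\in\operatorname{Irr}(\mathcal D)}\operatorname{Hom}(c,a\otimes e\otimes b)\otimes\operatorname{Hom}(a\otimes f\otimes b,h),$$ and write $X=[v,w]$ for the element given by $v\colon c\to a\otimes e\otimes b$ and $w\colon a\otimes f\otimes b\to h$ (the tube diagram with left arc $a$, right arc $b$, lower wall with outer end $c$ and inner end $e$, upper wall with outer end $h$ and inner end $f$). Define (associators and unitors suppressed, everything extended linearly, except that $*$ is extended antilinearly): - the product: $[v,w]\,[v',w']$ is $0$ unless $c'=e$ and $h'=f$, and then equals $\sum_{k,\alpha,s,\xi}\frac{1}{Y^{aa'}_kY^{b'b}_s}\big[(\alpha^\dagger\otimes\mathrm{id}_{e'}\otimes\xi^\dagger)(\mathrm{id}_a\otimes v'\otimes\mathrm{id}_b)v,\; w(\mathrm{id}_a\otimes w'\otimes\mathrm{id}_b)(\alpha\otimes\mathrm{id}_{f'}\otimes\xi)\big]$, where $\alpha$ and $\xi$ run over the bases of $\operatorname{Hom}(k,a\otimes a')$ and $\operatorname{Hom}(s,b'\otimes b)$; - the unit: the sum over all $x,y\in\operatorname{Irr}(\mathcal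 D)$ and $i,j\in I$ of the diagrams with upper wall $x$, lower wall $y$ and arcs $\mathbf 1_i,\mathbf 1_j$, whose two halves are the canonical maps $y\to\mathbf 1_i\otimes y\otimes\mathbf 1_j$ and $\mathbf 1_i\otimes x\otimes\mathbf 1_j\to x$ (a term is zero unless $x$ and $y$ both lie in $\mathbf 1_i\otimes\mathcal D\otimes\mathbf 1_j$); - the counit: $\varepsilon([v,w])$ is $0$ unless $e=f$ and $c=h$, and then it is the scalar $z$ with $wv=z\,\mathrm{id}_h$; - the comultiplication: $\Delta([v,w])=\sum_{i,j,k,\rho,\sigma}\frac{1}{Y^{ai}_jY^{jb}_k}\,[t,w]\otimes[v,t^\dagger]$ with $t=(\sigma\otimes\mathrm{id}_b)\rho$, where $\rho$ and $\sigma$ run over the bases of $\operatorname{Hom}(k,j\otimes b)$ and $\operatorname{Hom}(j,a\otimes i)$; - the antipode: $S([v,w])=\frac{d_f}{d_h}\,[\widehat w,\widehat v]$, where $\widehat w\colon f\to\bar a\otimes h\otimes\bar b$ and $\widehat v\colon\bar a\otimes c\otimes\bar b\to e$ arise from $w$ and $v$ by bending the arcs $a$ and $b$, that is, by composing with the dagger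 of the cap of $a$ and the cup of $b$ for $\widehat w$, and with the daggers of these two maps for $\widehat v$; - the star: $[v,w]^*=\frac{d_e}{d_c}\,[\widehat{v^\dagger},\widehat{w^\dagger}]$, with the same bending. Then $\mathbf{Tube}({}_{\mathcal D}\mathcal D_{\mathcal D})$ with these maps is a (finite-dimensional) $C^*$ weak Hopf algebra: it is a weak Hopf algebra, $*$ is an antilinear involution with $(XY)^*=Y^*X^*$ and $\Delta(X^*)=\Delta(X)^*$, and it has a faithful unital $*$-representation on a Hilbert space. Moreover $S$ is invertible and $S(X^*)=S^{-1}(X)^*$ for all $X$. -/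

import Mathlib

open CategoryTheory MonoidalCategory

universe v u

/-! ### Weak Hopf algebras, star structures, `C*` -/

namespace WeakHopf

open scoped TensorProduct

variable {W : Type*} [AddCommGroup W] [Module ℂ W]

/-- A finite-dimensional complex weak bialgebra, given by its structure maps. The product of
`W ⊗ W` is `TensorProduct.map₂ mul mul`. -/
structure IsWeakBialgebra (mul : W →ₗ[ℂ] W →ₗ[ℂ] W) (one : W)
    (comul : W →ₗ[ℂ] W ⊗[ℂ] W) (counit : W →ₗ[ℂ] ℂ) : Prop where
  finite : Module.Finite ℂ W
  mul_assoc : ∀ x y z, mul (mul x y) z = mul x (mul y z)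
  one_mul : ∀ x, mul one x = x
  mul_one : ∀ x, mul x one = x
  coassoc : ∀ x, TensorProduct.assoc ℂ W W W (comul.rTensor W (comul x))
    = comul.lTensor W (comul x)
  counit_comul : ∀ x, TensorProduct.lid ℂ W (counit.rTensor W (comul x)) = x
  comul_counit : ∀ x, TensorProduct.rid ℂ W (counit.lTensor W (comul x)) = x
  comul_mul : ∀ x y, comul (mul x y) = TensorProduct.map₂ mul mul (comul x) (comul y)
  /-- `(Δ ⊗ id) Δ(1) = (Δ(1) ⊗ 1) (1 ⊗ Δ(1))` -/
  comul_one : TensorProduct.assoc ℂ W W W (comul.rTensor W (comul one))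
    = TensorProduct.map₂ mul (TensorProduct.map₂ mul mul)
        (TensorProduct.assoc ℂ W W W (comul one ⊗ₜ[ℂ] one)) (one ⊗ₜ[ℂ] comul one)
  /-- `(Δ ⊗ id) Δ(1) = (1 ⊗ Δ(1)) (Δ(1) ⊗ 1)` -/
  comul_one' : TensorProduct.assoc ℂ W W W (comul.rTensor W (comul one))
    = TensorProduct.map₂ mul (TensorProduct.map₂ mul mul)
        (one ⊗ₜ[ℂ] comul one) (TensorProduct.assoc ℂ W W W (comul one ⊗ₜ[ℂ] one))
  /-- `ε(xyz) = ∑ ε(x y₍₁₎) ε(y₍₂₎ z)` -/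
  counit_mul : ∀ x y z, counit (mul (mul x y) z)
    = TensorProduct.lid ℂ ℂ
        (TensorProduct.map (counit ∘ₗ mul x) (counit ∘ₗ mul.flip z) (comul y))
  /-- `ε(xyz) = ∑ ε(x y₍₂₎) ε(y₍₁₎ z)` -/
  counit_mul' : ∀ x y z, counit (mul (mul x y) z)
    = TensorProduct.lid ℂ ℂ
        (TensorProduct.map (counit ∘ₗ mul.flip z) (counit ∘ₗ mul x) (comul y))

/-- A weak Hopf algebra: a weak bialgebra with an antipode. -/
structure IsWeakHopfAlgebra (mul : W →ₗ[ℂ] W →ₗ[ℂ] W) (one : W)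
    (comul : W →ₗ[ℂ] W ⊗[ℂ] W) (counit : W →ₗ[ℂ] ℂ) (S : W →ₗ[ℂ] W) : Prop
    extends IsWeakBialgebra mul one comul counit where
  /-- `∑ x₍₁₎ S(x₍₂₎) = ∑ ε(1₍₁₎ x) 1₍₂₎` -/
  mul_antipode : ∀ x, TensorProduct.lift mul (S.lTensor W (comul x))
    = TensorProduct.lid ℂ W
        (TensorProduct.map (counit ∘ₗ mul.flip x) LinearMap.id (comul one))
  /-- `∑ S(x₍₁₎) x₍₂₎ = ∑ 1₍₁₎ ε(x 1₍₂₎)` -/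
  antipode_mul : ∀ x, TensorProduct.lift mul (S.rTensor W (comul x))
    = TensorProduct.rid ℂ W
        (TensorProduct.map LinearMap.id (counit ∘ₗ mul x) (comul one))
  /-- `∑ S(x₍₁₎) x₍₂₎ S(x₍₃₎) = S(x)` -/
  antipode_mul_antipode : ∀ x,
    TensorProduct.lift mul (TensorProduct.map (TensorProduct.lift mul ∘ₗ S.rTensor W) S
      (comul.rTensor W (comul x))) = S x

/-- A `*`-weak Hopf algebra: the antilinear map `star` is an involution, reverses products, and
the comultiplication is a `*`-map. -/
structure IsStarWeakHopfAlgebra (mul : W →ₗ[ℂ] W →ₗ[ℂ] W) (one : W)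
    (comul : W →ₗ[ℂ] W ⊗[ℂ] W) (counit : W →ₗ[ℂ] ℂ) (S : W →ₗ[ℂ] W)
    (star : W →ₛₗ[starRingEnd ℂ] W) : Prop
    extends IsWeakHopfAlgebra mul one comul counit S where
  star_star : ∀ x, star (star x) = x
  star_mul : ∀ x y, star (mul x y) = mul (star y) (star x)
  comul_star : ∀ x, comul (star x) = TensorProduct.map star star (comul x)

/-- A `C*` weak Hopf algebra: a `*`-weak Hopf algebra with a faithful (unital) `*`-representation
by bounded operators on a Hilbert space. -/
structure IsCStarWeakHopfAlgebra (mul : W →ₗ[ℂ] W →ₗ[ℂ] W) (one : W)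
    (comul : W →ₗ[ℂ] W ⊗[ℂ] W) (counit : W →ₗ[ℂ] ℂ) (S : W →ₗ[ℂ] W)
    (star : W →ₛₗ[starRingEnd ℂ] W) : Prop
    extends IsStarWeakHopfAlgebra mul one comul counit S star where
  exists_faithful_rep : ∃ (H : Type) (_ : NormedAddCommGroup H) (_ : InnerProductSpace ℂ H)
    (_ : CompleteSpace H) (π : W →ₗ[ℂ] (H →L[ℂ] H)),
    Function.Injective π ∧ π one = 1 ∧ (∀ x y, π (mul x y) = π x * π y) ∧
      ∀ x, π (star x) = ContinuousLinearMap.adjoint (π x)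

end WeakHopf

/-! ### Unitary multifusion categories -/

/-- A `†`-category: a `ℂ`-linear category with an involutive antilinear contravariant functor
that is the identity on objects. -/
class DaggerCategory (C : Type u) [Category.{v} C] [Preadditive C] [Linear ℂ C] where
  dag : ∀ {X Y : C}, (X ⟶ Y) → (Y ⟶ X)
  dag_dag : ∀ {X Y : C} (f : X ⟶ Y), dag (dag f) = f
  dag_add : ∀ {X Y : C} (f g : X ⟶ Y), dag (f + g) = dag f + dag g
  dag_smul : ∀ {X Y : C} (z : ℂ) (f : X ⟶ Y), dag (z • f) = (starRingEnd ℂ) z • dag f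
  dag_id : ∀ X : C, dag (𝟙 X) = 𝟙 X
  dag_comp : ∀ {X Y Z : C} (f : X ⟶ Y) (g : Y ⟶ Z), dag (f ≫ g) = dag g ≫ dag f

open DaggerCategory (dag)

/-- `X` is simple: `End X = ℂ · id`, with `id ≠ 0`. -/
def IsSimpleObject {C : Type u} [Category.{v} C] [Preadditive C] [Linear ℂ C] (X : C) : Prop :=
  Function.Bijective (fun z : ℂ => z • 𝟙 X)

/-- A unitary multifusion category: a finite semisimple `ℂ`-linear rigid monoidal `†`-category
which is unitary. Direct sums in a `†`-category are orthogonal ones (the injections are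
isometries with pairwise orthogonal ranges). -/
class UnitaryMultifusionCategory (C : Type u) [Category.{v} C] [Preadditive C] [Linear ℂ C]
    [MonoidalCategory C] [MonoidalPreadditive C] [MonoidalLinear ℂ C] [RigidCategory C]
    [DaggerCategory C] : Prop where
  dag_tensor : ∀ {X Y X' Y' : C} (f : X ⟶ Y) (g : X' ⟶ Y'), dag (f ⊗ₘ g) = dag f ⊗ₘ dag g
  dag_associator : ∀ X Y Z : C, dag (α_ X Y Z).hom = (α_ X Y Z).inv
  dag_leftUnitor : ∀ X : C, dag (λ_ X).hom = (λ_ X).inv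
  dag_rightUnitor : ∀ X : C, dag (ρ_ X).hom = (ρ_ X).inv
  /-- Unitarity: `f† ∘ f = 0` implies `f = 0`. -/
  eq_zero_of_comp_dag : ∀ {X Y : C} (f : X ⟶ Y), f ≫ dag f = 0 → f = 0
  finite_hom : ∀ X Y : C, Module.Finite ℂ (X ⟶ Y)
  /-- Any two objects have an orthogonal direct sum. -/
  exists_directSum : ∀ X Y : C, ∃ (Z : C) (i : X ⟶ Z) (j : Y ⟶ Z),
    i ≫ dag i = 𝟙 X ∧ j ≫ dag j = 𝟙 Y ∧ i ≫ dag j = 0 ∧ dag i ≫ i + dag j ≫ j = 𝟙 Z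
  /-- Every object is a finite direct sum of simple objects. -/
  semisimple : ∀ X : C, ∃ (n : ℕ) (S : Fin n → C) (i : ∀ k, S k ⟶ X),
    (∀ k, IsSimpleObject (S k)) ∧ (∀ k, i k ≫ dag (i k) = 𝟙 (S k)) ∧
      (∀ k l, k ≠ l → i k ≫ dag (i l) = 0) ∧ ∑ k, dag (i k) ≫ i k = 𝟙 X
  /-- There are finitely many isomorphism classes of simple objects. -/
  finite_simples : ∃ (n : ℕ) (S : Fin n → C), ∀ X : C, IsSimpleObject X → ∃ k, Nonempty (X ≅ S k)

/-! ### String labels, vertices and quantum dimensions -/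

section

variable (C : Type u) [Category.{v} C] [Preadditive C] [Linear ℂ C] [MonoidalCategory C]
  [DaggerCategory C]

/-- The choices needed to draw string diagrams in `C`: representatives of the simple objects,
the simple summands of the tensor unit, cups and caps for the simple objects, and bases of the
vertex spaces. The cups and caps are spherical: a closed loop labelled `a` has the same value
`dim a`, the quantum dimension, on both sides of a strand `a`. -/
structure StringData where
  /-- the label set `Irr C` -/
  L : Type
  [fintypeL : Fintype L]
  [decEqL : DecidableEq L]
  /-- the simple object with a given label -/
  obj : L → C
  simple : ∀ a, IsSimpleObject (obj a)
  eq_of_iso : ∀ a b, Nonempty (obj a ≅ obj b) → a = b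
  exists_iso : ∀ X : C, IsSimpleObject X → ∃ a, Nonempty (X ≅ obj a)
  /-- the index set `I` of the decomposition `𝟙 = ⨁ 𝟙ᵢ` of the tensor unit -/
  I : Type
  [fintypeI : Fintype I]
  /-- the label of `𝟙ᵢ` -/
  unit : I → L
  /-- the injection `𝟙ᵢ ⟶ 𝟙` -/
  unitIncl : ∀ i, obj (unit i) ⟶ 𝟙_ C
  unitIncl_isometry : ∀ i, unitIncl i ≫ dag (unitIncl i) = 𝟙 _
  unitIncl_orthogonal : ∀ i j, i ≠ j → unitIncl i ≫ dag (unitIncl j) = 0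
  unitIncl_complete : ∑ i, dag (unitIncl i) ≫ unitIncl i = 𝟙 (𝟙_ C)
  /-- the label of the dual object -/
  bar : L → L
  /-- `𝟙 ⟶ a ⊗ ā` and `ā ⊗ a ⟶ 𝟙`, satisfying the zigzag equations -/
  pairing : ∀ a, ExactPairing (obj a) (obj (bar a))
  /-- the quantum dimension -/
  dim : L → ℝ
  loop_left : ∀ a, (λ_ (obj a)).inv ≫
    (((pairing a).coevaluation' ≫ dag (pairing a).coevaluation') ▷ obj a) ≫ (λ_ (obj a)).hom
      = (dim a : ℂ) • 𝟙 (obj a)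
  loop_right : ∀ a, (ρ_ (obj a)).inv ≫
    (obj a ◁ (dag (pairing a).evaluation' ≫ (pairing a).evaluation')) ≫ (ρ_ (obj a)).hom
      = (dim a : ℂ) • 𝟙 (obj a)
  /-- the fusion rule `N_{ab}^c` -/
  N : L → L → L → ℕ
  /-- the splitting vertices `c ⟶ a ⊗ b`; the fusion vertices are their daggers -/
  vtx : ∀ a b c, Fin (N a b c) → (obj c ⟶ obj a ⊗ obj b)
  /-- loop move, with normalization `Y_c^{ab} = (d_a d_b / d_c)^{1/2}` -/
  loop_move : ∀ a b c (α β : Fin (N a b c)), vtx a b c α ≫ dag (vtx a b c β)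
    = if α = β then (Real.sqrt (dim a * dim b / dim c) : ℂ) • 𝟙 (obj c) else 0
  /-- parallel move -/
  parallel_move : ∀ a b, ∑ c, ∑ α, ((Real.sqrt (dim a * dim b / dim c) : ℂ))⁻¹ •
    (dag (vtx a b c α) ≫ vtx a b c α) = 𝟙 (obj a ⊗ obj b)

end

/-- The edge labels of a tube diagram: `a` and `b` for the left and the right arc, `c` and `e` for
the outer and the inner end of the lower wall, `h` and `f` for the outer and the inner end of the
upper wall. -/
structure TubeLabel (L : Type) where
  a : L
  b : L
  c : L
  e : L
  f : L
  h : L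
deriving DecidableEq, Fintype

namespace StringData

variable {C : Type u} [Category.{v} C] [Preadditive C] [Linear ℂ C] [MonoidalCategory C]
  [MonoidalPreadditive C] [MonoidalLinear ℂ C] [DaggerCategory C] (D : StringData C)

instance : Fintype D.L := D.fintypeL
instance : DecidableEq D.L := D.decEqL
instance : Fintype D.I := D.fintypeI

noncomputable section

/-- The normalization factor `Y_c^{ab}`. -/
def Y (a b c : D.L) : ℂ := (Real.sqrt (D.dim a * D.dim b / D.dim c) : ℂ)

/-- The cup `𝟙 ⟶ b ⊗ b̄`. -/
def coev (b : D.L) : 𝟙_ C ⟶ D.obj b ⊗ D.obj (D.bar b) := (D.pairing b).coevaluation'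

/-- The cap `ā ⊗ a ⟶ 𝟙`. -/
def ev (a : D.L) : D.obj (D.bar a) ⊗ D.obj a ⟶ 𝟙_ C := (D.pairing a).evaluation'

/-- The identity if `x = y`, and zero otherwise. -/
def delta (x y : D.L) : D.obj x ⟶ D.obj y :=
  if h : x = y then eqToHom (congrArg D.obj h) else 0

/-- The number `z` with `f = z • id`. -/
def coeff (x : D.L) : (D.obj x ⟶ D.obj x) →ₗ[ℂ] ℂ :=
  (LinearEquiv.ofBijective (LinearMap.toSpanSingleton ℂ _ (𝟙 (D.obj x)))
    (D.simple x)).symm.toLinearMap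

/-- Lower halves of tube diagrams, spanned by `c ⟶ d ⊗ b ⟶ (a ⊗ e) ⊗ b`. -/
abbrev Bot (a b c e : D.L) : Type v := D.obj c ⟶ (D.obj a ⊗ D.obj e) ⊗ D.obj b

/-- Upper halves of tube diagrams, spanned by `(a ⊗ f) ⊗ b ⟶ g ⊗ b ⟶ h`. -/
abbrev Top (a b f h : D.L) : Type v := (D.obj a ⊗ D.obj f) ⊗ D.obj b ⟶ D.obj h

/-- The space of tube diagrams with given edge labels. -/
abbrev Sector (l : TubeLabel D.L) : Type v :=
  TensorProduct ℂ (D.Bot l.a l.b l.c l.e) (D.Top l.a l.b l.f l.h)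

/-- The underlying space of the bulk tube algebra. -/
abbrev Tube : Type v := ∀ l : TubeLabel D.L, D.Sector l

/-- The tube diagram with lower half `v` and upper half `w`. -/
def diag (a b c e f h : D.L) (v : D.Bot a b c e) (w : D.Top a b f h) : D.Tube :=
  Pi.single (M := D.Sector) ⟨a, b, c, e, f, h⟩ (TensorProduct.tmul ℂ v w)

/-- `diag` as a bilinear map. -/
def diagₗ (a b c e f h : D.L) : D.Bot a b c e →ₗ[ℂ] D.Top a b f h →ₗ[ℂ] D.Tube :=
  (TensorProduct.mk ℂ (D.Bot a b c e) (D.Top a b f h)).compr₂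
    (LinearMap.single ℂ D.Sector ⟨a, b, c, e, f, h⟩)

/-! #### Unit and multiplication -/

/-- The unit: the sum of the diagrams with walls `x` (upper) and `y` (lower) and with arcs labelled
by the summands of the tensor unit; a term vanishes unless `𝟙ᵢ ⊗ x ⊗ 𝟙ⱼ` and `𝟙ᵢ ⊗ y ⊗ 𝟙ⱼ` are both
nonzero. -/
def one : D.Tube :=
  ∑ x, ∑ y, ∑ i, ∑ j, D.diag (D.unit i) (D.unit j) y y x x
    ((ρ_ (D.obj y)).inv ≫ ((λ_ (D.obj y)).inv ▷ 𝟙_ C) ≫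
      ((dag (D.unitIncl i) ▷ D.obj y) ⊗ₘ dag (D.unitIncl j)))
    (((D.unitIncl i ▷ D.obj x) ⊗ₘ D.unitIncl j) ≫
      ((λ_ (D.obj x)).hom ▷ 𝟙_ C) ≫ (ρ_ (D.obj x)).hom)

/-- The reassociation `(a ⊗ ((a' ⊗ x) ⊗ b')) ⊗ b ≅ ((a ⊗ a') ⊗ x) ⊗ (b' ⊗ b)`. -/
def reassoc (A A' X B' B : C) :
    (A ⊗ ((A' ⊗ X) ⊗ B')) ⊗ B ≅ ((A ⊗ A') ⊗ X) ⊗ (B' ⊗ B) :=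
  whiskerRightIso ((α_ A (A' ⊗ X) B').symm ≪≫ whiskerRightIso (α_ A A' X).symm B') B ≪≫
    α_ ((A ⊗ A') ⊗ X) B' B

/-- Lower half of a product: stack `v'` inside `v`, then project the arcs `a ⊗ a'` to `k` and
`b' ⊗ b` to `s`. -/
def mulBot (a b c e a' b' c' e' k s : D.L) (α : Fin (D.N a a' k)) (ξ : Fin (D.N b' b s)) :
    D.Bot a b c e →ₗ[ℂ] D.Bot a' b' c' e' →ₗ[ℂ] D.Bot k s c e' :=
  LinearMap.mk₂ ℂ (fun v v' => v ≫ ((D.obj a ◁ (D.delta e c' ≫ v')) ▷ D.obj b) ≫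
      (reassoc (D.obj a) (D.obj a') (D.obj e') (D.obj b') (D.obj b)).hom ≫
      ((dag (D.vtx a a' k α) ▷ D.obj e') ⊗ₘ dag (D.vtx b' b s ξ)))
    (by intros; simp) (by intros; simp) (by intros; simp) (by intros; simp)

/-- Upper half of a product. -/
def mulTop (a b f h a' b' f' h' k s : D.L) (α : Fin (D.N a a' k)) (ξ : Fin (D.N b' b s)) :
    D.Top a b f h →ₗ[ℂ] D.Top a' b' f' h' →ₗ[ℂ] D.Top k s f' h :=
  LinearMap.mk₂ ℂ (fun w w' => ((D.vtx a a' k α ▷ D.obj f') ⊗ₘ D.vtx b' b s ξ) ≫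
      (reassoc (D.obj a) (D.obj a') (D.obj f') (D.obj b') (D.obj b)).inv ≫
      ((D.obj a ◁ (w' ≫ D.delta h' f)) ▷ D.obj b) ≫ w)
    (by intros; simp) (by intros; simp) (by intros; simp) (by intros; simp)

/-- The product of two tube diagrams: stack the second inside the first (zero unless `c' = e` and
`h' = f`), and fuse the parallel arcs. -/
def mulSector (l l' : TubeLabel D.L) : D.Sector l →ₗ[ℂ] D.Sector l' →ₗ[ℂ] D.Tube :=
  ∑ k, ∑ α, ∑ s, ∑ ξ, ((D.Y l.a l'.a k)⁻¹ * (D.Y l'.b l.b s)⁻¹) •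
    (TensorProduct.map₂ (D.mulBot l.a l.b l.c l.e l'.a l'.b l'.c l'.e k s α ξ)
      (D.mulTop l.a l.b l.f l.h l'.a l'.b l'.f l'.h k s α ξ)).compr₂
        (LinearMap.single ℂ D.Sector ⟨k, s, l.c, l'.e, l'.f, l.h⟩)

/-- The multiplication of the tube algebra. -/
def mul : D.Tube →ₗ[ℂ] D.Tube →ₗ[ℂ] D.Tube :=
  ∑ l, ∑ l', (D.mulSector l l').compl₁₂ (LinearMap.proj l) (LinearMap.proj l')

/-! #### Counit and comultiplication -/

/-- The counit: connect `e` with `f` and `c` with `h` (zero unless they agree); the value of the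
closed diagram divided by `d_h` is the scalar by which the resulting morphism `h ⟶ h` acts. -/
def counitSector (l : TubeLabel D.L) : D.Sector l →ₗ[ℂ] ℂ :=
  TensorProduct.lift <| LinearMap.mk₂ ℂ (fun v w => D.coeff l.h
      (D.delta l.h l.c ≫ v ≫ ((D.obj l.a ◁ D.delta l.e l.f) ▷ D.obj l.b) ≫ w))
    (by intros; simp) (by intros; simp) (by intros; simp) (by intros; simp)

/-- The counit of the tube algebra. -/
def counit : D.Tube →ₗ[ℂ] ℂ := ∑ l, D.counitSector l ∘ₗ LinearMap.proj l

/-- The comultiplication: insert a wall `i` and apply the parallel move to `a, i` and to `j, b`. -/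
def comulSector (l : TubeLabel D.L) : D.Sector l →ₗ[ℂ] TensorProduct ℂ D.Tube D.Tube :=
  ∑ i, ∑ j, ∑ k, ∑ ρ : Fin (D.N j l.b k), ∑ σ : Fin (D.N l.a i j),
    ((D.Y l.a i j)⁻¹ * (D.Y j l.b k)⁻¹) •
    (TensorProduct.map
      ((D.diagₗ l.a l.b k i l.f l.h) (D.vtx j l.b k ρ ≫ (D.vtx l.a i j σ ▷ D.obj l.b)))
      ((D.diagₗ l.a l.b l.c l.e i k).flip
        (dag (D.vtx l.a i j σ) ▷ D.obj l.b ≫ dag (D.vtx j l.b k ρ)))) ∘ₗ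
      (TensorProduct.comm ℂ _ _).toLinearMap

/-- The comultiplication of the tube algebra. -/
def comul : D.Tube →ₗ[ℂ] TensorProduct ℂ D.Tube D.Tube :=
  ∑ l, D.comulSector l ∘ₗ LinearMap.proj l

/-! #### Antipode and star -/

/-- The cups creating arcs `ā, a` on the left and `b, b̄` on the right of a wall `x`. -/
def cups (a b x : D.L) : D.obj x ⟶
    (D.obj (D.bar a) ⊗ ((D.obj a ⊗ D.obj x) ⊗ D.obj b)) ⊗ D.obj (D.bar b) :=
  (λ_ (D.obj x)).inv ≫ (dag (D.ev a) ▷ D.obj x) ≫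
    (α_ (D.obj (D.bar a)) (D.obj a) (D.obj x)).hom ≫
    (ρ_ (D.obj (D.bar a) ⊗ (D.obj a ⊗ D.obj x))).inv ≫
    ((D.obj (D.bar a) ⊗ (D.obj a ⊗ D.obj x)) ◁ D.coev b) ≫
    (α_ (D.obj (D.bar a) ⊗ (D.obj a ⊗ D.obj x)) (D.obj b) (D.obj (D.bar b))).inv ≫
    ((α_ (D.obj (D.bar a)) (D.obj a ⊗ D.obj x) (D.obj b)).hom ▷ D.obj (D.bar b))

/-- Bend the arcs of an upper half down, which makes it a lower half. -/
def bendTop (a b f h : D.L) : D.Top a b f h →ₗ[ℂ] D.Bot (D.bar a) (D.bar b) f h where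
  toFun w := D.cups a b f ≫ ((D.obj (D.bar a) ◁ w) ▷ D.obj (D.bar b))
  map_add' _ _ := by simp
  map_smul' _ _ := by simp

/-- Bend the arcs of a lower half up, which makes it an upper half. -/
def bendBot (a b c e : D.L) : D.Bot a b c e →ₗ[ℂ] D.Top (D.bar a) (D.bar b) c e where
  toFun v := ((D.obj (D.bar a) ◁ v) ▷ D.obj (D.bar b)) ≫ dag (D.cups a b e)
  map_add' _ _ := by simp
  map_smul' _ _ := by simp

/-- The antipode on diagrams with fixed labels: `d_f / d_h` times the diagram turned inside out. -/
def antipodeSector (l : TubeLabel D.L) : D.Sector l →ₗ[ℂ] D.Tube :=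
  ((D.dim l.f / D.dim l.h : ℝ) : ℂ) •
    (LinearMap.single ℂ D.Sector ⟨D.bar l.a, D.bar l.b, l.f, l.h, l.c, l.e⟩ ∘ₗ
      TensorProduct.map (D.bendTop l.a l.b l.f l.h) (D.bendBot l.a l.b l.c l.e) ∘ₗ
      (TensorProduct.comm ℂ _ _).toLinearMap)

/-- The antipode of the tube algebra. -/
def antipode : D.Tube →ₗ[ℂ] D.Tube := ∑ l, D.antipodeSector l ∘ₗ LinearMap.proj l

/-- The dagger as an antilinear map. -/
def dagₛₗ (X Y : C) : (X ⟶ Y) →ₛₗ[starRingEnd ℂ] (Y ⟶ X) where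
  toFun := dag
  map_add' := DaggerCategory.dag_add
  map_smul' := DaggerCategory.dag_smul

/-- The star operation on diagrams with fixed labels: `d_e / d_c` times the reflected diagram, with
every vertex replaced by its dagger. -/
def starSector (l : TubeLabel D.L) : D.Sector l →ₛₗ[starRingEnd ℂ] D.Tube :=
  ((D.dim l.e / D.dim l.c : ℝ) : ℂ) •
    (LinearMap.single ℂ D.Sector ⟨D.bar l.a, D.bar l.b, l.e, l.c, l.h, l.f⟩).comp
      (TensorProduct.map ((D.bendTop l.a l.b l.e l.c).comp (dagₛₗ _ _))
        ((D.bendBot l.a l.b l.h l.f).comp (dagₛₗ _ _)))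

/-- The star operation of the tube algebra. -/
def star : D.Tube →ₛₗ[starRingEnd ℂ] D.Tube :=
  ∑ l, (D.starSector l).comp (LinearMap.proj l : D.Tube →ₗ[ℂ] D.Sector l)

end

end StringData

/-! A tube diagram depends on its arcs only through a coend: a morphism on an arc may be pushed from
the lower half to the upper half. For simple arcs this is Schur's lemma, so diagrams with arbitrary
objects `A`, `B` as arcs make sense inside the same finite-dimensional space (`gdiag`), and
morphisms slide along their arcs (`gdiag_dinatural`). In this language vertices and normalization
factors disappear. The product is nesting, with arcs `A ⊗ A'` and `B' ⊗ B` (`mul_gdiag`); the unit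
consists of diagrams with arcs `𝟙` (`one_eq`); the coproduct cuts along any resolution of `(A ⊗ i) ⊗
B` into simple objects (`comul_gdiag`), because the canonical element of a resolution does not
depend on the choice (`sum_resolution_eq`). The weak bialgebra axioms then follow from coherence,
Schur's lemma and the completeness of resolutions.

The antipode needs the spherical normalization. Comparing the two ways of closing a diagram around a
vertex shows that the mates of splitting and of fusion vertices have the same Gram matrix
(`gram_eq`); with positivity this forces duality to commute with the dagger (`dag_mateIn`). Hence
closing the arcs of `a i b ⟶ k ⟶ a i b` on both sides multiplies the scalar by `d_k / d_i`
(`bend_trace`), and the bent vertices, weighted by `d_i / d_k`, again resolve the identity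
(`sum_bend`). These two facts give the antipode axioms, and the factor in the antipode is exactly
what they require.

The star is the antipode composed with an antilinear multiplicative involution `conj`, which takes
daggers of both halves (`star_eq`). The antipode reverses products because mates of a resolution of
`a ⊗ a'` resolve the tensor product of the duals in the opposite order (`antipode_mul`). Bending
twice only inserts the comparison `a ⟶ ā̄`, an isometry by the equality of the loops
(`doubleDual_isometry`), so the star is an involution. This says that the inverse of the antipode is
its conjugate by `conj`, whence the relation between the antipode and the star.

For the representation, a functional supported on diagrams with unit arcs gives a form for which
different sectors are orthogonal and each sector is a product of the positive forms on the two
halves, up to a positive weight (`functional_star_mul_same`). The left regular representation on an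
orthonormal basis is a faithful `*`-representation. The string data exist because orthonormal bases
of morphism spaces exist and a single rescaling of a pairing equalizes its two loops. -/

set_option linter.unusedSectionVars false

/-! ### Calculus of the dagger -/

namespace DaggerCategory

section

variable {C : Type u} [Category.{v} C] [Preadditive C] [Linear ℂ C] [DaggerCategory C]

/-- The dagger as an additive map. -/
def dagHom (X Y : C) : (X ⟶ Y) →+ (Y ⟶ X) where
  toFun := dag
  map_zero' := by simpa using dag_smul (0 : ℂ) (0 : X ⟶ Y)
  map_add' := dag_add

lemma dag_zero {X Y : C} : dag (0 : X ⟶ Y) = 0 := (dagHom X Y).map_zero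

lemma dag_sum {ι : Type*} (s : Finset ι) {X Y : C} (f : ι → (X ⟶ Y)) :
    dag (∑ i ∈ s, f i) = ∑ i ∈ s, dag (f i) := map_sum (dagHom X Y) f s

lemma dag_injective {X Y : C} : Function.Injective (dag : (X ⟶ Y) → (Y ⟶ X)) :=
  Function.LeftInverse.injective (g := dag) dag_dag

lemma dag_eq_zero_iff {X Y : C} (f : X ⟶ Y) : dag f = 0 ↔ f = 0 := by
  rw [← dag_zero, dag_injective.eq_iff]

end

variable {C : Type u} [Category.{v} C] [Preadditive C] [Linear ℂ C] [MonoidalCategory C]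
  [MonoidalPreadditive C] [MonoidalLinear ℂ C] [RigidCategory C] [DaggerCategory C]
  [UnitaryMultifusionCategory C]

open UnitaryMultifusionCategory

lemma dag_whiskerLeft (X : C) {Y Z : C} (f : Y ⟶ Z) : dag (X ◁ f) = X ◁ dag f := by
  rw [← id_tensorHom, dag_tensor, dag_id, id_tensorHom]

lemma dag_whiskerRight {Y Z : C} (f : Y ⟶ Z) (X : C) : dag (f ▷ X) = dag f ▷ X := by
  rw [← tensorHom_id, dag_tensor, dag_id, tensorHom_id]

lemma dag_associator_inv (X Y Z : C) : dag (α_ X Y Z).inv = (α_ X Y Z).hom := by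
  rw [← dag_associator, dag_dag]

lemma dag_leftUnitor_inv (X : C) : dag (λ_ X).inv = (λ_ X).hom := by
  rw [← dag_leftUnitor, dag_dag]

lemma dag_rightUnitor_inv (X : C) : dag (ρ_ X).inv = (ρ_ X).hom := by
  rw [← dag_rightUnitor, dag_dag]

end DaggerCategory

/-! ### Two-sided tensoring -/

namespace TwoSided

variable {C : Type u} [Category.{v} C] [MonoidalCategory C]

/-- The action `(φ ⊗ f) ⊗ ψ` on morphisms of the two-sided tensor product `(A ⊗ X) ⊗ B`. -/
def triMap {A A' X X' B B' : C} (φ : A ⟶ A') (f : X ⟶ X') (ψ : B ⟶ B') :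
    (A ⊗ X) ⊗ B ⟶ (A' ⊗ X') ⊗ B' := (φ ⊗ₘ f) ⊗ₘ ψ

/-- The unitor `(𝟙 ⊗ X) ⊗ 𝟙 ≅ X`. -/
def triUnitor (X : C) : (𝟙_ C ⊗ X) ⊗ 𝟙_ C ≅ X :=
  whiskerRightIso (λ_ X) (𝟙_ C) ≪≫ ρ_ X

/-- This is the associator of the two-sided action on `C`. The right factors appear in reverse order
because the primed pair lies inside the unprimed one. -/
abbrev triAssoc (A A' X B' B : C) := StringData.reassoc A A' X B' B

@[simp]
lemma triMap_id (A X B : C) : triMap (𝟙 A) (𝟙 X) (𝟙 B) = 𝟙 ((A ⊗ X) ⊗ B) := by simp [triMap]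

@[simp]
lemma triMap_comp {A A' A'' X X' X'' B B' B'' : C} (φ : A ⟶ A') (f : X ⟶ X') (ψ : B ⟶ B')
    (φ' : A' ⟶ A'') (f' : X' ⟶ X'') (ψ' : B' ⟶ B'') :
    triMap φ f ψ ≫ triMap φ' f' ψ' = triMap (φ ≫ φ') (f ≫ f') (ψ ≫ ψ') := by
  simp [triMap]

@[simp]
lemma triMap_comp_assoc {A A' A'' X X' X'' B B' B'' Z : C} (φ : A ⟶ A') (f : X ⟶ X') (ψ : B ⟶ B')
    (φ' : A' ⟶ A'') (f' : X' ⟶ X'') (ψ' : B' ⟶ B'') (h : (A'' ⊗ X'') ⊗ B'' ⟶ Z) :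
    triMap φ f ψ ≫ triMap φ' f' ψ' ≫ h = triMap (φ ≫ φ') (f ≫ f') (ψ ≫ ψ') ≫ h := by
  rw [← Category.assoc, triMap_comp]

lemma triMap_triMap {A A' X B' B A₁ A₁' X₁ B₁' B₁ : C} (φ : A ⟶ A₁) (φ' : A' ⟶ A₁') (f : X ⟶ X₁)
    (ψ' : B' ⟶ B₁') (ψ : B ⟶ B₁) :
    triMap φ (triMap φ' f ψ') ψ ≫ (triAssoc A₁ A₁' X₁ B₁' B₁).hom =
      (triAssoc A A' X B' B).hom ≫ triMap (φ ⊗ₘ φ') f (ψ' ⊗ₘ ψ) := by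
  simp only [triMap, StringData.reassoc, Iso.trans_hom, whiskerRightIso_hom, Iso.symm_hom,
    comp_whiskerRight, Category.assoc]
  rw [← associator_naturality, ← tensorHom_id, ← tensorHom_id, ← tensorHom_id,
    tensorHom_comp_tensorHom_assoc, associator_inv_naturality, ← tensorHom_comp_tensorHom_assoc]
  simp only [tensorHom_comp_tensorHom_assoc, tensorHom_comp_tensorHom, Category.comp_id,
    associator_inv_naturality]
  simp only [← tensorHom_id, tensorHom_comp_tensorHom_assoc, tensorHom_comp_tensorHom,
    Category.id_comp]

lemma triMap_triMap_inv {A A' X B' B A₁ A₁' X₁ B₁' B₁ : C} (φ : A ⟶ A₁) (φ' : A' ⟶ A₁')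
    (f : X ⟶ X₁) (ψ' : B' ⟶ B₁') (ψ : B ⟶ B₁) :
    (triAssoc A A' X B' B).inv ≫ triMap φ (triMap φ' f ψ') ψ =
      triMap (φ ⊗ₘ φ') f (ψ' ⊗ₘ ψ) ≫ (triAssoc A₁ A₁' X₁ B₁' B₁).inv := by
  rw [Iso.inv_comp_eq, ← Category.assoc, Iso.eq_comp_inv, triMap_triMap]

lemma triMap_triUnitor {X Y : C} (f : X ⟶ Y) :
    triMap (𝟙 (𝟙_ C)) f (𝟙 (𝟙_ C)) ≫ (triUnitor Y).hom = (triUnitor X).hom ≫ f := by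
  simp [triMap, triUnitor]

lemma triUnitor_inv_triMap {X Y : C} (f : X ⟶ Y) :
    (triUnitor X).inv ≫ triMap (𝟙 (𝟙_ C)) f (𝟙 (𝟙_ C)) = f ≫ (triUnitor Y).inv := by
  rw [Iso.inv_comp_eq, ← Category.assoc, Iso.eq_comp_inv, triMap_triUnitor]

/-- The pentagon of the two-sided action; `triAssoc_unit_left` and `triAssoc_unit_right` are its
triangles. They compare structural isomorphisms only, so coherence decides them. -/
lemma triAssoc_triAssoc (A A' A'' X B'' B' B : C) :
    triMap (𝟙 A) (triAssoc A' A'' X B'' B').hom (𝟙 B) ≫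
      (triAssoc A (A' ⊗ A'') X (B'' ⊗ B') B).hom =
    (triAssoc A A' ((A'' ⊗ X) ⊗ B'') B' B).hom ≫ (triAssoc (A ⊗ A') A'' X B'' (B' ⊗ B)).hom ≫
      triMap (α_ A A' A'').hom (𝟙 X) (α_ B'' B' B).inv := by
  simp only [triMap, StringData.reassoc, Iso.trans_hom, whiskerRightIso_hom, Iso.symm_hom]
  monoidal

lemma triAssoc_unit_left (A X B : C) :
    (triAssoc (𝟙_ C) A X B (𝟙_ C)).hom ≫ triMap (λ_ A).hom (𝟙 X) (ρ_ B).hom =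
      (triUnitor ((A ⊗ X) ⊗ B)).hom := by
  simp only [triMap, StringData.reassoc, Iso.trans_hom, whiskerRightIso_hom, Iso.symm_hom,
    triUnitor]
  monoidal

lemma triAssoc_unit_right (A X B : C) :
    (triAssoc A (𝟙_ C) X (𝟙_ C) B).hom ≫ triMap (ρ_ A).hom (𝟙 X) (λ_ B).hom =
      triMap (𝟙 A) (triUnitor X).hom (𝟙 B) := by
  simp only [triMap, StringData.reassoc, Iso.trans_hom, whiskerRightIso_hom, Iso.symm_hom,
    triUnitor]
  monoidal

section

variable [Preadditive C] [MonoidalPreadditive C]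

lemma triMap_add_mid {A A' X X' B B' : C} (φ : A ⟶ A') (f g : X ⟶ X') (ψ : B ⟶ B') :
    triMap φ (f + g) ψ = triMap φ f ψ + triMap φ g ψ := by
  simp only [triMap, MonoidalPreadditive.tensor_add, MonoidalPreadditive.add_tensor]

lemma triMap_sum_mid {ι : Type*} (s : Finset ι) {A A' X X' B B' : C} (φ : A ⟶ A')
    (f : ι → (X ⟶ X')) (ψ : B ⟶ B') :
    triMap φ (∑ i ∈ s, f i) ψ = ∑ i ∈ s, triMap φ (f i) ψ := by
  simp [triMap, tensor_sum, sum_tensor]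

lemma triMap_sum_left {ι : Type*} (s : Finset ι) {A A' X X' B B' : C} (φ : ι → (A ⟶ A'))
    (f : X ⟶ X') (ψ : B ⟶ B') :
    triMap (∑ i ∈ s, φ i) f ψ = ∑ i ∈ s, triMap (φ i) f ψ := by
  simp [triMap, sum_tensor]

lemma triMap_sum_right {ι : Type*} (s : Finset ι) {A A' X X' B B' : C} (φ : A ⟶ A')
    (f : X ⟶ X') (ψ : ι → (B ⟶ B')) :
    triMap φ f (∑ i ∈ s, ψ i) = ∑ i ∈ s, triMap φ f (ψ i) := by
  simp [triMap, tensor_sum]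

@[simp]
lemma triMap_zero_mid {A A' X X' B B' : C} (φ : A ⟶ A') (ψ : B ⟶ B') :
    triMap φ (0 : X ⟶ X') ψ = 0 := by simp [triMap]

@[simp]
lemma triMap_zero_left {A A' X X' B B' : C} (f : X ⟶ X') (ψ : B ⟶ B') :
    triMap (0 : A ⟶ A') f ψ = 0 := by simp [triMap]

@[simp]
lemma triMap_zero_right {A A' X X' B B' : C} (φ : A ⟶ A') (f : X ⟶ X') :
    triMap φ f (0 : B ⟶ B') = 0 := by simp [triMap]

variable [Linear ℂ C] [MonoidalLinear ℂ C]

@[simp]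
lemma triMap_smul_mid {A A' X X' B B' : C} (z : ℂ) (φ : A ⟶ A') (f : X ⟶ X') (ψ : B ⟶ B') :
    triMap φ (z • f) ψ = z • triMap φ f ψ := by
  simp [triMap, MonoidalCategory.tensorHom_def]

@[simp]
lemma triMap_smul_left {A A' X X' B B' : C} (z : ℂ) (φ : A ⟶ A') (f : X ⟶ X') (ψ : B ⟶ B') :
    triMap (z • φ) f ψ = z • triMap φ f ψ := by
  simp [triMap, MonoidalCategory.tensorHom_def]

@[simp]
lemma triMap_smul_right {A A' X X' B B' : C} (z : ℂ) (φ : A ⟶ A') (f : X ⟶ X') (ψ : B ⟶ B') :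
    triMap φ f (z • ψ) = z • triMap φ f ψ := by
  simp [triMap, MonoidalCategory.tensorHom_def]

variable [RigidCategory C] [DaggerCategory C] [UnitaryMultifusionCategory C]

open DaggerCategory UnitaryMultifusionCategory

lemma dag_triMap {A A' X X' B B' : C} (φ : A ⟶ A') (f : X ⟶ X') (ψ : B ⟶ B') :
    dag (triMap φ f ψ) = triMap (dag φ) (dag f) (dag ψ) := by
  simp only [triMap, dag_tensor]

lemma dag_triAssoc_hom (A A' X B' B : C) :
    dag (triAssoc A A' X B' B).hom = (triAssoc A A' X B' B).inv := by
  simp [StringData.reassoc, dag_comp, dag_whiskerRight, dag_associator, dag_associator_inv]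

lemma dag_triAssoc_inv (A A' X B' B : C) :
    dag (triAssoc A A' X B' B).inv = (triAssoc A A' X B' B).hom := by
  rw [← dag_triAssoc_hom, dag_dag]

lemma dag_triUnitor_hom (X : C) : dag (triUnitor X).hom = (triUnitor X).inv := by
  simp [triUnitor, dag_comp, dag_leftUnitor, dag_rightUnitor]

lemma dag_triUnitor_inv (X : C) : dag (triUnitor X).inv = (triUnitor X).hom := by
  rw [← dag_triUnitor_hom, dag_dag]

end

end TwoSided

/-! ### Simple objects -/

namespace IsSimpleObject

section

variable {C : Type u} [Category.{v} C] [Preadditive C] [Linear ℂ C] {X : C}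

lemma exists_smul (hX : IsSimpleObject X) (f : X ⟶ X) : ∃ z : ℂ, f = z • 𝟙 X := by
  obtain ⟨z, hz⟩ := hX.2 f
  exact ⟨z, hz.symm⟩

lemma smul_id_injective (hX : IsSimpleObject X) {z w : ℂ} (h : z • 𝟙 X = w • 𝟙 X) : z = w :=
  hX.1 h

lemma id_ne_zero (hX : IsSimpleObject X) : 𝟙 X ≠ 0 := fun h =>
  zero_ne_one (hX.smul_id_injective (z := 0) (w := 1) (by simp [h]))

lemma of_iso {Y : C} (hX : IsSimpleObject X) (e : X ≅ Y) : IsSimpleObject Y := by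
  constructor
  · intro z w h
    refine hX.smul_id_injective ?_
    have := congrArg (fun t => e.hom ≫ t ≫ e.inv) h
    simpa using this
  · intro f
    obtain ⟨z, hz⟩ := hX.exists_smul (e.hom ≫ f ≫ e.inv)
    refine ⟨z, ?_⟩
    have := congrArg (fun t => e.inv ≫ t ≫ e.hom) hz
    simpa using this.symm

end

variable {C : Type u} [Category.{v} C] [Preadditive C] [Linear ℂ C] [MonoidalCategory C]
  [MonoidalPreadditive C] [MonoidalLinear ℂ C] [RigidCategory C] [DaggerCategory C]
  [UnitaryMultifusionCategory C] {X : C}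

open DaggerCategory UnitaryMultifusionCategory

/-- On a simple object, `f† ∘ f` is a positive number unless `f = 0`. -/
lemma exists_pos (hX : IsSimpleObject X) {Y : C} {f : X ⟶ Y} (hf : f ≠ 0) :
    ∃ z : ℝ, 0 < z ∧ f ≫ dag f = (z : ℂ) • 𝟙 X := by
  obtain ⟨z, hz⟩ := hX.exists_smul (f ≫ dag f)
  have hreal : (starRingEnd ℂ) z = z := by
    refine hX.smul_id_injective ?_
    have := congrArg dag hz
    rw [dag_comp, dag_dag, dag_smul, dag_id, hz] at this
    exact this.symm
  obtain ⟨r, rfl⟩ := Complex.conj_eq_iff_real.1 hreal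
  refine ⟨r, ?_, hz⟩
  by_contra hr
  -- If `r ≤ 0`, the morphism `√(-r) • i + f ≫ j` into the orthogonal sum `X ⊕ Y`, followed by its
  -- dagger, gives `-r + r = 0`. Unitarity kills it, hence also its component `f`.
  obtain ⟨Z, i, j, hi, hj, hij, -⟩ := exists_directSum X Y
  have hji : j ≫ dag i = 0 := by
    have := congrArg dag hij
    rwa [dag_comp, dag_dag, dag_zero] at this
  set s : ℂ := (Real.sqrt (-r) : ℂ)
  have hs : s * s = -(r : ℂ) := by
    rw [← Complex.ofReal_mul, Real.mul_self_sqrt (by linarith), Complex.ofReal_neg]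
  have hsc : (starRingEnd ℂ) s = s := Complex.conj_ofReal _
  have h0 : s • i + f ≫ j = 0 := by
    apply eq_zero_of_comp_dag
    rw [dag_add, dag_smul, dag_comp, hsc]
    simp only [Preadditive.add_comp, Preadditive.comp_add, Linear.smul_comp, Linear.comp_smul,
      Category.assoc, hi]
    rw [← Category.assoc i (dag j), hij, hji, ← Category.assoc j, hj]
    simp only [Limits.zero_comp, Limits.comp_zero, smul_zero, add_zero, zero_add, Category.id_comp,
      hz, smul_smul, hs, neg_smul, neg_add_cancel]
  have hfj : f = 0 := by
    have := congrArg (· ≫ dag j) h0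
    simpa [hij, hj] using this
  exact hf hfj

lemma exists_nonneg (hX : IsSimpleObject X) {Y : C} (f : X ⟶ Y) :
    ∃ z : ℝ, 0 ≤ z ∧ f ≫ dag f = (z : ℂ) • 𝟙 X := by
  by_cases hf : f = 0
  · exact ⟨0, le_rfl, by simp [hf]⟩
  · obtain ⟨z, hz, h⟩ := hX.exists_pos hf
    exact ⟨z, hz.le, h⟩

/-- A nonzero morphism of simple objects is a multiple of a unitary isomorphism. -/
lemma exists_unitary (hX : IsSimpleObject X) {Y : C} (hY : IsSimpleObject Y) {f : X ⟶ Y}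
    (hf : f ≠ 0) : ∃ g : X ⟶ Y, g ≫ dag g = 𝟙 X ∧ dag g ≫ g = 𝟙 Y := by
  obtain ⟨z, hz, hzf⟩ := hX.exists_pos hf
  obtain ⟨w, hw⟩ := hY.exists_smul (dag f ≫ f)
  -- The scalars of `f ≫ dag f` and `dag f ≫ f` agree since both act on `f ≫ dag f ≫ f`; dividing
  -- `f` by the square root of this scalar then makes it unitary.
  have hwz : w = z := by
    have h1 : f ≫ dag f ≫ f = w • f := by rw [hw]; simp
    have h2 : f ≫ dag f ≫ f = (z : ℂ) • f := by
      rw [← Category.assoc, hzf, Linear.smul_comp, Category.id_comp]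
    have h3 : (w - z) • f = 0 := by rw [sub_smul, ← h1, h2, sub_self]
    rcases smul_eq_zero.1 h3 with h | h
    · exact sub_eq_zero.1 h
    · exact absurd h hf
  set s : ℂ := (((Real.sqrt z)⁻¹ : ℝ) : ℂ)
  have hs : s * s * z = 1 := by
    have : (Real.sqrt z)⁻¹ * (Real.sqrt z)⁻¹ * z = 1 := by
      have h := Real.mul_self_sqrt hz.le
      have h' : Real.sqrt z ≠ 0 := (Real.sqrt_pos.2 hz).ne'
      field_simp
      nlinarith
    rw [← Complex.ofReal_mul, ← Complex.ofReal_mul, this, Complex.ofReal_one]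
  have hsc : (starRingEnd ℂ) s = s := Complex.conj_ofReal _
  refine ⟨s • f, ?_, ?_⟩
  · rw [dag_smul, hsc, Linear.smul_comp, Linear.comp_smul, hzf, smul_smul, smul_smul, hs, one_smul]
  · rw [dag_smul, hsc, Linear.smul_comp, Linear.comp_smul, hw, hwz, smul_smul, smul_smul, hs,
      one_smul]

end IsSimpleObject

/-! ### Scalars, Schur's lemma and positivity of the quantum dimensions -/

namespace StringData

open DaggerCategory UnitaryMultifusionCategory

section

variable {C : Type u} [Category.{v} C] [Preadditive C] [Linear ℂ C] [MonoidalCategory C]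
  [DaggerCategory C] (D : StringData C)

@[simp]
lemma delta_self (x : D.L) : D.delta x x = 𝟙 (D.obj x) := by simp [delta]

lemma delta_of_ne {x y : D.L} (h : x ≠ y) : D.delta x y = 0 := by simp [delta, h]

lemma coeff_smul_id (x : D.L) (f : D.obj x ⟶ D.obj x) : D.coeff x f • 𝟙 (D.obj x) = f :=
  (LinearEquiv.ofBijective (LinearMap.toSpanSingleton ℂ _ (𝟙 (D.obj x)))
    (D.simple x)).apply_symm_apply f

@[simp]
lemma coeff_id (x : D.L) : D.coeff x (𝟙 (D.obj x)) = 1 :=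
  (D.simple x).smul_id_injective (by rw [coeff_smul_id, one_smul])

lemma eq_coeff {x : D.L} {f : D.obj x ⟶ D.obj x} {z : ℂ} (h : f = z • 𝟙 _) : D.coeff x f = z := by
  rw [h, map_smul, coeff_id, smul_eq_mul, mul_one]

lemma id_ne_zero (x : D.L) : 𝟙 (D.obj x) ≠ 0 := (D.simple x).id_ne_zero

end

variable {C : Type u} [Category.{v} C] [Preadditive C] [Linear ℂ C] [MonoidalCategory C]
  [MonoidalPreadditive C] [MonoidalLinear ℂ C] [RigidCategory C] [DaggerCategory C]
  [UnitaryMultifusionCategory C] (D : StringData C)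

/-- Schur's lemma. -/
lemma hom_eq_zero {x y : D.L} (h : x ≠ y) (f : D.obj x ⟶ D.obj y) : f = 0 := by
  by_contra hf
  obtain ⟨g, h1, h2⟩ := (D.simple x).exists_unitary (D.simple y) hf
  exact h (D.eq_of_iso x y ⟨⟨g, dag g, h1, h2⟩⟩)

/-- The right loop is a cup beside a strand followed by its own dagger, and the zigzag equation
prevents this cup from vanishing; such scalars are positive. -/
lemma dim_pos (a : D.L) : 0 < D.dim a := by
  have hne : (ρ_ (D.obj a)).inv ≫ (D.obj a ◁ dag (D.ev a)) ≠ 0 := by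
    intro h
    have h2 : D.obj a ◁ dag (D.ev a) = 0 := by
      have := congrArg ((ρ_ (D.obj a)).hom ≫ ·) h
      simpa using this
    have h3 : D.obj a ◁ D.ev a = 0 := by
      have := congrArg dag h2
      simpa [dag_whiskerLeft, dag_dag, dag_zero] using this
    have h4 := (D.pairing a).evaluation_coevaluation'
    change _ ≫ _ ≫ D.obj a ◁ D.ev a = _ at h4
    rw [h3] at h4
    refine D.id_ne_zero a ?_
    have := congrArg (fun t => (λ_ (D.obj a)).inv ≫ t ≫ (ρ_ (D.obj a)).hom) h4
    simpa using this.symm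
  obtain ⟨z, hz, h⟩ := (D.simple a).exists_pos hne
  have h' := D.loop_right a
  simp only [dag_comp, dag_whiskerLeft, dag_rightUnitor_inv, dag_dag, Category.assoc] at h
  simp only [MonoidalCategory.whiskerLeft_comp, Category.assoc] at h'
  have := (D.simple a).smul_id_injective (h.symm.trans h')
  rw [← Complex.ofReal_inj.1 this]
  exact hz

lemma dim_ne_zero (a : D.L) : (D.dim a : ℂ) ≠ 0 := by exact_mod_cast (D.dim_pos a).ne'

/-! ### Resolutions into simple objects -/

/-- A family of morphisms from and to simple objects which resolves the identity of `Z`. -/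
structure Resolution (Z : C) where
  ι : Type
  [fintype : Fintype ι]
  lab : ι → D.L
  inc : ∀ m, D.obj (lab m) ⟶ Z
  prj : ∀ m, Z ⟶ D.obj (lab m)
  complete : ∑ m, prj m ≫ inc m = 𝟙 Z

attribute [instance] Resolution.fintype

namespace Resolution

variable {D} {Z W : C} (R : D.Resolution Z)

lemma sum_comp_right (f : W ⟶ Z) : ∑ m, (f ≫ R.prj m) ≫ R.inc m = f := by
  simp only [Category.assoc, ← Preadditive.comp_sum, R.complete, Category.comp_id]

lemma sum_comp_left (f : Z ⟶ W) : ∑ m, R.prj m ≫ R.inc m ≫ f = f := by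
  simp only [← Category.assoc, ← Preadditive.sum_comp, R.complete, Category.id_comp]

end Resolution

lemma nonempty_resolution (Z : C) : Nonempty (D.Resolution Z) := by
  obtain ⟨n, S, i, hS, -, -, hc⟩ := semisimple Z
  choose l hl using fun k => D.exists_iso (S k) (hS k)
  have e : ∀ k, S k ≅ D.obj (l k) := fun k => (hl k).some
  exact ⟨⟨Fin n, l, fun m => (e m).inv ≫ i m, fun m => dag (i m) ≫ (e m).hom, by simp [hc]⟩⟩

/-- A chosen resolution. -/
noncomputable def resolution (Z : C) : D.Resolution Z := (D.nonempty_resolution Z).some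

/-- The canonical element `∑ inc ⊗ prj` does not depend on the resolution. -/
lemma sum_resolution_eq {Z : C} {M : Type*} [AddCommGroup M] [Module ℂ M]
    (β : ∀ k, (D.obj k ⟶ Z) →ₗ[ℂ] (Z ⟶ D.obj k) →ₗ[ℂ] M) (R R' : D.Resolution Z) :
    ∑ m, β (R.lab m) (R.inc m) (R.prj m) = ∑ m, β (R'.lab m) (R'.inc m) (R'.prj m) := by
  -- Schur's lemma lets a morphism between labels slide from one slot of `β` to the other. Inserting
  -- `R'` after the inclusions of `R`, sliding, and summing over `R` exchanges the two resolutions.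
  have key : ∀ k k' (φ : D.obj k ⟶ D.obj k') (u : D.obj k' ⟶ Z) (p : Z ⟶ D.obj k),
      β k (φ ≫ u) p = β k' u (p ≫ φ) := by
    intro k k' φ u p
    by_cases h : k = k'
    · subst h
      obtain ⟨z, rfl⟩ := (D.simple k).exists_smul φ
      simp
    · simp [D.hom_eq_zero h φ]
  calc ∑ m, β (R.lab m) (R.inc m) (R.prj m)
      = ∑ m, ∑ n, β (R'.lab n) (R'.inc n) (R.prj m ≫ R.inc m ≫ R'.prj n) := by
        refine Finset.sum_congr rfl fun m _ => ?_
        conv_lhs => rw [← R'.sum_comp_right (R.inc m)]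
        simp only [map_sum, LinearMap.sum_apply, key]
    _ = ∑ n, ∑ m, β (R'.lab n) (R'.inc n) (R.prj m ≫ R.inc m ≫ R'.prj n) := Finset.sum_comm
    _ = _ := by
        refine Finset.sum_congr rfl fun n _ => ?_
        conv_rhs => rw [← R.sum_comp_left (R'.prj n)]
        simp only [map_sum]

/-- The resolution of `a ⊗ b` by vertices. -/
noncomputable def vtxResolution (a b : D.L) : D.Resolution (D.obj a ⊗ D.obj b) where
  ι := Σ c, Fin (D.N a b c)
  lab m := m.1
  inc m := (D.Y a b m.1)⁻¹ • D.vtx a b m.1 m.2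
  prj m := dag (D.vtx a b m.1 m.2)
  complete := by
    rw [Fintype.sum_sigma]
    simpa [Y] using D.parallel_move a b

/-- The resolution of the tensor unit. -/
noncomputable def unitResolution : D.Resolution (𝟙_ C) where
  ι := D.I
  lab i := D.unit i
  inc i := D.unitIncl i
  prj i := dag (D.unitIncl i)
  complete := D.unitIncl_complete

/-- Resolutions are transported along isomorphisms. -/
def Resolution.ofIso {D : StringData C} {Z W : C} (R : D.Resolution Z) (e : Z ≅ W) :
    D.Resolution W where
  ι := R.ι
  lab := R.lab
  inc m := R.inc m ≫ e.hom
  prj m := e.inv ≫ R.prj m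
  complete := by
    have : ∑ m, (e.inv ≫ R.prj m) ≫ R.inc m ≫ e.hom = e.inv ≫ (∑ m, R.prj m ≫ R.inc m) ≫ e.hom := by
      simp only [Preadditive.comp_sum, Preadditive.sum_comp, Category.assoc]
    rw [this, R.complete]
    simp

/-- The resolution of a simple object by itself. -/
def simpleResolution (x : D.L) : D.Resolution (D.obj x) where
  ι := Unit
  lab _ := x
  inc _ := 𝟙 _
  prj _ := 𝟙 _
  complete := by simp

open TwoSided

/-- Resolve first the middle object of `(A ⊗ Z) ⊗ B`, then the two-sided tensor products with its
simple constituents. -/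
def Resolution.triMid {D : StringData C} {Z : C} (A B : C) (R : D.Resolution Z)
    (R' : ∀ m, D.Resolution ((A ⊗ D.obj (R.lab m)) ⊗ B)) : D.Resolution ((A ⊗ Z) ⊗ B) where
  ι := Σ m, (R' m).ι
  lab m := (R' m.1).lab m.2
  inc m := (R' m.1).inc m.2 ≫ triMap (𝟙 A) (R.inc m.1) (𝟙 B)
  prj m := triMap (𝟙 A) (R.prj m.1) (𝟙 B) ≫ (R' m.1).prj m.2
  complete := by
    rw [Fintype.sum_sigma]
    have : ∀ m, ∑ n, (triMap (𝟙 A) (R.prj m) (𝟙 B) ≫ (R' m).prj n) ≫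
        (R' m).inc n ≫ triMap (𝟙 A) (R.inc m) (𝟙 B) =
        triMap (𝟙 A) (R.prj m ≫ R.inc m) (𝟙 B) := by
      intro m
      have h : ∑ n, (triMap (𝟙 A) (R.prj m) (𝟙 B) ≫ (R' m).prj n) ≫
        (R' m).inc n ≫ triMap (𝟙 A) (R.inc m) (𝟙 B) = triMap (𝟙 A) (R.prj m) (𝟙 B) ≫
          (∑ n, (R' m).prj n ≫ (R' m).inc n) ≫ triMap (𝟙 A) (R.inc m) (𝟙 B) := by
        simp only [Preadditive.comp_sum, Preadditive.sum_comp, Category.assoc]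
      rw [h, (R' m).complete]
      simp
    simp only [this, ← triMap_sum_mid, R.complete, triMap_id]

/-- Resolve first the outer objects of `(A ⊗ X) ⊗ B`. -/
def Resolution.triOuter {D : StringData C} {A B : C} (X : C) (R : D.Resolution A)
    (S : D.Resolution B)
    (R' : ∀ m n, D.Resolution ((D.obj (R.lab m) ⊗ X) ⊗ D.obj (S.lab n))) :
    D.Resolution ((A ⊗ X) ⊗ B) where
  ι := Σ m : R.ι × S.ι, (R' m.1 m.2).ι
  lab m := (R' m.1.1 m.1.2).lab m.2
  inc m := (R' m.1.1 m.1.2).inc m.2 ≫ triMap (R.inc m.1.1) (𝟙 X) (S.inc m.1.2)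
  prj m := triMap (R.prj m.1.1) (𝟙 X) (S.prj m.1.2) ≫ (R' m.1.1 m.1.2).prj m.2
  complete := by
    rw [Fintype.sum_sigma]
    have : ∀ m : R.ι × S.ι,
        ∑ n, (triMap (R.prj m.1) (𝟙 X) (S.prj m.2) ≫ (R' m.1 m.2).prj n) ≫
        (R' m.1 m.2).inc n ≫ triMap (R.inc m.1) (𝟙 X) (S.inc m.2) =
        triMap (R.prj m.1 ≫ R.inc m.1) (𝟙 X) (S.prj m.2 ≫ S.inc m.2) := by
      intro m
      have h : ∑ n, (triMap (R.prj m.1) (𝟙 X) (S.prj m.2) ≫ (R' m.1 m.2).prj n) ≫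
        (R' m.1 m.2).inc n ≫ triMap (R.inc m.1) (𝟙 X) (S.inc m.2) =
          triMap (R.prj m.1) (𝟙 X) (S.prj m.2) ≫
          (∑ n, (R' m.1 m.2).prj n ≫ (R' m.1 m.2).inc n) ≫
            triMap (R.inc m.1) (𝟙 X) (S.inc m.2) := by
        simp only [Preadditive.comp_sum, Preadditive.sum_comp, Category.assoc]
      rw [h, (R' m.1 m.2).complete]
      simp
    simp only [this, Fintype.sum_prod_type, ← triMap_sum_right, ← triMap_sum_left, R.complete,
      S.complete, triMap_id]

/-- The resolution of `(a ⊗ i) ⊗ b` by pairs of vertices. -/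
noncomputable def triResolution (a b i : D.L) :
    D.Resolution ((D.obj a ⊗ D.obj i) ⊗ D.obj b) where
  ι := Σ j, Σ k, Fin (D.N j b k) × Fin (D.N a i j)
  lab m := m.2.1
  inc m := ((D.Y a i m.1)⁻¹ * (D.Y m.1 b m.2.1)⁻¹) •
    (D.vtx m.1 b m.2.1 m.2.2.1 ≫ (D.vtx a i m.1 m.2.2.2 ▷ D.obj b))
  prj m := dag (D.vtx a i m.1 m.2.2.2) ▷ D.obj b ≫ dag (D.vtx m.1 b m.2.1 m.2.2.1)
  complete := by
    -- For fixed `j` and `σ`, the parallel move for `j ⊗ b` is inserted between the two vertices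
    -- labelled `σ`; summing over `j` and `σ` is then the parallel move for `a ⊗ i`.
    have h : ∀ j, ∑ σ, (D.Y a i j)⁻¹ • (dag (D.vtx a i j σ) ▷ D.obj b ≫
        D.vtx a i j σ ▷ D.obj b) = ∑ x : Σ k, Fin (D.N j b k) × Fin (D.N a i j),
        (dag (D.vtx a i j x.2.2) ▷ D.obj b ≫ dag (D.vtx j b x.1 x.2.1)) ≫
        (((D.Y a i j)⁻¹ * (D.Y j b x.1)⁻¹) •
        (D.vtx j b x.1 x.2.1 ≫ (D.vtx a i j x.2.2 ▷ D.obj b))) := by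
      intro j
      simp only [Fintype.sum_sigma, Fintype.sum_prod_type]
      simp only [Finset.sum_comm (s := Finset.univ (α := Fin (D.N j b _)))
        (t := Finset.univ (α := Fin (D.N a i j)))]
      rw [Finset.sum_comm]
      refine Finset.sum_congr rfl fun σ _ => ?_
      have h2 := D.parallel_move j b
      have h3 := congrArg (fun t => (D.Y a i j)⁻¹ •
        (dag (D.vtx a i j σ) ▷ D.obj b ≫ t ≫ D.vtx a i j σ ▷ D.obj b)) h2
      simp only [Category.id_comp] at h3
      rw [← h3]
      simp only [Preadditive.comp_sum, Preadditive.sum_comp, Finset.smul_sum, Category.assoc,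
        Linear.comp_smul, Linear.smul_comp, smul_smul]
      rfl
    rw [Fintype.sum_sigma]
    refine (Finset.sum_congr rfl fun j _ => (h j).symm).trans ?_
    have := congrArg (· ▷ D.obj b) (D.parallel_move a i)
    simp only [id_whiskerRight] at this
    rw [← this]
    simp only [sum_whiskerRight, MonoidalLinear.smul_whiskerRight, comp_whiskerRight]
    rfl

end StringData

/-! ### Tube diagrams with arbitrary arcs -/

namespace StringData

open DaggerCategory UnitaryMultifusionCategory TwoSided
open scoped TensorProduct

variable {C : Type u} [Category.{v} C] [Preadditive C] [Linear ℂ C] [MonoidalCategory C]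
  [MonoidalPreadditive C] [MonoidalLinear ℂ C] [RigidCategory C] [DaggerCategory C]
  [UnitaryMultifusionCategory C] (D : StringData C)

lemma diagₗ_apply (a b c e f h : D.L) (v : D.Bot a b c e) (w : D.Top a b f h) :
    D.diagₗ a b c e f h v w = D.diag a b c e f h v w := rfl

/-- By Schur's lemma `φ` and `ψ` are scalars or zero, and a scalar passes through the tensor sign.
This is the coend relation on simple arcs. -/
lemma diagₗ_dinatural {a a' b b' : D.L} (c e f h : D.L) (φ : D.obj a ⟶ D.obj a')
    (ψ : D.obj b ⟶ D.obj b') (v : D.Bot a b c e) (w : D.Top a' b' f h) :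
    D.diagₗ a' b' c e f h (v ≫ triMap φ (𝟙 _) ψ) w =
      D.diagₗ a b c e f h v (triMap φ (𝟙 _) ψ ≫ w) := by
  by_cases ha : a = a'
  · by_cases hb : b = b'
    · subst ha hb
      obtain ⟨y, rfl⟩ := (D.simple a).exists_smul φ
      obtain ⟨z, rfl⟩ := (D.simple b).exists_smul ψ
      simp
    · simp [D.hom_eq_zero hb ψ]
  · simp [D.hom_eq_zero ha φ]

/-- Tube diagrams whose arcs are labelled by arbitrary objects, as elements of the tube algebra. -/
noncomputable def gdiag (A B : C) (c e f h : D.L) :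
    (D.obj c ⟶ (A ⊗ D.obj e) ⊗ B) →ₗ[ℂ] ((A ⊗ D.obj f) ⊗ B ⟶ D.obj h) →ₗ[ℂ] D.Tube :=
  ∑ m, ∑ n, (D.diagₗ ((D.resolution A).lab m) ((D.resolution B).lab n) c e f h).compl₁₂
    (Linear.rightComp ℂ _ (triMap ((D.resolution A).prj m) (𝟙 _) ((D.resolution B).prj n)))
    (Linear.leftComp ℂ _ (triMap ((D.resolution A).inc m) (𝟙 _) ((D.resolution B).inc n)))

lemma gdiag_def (A B : C) (c e f h : D.L) (v : D.obj c ⟶ (A ⊗ D.obj e) ⊗ B)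
    (w : (A ⊗ D.obj f) ⊗ B ⟶ D.obj h) :
    D.gdiag A B c e f h v w = ∑ m, ∑ n,
      D.diagₗ ((D.resolution A).lab m) ((D.resolution B).lab n) c e f h
        (v ≫ triMap ((D.resolution A).prj m) (𝟙 _) ((D.resolution B).prj n))
        (triMap ((D.resolution A).inc m) (𝟙 _) ((D.resolution B).inc n) ≫ w) := by
  simp [gdiag]

lemma triMap_outer_eq_sum {A A' B B' X : C} {ι κ : Type*} [Fintype ι] [Fintype κ]
    {φ : ι → (A ⟶ A')} {ψ : κ → (B ⟶ B')} {φ₀ : A ⟶ A'} {ψ₀ : B ⟶ B'} (hφ : ∑ m, φ m = φ₀)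
    (hψ : ∑ n, ψ n = ψ₀) :
    triMap φ₀ (𝟙 X) ψ₀ = ∑ m, ∑ n, triMap (φ m) (𝟙 X) (ψ n) := by
  rw [← hφ, ← hψ]
  simp only [triMap_sum_left, triMap_sum_right]
  exact Finset.sum_comm

lemma sum_comm_pairs {ι κ ι' κ' M : Type*} [Fintype ι] [Fintype κ] [Fintype ι'] [Fintype κ']
    [AddCommMonoid M] (F : ι → κ → ι' → κ' → M) :
    ∑ m, ∑ n, ∑ m', ∑ n', F m n m' n' = ∑ m', ∑ n', ∑ m, ∑ n, F m n m' n' := by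
  have := Finset.sum_comm (s := (Finset.univ : Finset (ι × κ)))
    (t := (Finset.univ : Finset (ι' × κ'))) (f := fun p q => F p.1 p.2 q.1 q.2)
  simpa only [Fintype.sum_prod_type] using this

/-- Morphisms slide along the arcs of a diagram. -/
lemma gdiag_dinatural {A A' B B' : C} (c e f h : D.L) (φ : A ⟶ A') (ψ : B ⟶ B')
    (v : D.obj c ⟶ (A ⊗ D.obj e) ⊗ B) (w : (A' ⊗ D.obj f) ⊗ B' ⟶ D.obj h) :
    D.gdiag A' B' c e f h (v ≫ triMap φ (𝟙 _) ψ) w =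
      D.gdiag A B c e f h v (triMap φ (𝟙 _) ψ ≫ w) := by
  rw [gdiag_def, gdiag_def]
  set R := D.resolution A
  set S := D.resolution B
  set R' := D.resolution A'
  set S' := D.resolution B'
  calc _ = ∑ m', ∑ n', ∑ m, ∑ n, D.diagₗ (R.lab m) (S.lab n) c e f h
            (v ≫ triMap (R.prj m) (𝟙 _) (S.prj n))
            (triMap (R.inc m ≫ φ ≫ R'.prj m' ≫ R'.inc m') (𝟙 _)
              (S.inc n ≫ ψ ≫ S'.prj n' ≫ S'.inc n') ≫ w) := by
        refine Finset.sum_congr rfl fun m' _ => Finset.sum_congr rfl fun n' _ => ?_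
        -- Resolutions of `A` and `B` are inserted below `φ` and `ψ`. The morphisms between the
        -- resulting simple arcs can then be slid to the upper half.
        have h1 : (v ≫ triMap φ (𝟙 _) ψ) ≫ triMap (R'.prj m') (𝟙 _) (S'.prj n') =
            ∑ m, ∑ n, (v ≫ triMap (R.prj m) (𝟙 (D.obj e)) (S.prj n)) ≫
              triMap (R.inc m ≫ φ ≫ R'.prj m') (𝟙 _) (S.inc n ≫ ψ ≫ S'.prj n') := by
          simp only [Category.assoc, triMap_comp, Category.comp_id, ← Preadditive.comp_sum]
          rw [← triMap_outer_eq_sum (R.sum_comp_left _) (S.sum_comp_left _)]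
        rw [h1]
        simp only [map_sum, LinearMap.sum_apply, diagₗ_dinatural]
        simp only [triMap_comp_assoc, Category.comp_id, Category.assoc]
    _ = ∑ m, ∑ n, ∑ m', ∑ n', D.diagₗ (R.lab m) (S.lab n) c e f h
            (v ≫ triMap (R.prj m) (𝟙 _) (S.prj n))
            (triMap (R.inc m ≫ φ ≫ R'.prj m' ≫ R'.inc m') (𝟙 _)
              (S.inc n ≫ ψ ≫ S'.prj n' ≫ S'.inc n') ≫ w) := by
        exact sum_comm_pairs _
    _ = _ := by
        refine Finset.sum_congr rfl fun m _ => Finset.sum_congr rfl fun n _ => ?_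
        simp only [← map_sum, ← Preadditive.sum_comp]
        rw [← triMap_outer_eq_sum (φ₀ := R.inc m ≫ φ) (ψ₀ := S.inc n ≫ ψ)]
        · rw [triMap_comp_assoc, Category.comp_id]
        · simpa using R'.sum_comp_right (R.inc m ≫ φ)
        · simpa using S'.sum_comp_right (S.inc n ≫ ψ)

lemma gdiag_obj (a b c e f h : D.L) (v : D.Bot a b c e) (w : D.Top a b f h) :
    D.gdiag (D.obj a) (D.obj b) c e f h v w = D.diagₗ a b c e f h v w := by
  rw [gdiag_def]
  simp only [diagₗ_dinatural, triMap_comp_assoc, ← map_sum, ← Preadditive.sum_comp,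
    Category.comp_id]
  rw [← triMap_outer_eq_sum (Resolution.complete _) (Resolution.complete _)]
  simp

/-- Sliding the projections across turns the right side into a diagram with arcs `A`, `B` and
completeness sums inserted, so any resolutions may replace the chosen ones. -/
lemma gdiag_eq_sum {A B : C} (R : D.Resolution A) (S : D.Resolution B) (c e f h : D.L)
    (v : D.obj c ⟶ (A ⊗ D.obj e) ⊗ B) (w : (A ⊗ D.obj f) ⊗ B ⟶ D.obj h) :
    D.gdiag A B c e f h v w = ∑ m, ∑ n, D.diagₗ (R.lab m) (S.lab n) c e f h
      (v ≫ triMap (R.prj m) (𝟙 _) (S.prj n)) (triMap (R.inc m) (𝟙 _) (S.inc n) ≫ w) := by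
  simp only [← gdiag_obj, gdiag_dinatural, triMap_comp_assoc, ← map_sum, ← Preadditive.sum_comp,
    Category.comp_id]
  rw [← triMap_outer_eq_sum (Resolution.complete _) (Resolution.complete _)]
  simp

/-! ### The structure maps on diagrams with arbitrary arcs -/

lemma mul_diagₗ (a b c e f h a' b' c' e' f' h' : D.L) (v : D.Bot a b c e) (w : D.Top a b f h)
    (v' : D.Bot a' b' c' e') (w' : D.Top a' b' f' h') :
    D.mul (D.diagₗ a b c e f h v w) (D.diagₗ a' b' c' e' f' h' v' w') =
      ∑ k, ∑ α, ∑ s, ∑ ξ, ((D.Y a a' k)⁻¹ * (D.Y b' b s)⁻¹) • D.diagₗ k s c e' f' h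
        (D.mulBot a b c e a' b' c' e' k s α ξ v v') (D.mulTop a b f h a' b' f' h' k s α ξ w w') := by
  simp only [mul, diagₗ, LinearMap.sum_apply, LinearMap.compl₁₂_apply, LinearMap.compr₂_apply,
    TensorProduct.mk_apply, LinearMap.coe_proj, Function.eval, LinearMap.coe_single]
  rw [Finset.sum_eq_single (⟨a, b, c, e, f, h⟩ : TubeLabel D.L),
    Finset.sum_eq_single (⟨a', b', c', e', f', h'⟩ : TubeLabel D.L)]
  · simp only [Pi.single_eq_same, mulSector, LinearMap.sum_apply, LinearMap.smul_apply,
      LinearMap.compr₂_apply, TensorProduct.map₂_apply_tmul, TensorProduct.map_tmul,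
      LinearMap.coe_single]
  · intro l _ hl
    rw [Pi.single_eq_of_ne hl, map_zero]
  · simp
  · intro l _ hl
    refine Finset.sum_eq_zero fun l' _ => ?_
    rw [Pi.single_eq_of_ne hl, map_zero, LinearMap.zero_apply]
  · simp

/-- The sums over fusion vertices, with their factors `Y⁻¹`, are the expansion of one diagram with
arcs `a ⊗ a'` and `b' ⊗ b` along `vtxResolution`. The vertices play no further role in the product.
-/
lemma mul_gdiag_obj (a b c e f h a' b' c' e' f' h' : D.L) (v : D.Bot a b c e) (w : D.Top a b f h)
    (v' : D.Bot a' b' c' e') (w' : D.Top a' b' f' h') :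
    D.mul (D.diagₗ a b c e f h v w) (D.diagₗ a' b' c' e' f' h' v' w') =
      D.gdiag (D.obj a ⊗ D.obj a') (D.obj b' ⊗ D.obj b) c e' f' h
        (v ≫ triMap (𝟙 _) (D.delta e c' ≫ v') (𝟙 _) ≫ (triAssoc _ _ _ _ _).hom)
        ((triAssoc _ _ _ _ _).inv ≫ triMap (𝟙 _) (w' ≫ D.delta h' f) (𝟙 _) ≫ w) := by
  rw [mul_diagₗ, D.gdiag_eq_sum (D.vtxResolution a a') (D.vtxResolution b' b)]
  refine Eq.symm ((Fintype.sum_sigma _).trans ?_)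
  refine Finset.sum_congr rfl fun k _ => Finset.sum_congr rfl fun α _ => ?_
  refine (Fintype.sum_sigma _).trans ?_
  refine Finset.sum_congr rfl fun s _ => Finset.sum_congr rfl fun ξ _ => ?_
  change D.diagₗ k s c e' f' h (_ ≫ triMap (dag (D.vtx a a' k α)) _ (dag (D.vtx b' b s ξ)))
    (triMap ((D.Y a a' k)⁻¹ • D.vtx a a' k α) _ ((D.Y b' b s)⁻¹ • D.vtx b' b s ξ) ≫ _) = _
  rw [triMap_smul_left, triMap_smul_right, smul_smul, Linear.smul_comp, map_smul]
  simp only [mulBot, mulTop, LinearMap.mk₂_apply, triMap, tensorHom_id, id_tensorHom,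
    Category.assoc]

end StringData

namespace StringData

open DaggerCategory UnitaryMultifusionCategory TwoSided
open scoped TensorProduct

variable {C : Type u} [Category.{v} C] [Preadditive C] [Linear ℂ C] [MonoidalCategory C]
  [MonoidalPreadditive C] [MonoidalLinear ℂ C] [RigidCategory C] [DaggerCategory C]
  [UnitaryMultifusionCategory C] (D : StringData C)

/-- The product stacks the second diagram inside the first. -/
lemma mul_gdiag (A B A' B' : C) (c e f h c' e' f' h' : D.L)
    (v : D.obj c ⟶ (A ⊗ D.obj e) ⊗ B) (w : (A ⊗ D.obj f) ⊗ B ⟶ D.obj h)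
    (v' : D.obj c' ⟶ (A' ⊗ D.obj e') ⊗ B') (w' : (A' ⊗ D.obj f') ⊗ B' ⟶ D.obj h') :
    D.mul (D.gdiag A B c e f h v w) (D.gdiag A' B' c' e' f' h' v' w') =
      D.gdiag (A ⊗ A') (B' ⊗ B) c e' f' h
        (v ≫ triMap (𝟙 _) (D.delta e c' ≫ v') (𝟙 _) ≫ (triAssoc _ _ _ _ _).hom)
        ((triAssoc _ _ _ _ _).inv ≫ triMap (𝟙 _) (w' ≫ D.delta h' f) (𝟙 _) ≫ w) := by
  rw [D.gdiag_def A B, D.gdiag_def A' B']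
  set R := D.resolution A
  set S := D.resolution B
  set R' := D.resolution A'
  set S' := D.resolution B'
  simp only [map_sum, LinearMap.sum_apply, mul_gdiag_obj]
  -- The projections on the four arcs are naturally moved to the outer ends of the nested half, slid
  -- to the other half, and paired there with the inclusions; the sums of these pairs are
  -- identities.
  have key : ∀ m n m' n',
      D.gdiag (D.obj (R.lab m) ⊗ D.obj (R'.lab m')) (D.obj (S'.lab n') ⊗ D.obj (S.lab n)) c e' f' h
        ((v ≫ triMap (R.prj m) (𝟙 _) (S.prj n)) ≫ triMap (𝟙 _)
          (D.delta e c' ≫ v' ≫ triMap (R'.prj m') (𝟙 _) (S'.prj n')) (𝟙 _) ≫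
            (triAssoc _ _ _ _ _).hom)
        ((triAssoc _ _ _ _ _).inv ≫ triMap (𝟙 _)
          ((triMap (R'.inc m') (𝟙 _) (S'.inc n') ≫ w') ≫ D.delta h' f) (𝟙 _) ≫
            triMap (R.inc m) (𝟙 _) (S.inc n) ≫ w) =
      D.gdiag (A ⊗ A') (B' ⊗ B) c e' f' h
        (v ≫ triMap (𝟙 _) (D.delta e c' ≫ v') (𝟙 _) ≫ (triAssoc _ _ _ _ _).hom)
        (triMap ((R.prj m ≫ R.inc m) ⊗ₘ (R'.prj m' ≫ R'.inc m')) (𝟙 _)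
          ((S'.prj n' ≫ S'.inc n') ⊗ₘ (S.prj n ≫ S.inc n)) ≫
        (triAssoc _ _ _ _ _).inv ≫ triMap (𝟙 _) (w' ≫ D.delta h' f) (𝟙 _) ≫ w) := by
    intro m n m' n'
    have h1 : (v ≫ triMap (R.prj m) (𝟙 _) (S.prj n)) ≫ triMap (𝟙 _)
          (D.delta e c' ≫ v' ≫ triMap (R'.prj m') (𝟙 _) (S'.prj n')) (𝟙 _) ≫
            (triAssoc _ _ _ _ _).hom =
        (v ≫ triMap (𝟙 _) (D.delta e c' ≫ v') (𝟙 _) ≫ (triAssoc _ _ _ _ _).hom) ≫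
          triMap (R.prj m ⊗ₘ R'.prj m') (𝟙 _) (S'.prj n' ⊗ₘ S.prj n) := by
      simp only [Category.assoc]
      rw [← triMap_triMap, triMap_comp_assoc, triMap_comp_assoc]
      simp
    have h2 : (triAssoc _ _ _ _ _).inv ≫ triMap (𝟙 _)
          ((triMap (R'.inc m') (𝟙 _) (S'.inc n') ≫ w') ≫ D.delta h' f) (𝟙 _) ≫
            triMap (R.inc m) (𝟙 _) (S.inc n) ≫ w =
        triMap (R.inc m ⊗ₘ R'.inc m') (𝟙 _) (S'.inc n' ⊗ₘ S.inc n) ≫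
        (triAssoc _ _ _ _ _).inv ≫ triMap (𝟙 _) (w' ≫ D.delta h' f) (𝟙 _) ≫ w := by
      rw [← reassoc_of% (triMap_triMap_inv (R.inc m) (R'.inc m') (𝟙 (D.obj f')) (S'.inc n')
        (S.inc n)), triMap_comp_assoc, triMap_comp_assoc]
      simp
    rw [h1, h2, gdiag_dinatural, triMap_comp_assoc, tensorHom_comp_tensorHom,
      tensorHom_comp_tensorHom, Category.comp_id]
  simp only [key, ← map_sum, ← Preadditive.sum_comp, ← triMap_sum_right, ← triMap_sum_left,
    ← tensor_sum, ← sum_tensor]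
  simp only [Resolution.complete, id_tensorHom_id, triMap_id, Category.id_comp]

@[simp]
lemma mul_gdiag_same (A B A' B' : C) (c e f h e' f' : D.L)
    (v : D.obj c ⟶ (A ⊗ D.obj e) ⊗ B) (w : (A ⊗ D.obj f) ⊗ B ⟶ D.obj h)
    (v' : D.obj e ⟶ (A' ⊗ D.obj e') ⊗ B') (w' : (A' ⊗ D.obj f') ⊗ B' ⟶ D.obj f) :
    D.mul (D.gdiag A B c e f h v w) (D.gdiag A' B' e e' f' f v' w') =
      D.gdiag (A ⊗ A') (B' ⊗ B) c e' f' h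
        (v ≫ triMap (𝟙 _) v' (𝟙 _) ≫ (triAssoc _ _ _ _ _).hom)
        ((triAssoc _ _ _ _ _).inv ≫ triMap (𝟙 _) w' (𝟙 _) ≫ w) := by
  simp [mul_gdiag]

lemma mul_gdiag_bot (A B A' B' : C) (c e f h c' e' f' h' : D.L) (hne : c' ≠ e)
    (v : D.obj c ⟶ (A ⊗ D.obj e) ⊗ B) (w : (A ⊗ D.obj f) ⊗ B ⟶ D.obj h)
    (v' : D.obj c' ⟶ (A' ⊗ D.obj e') ⊗ B') (w' : (A' ⊗ D.obj f') ⊗ B' ⟶ D.obj h') :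
    D.mul (D.gdiag A B c e f h v w) (D.gdiag A' B' c' e' f' h' v' w') = 0 := by
  simp [mul_gdiag, D.delta_of_ne hne.symm]

lemma mul_gdiag_top (A B A' B' : C) (c e f h c' e' f' h' : D.L) (hne : h' ≠ f)
    (v : D.obj c ⟶ (A ⊗ D.obj e) ⊗ B) (w : (A ⊗ D.obj f) ⊗ B ⟶ D.obj h)
    (v' : D.obj c' ⟶ (A' ⊗ D.obj e') ⊗ B') (w' : (A' ⊗ D.obj f') ⊗ B' ⟶ D.obj h') :
    D.mul (D.gdiag A B c e f h v w) (D.gdiag A' B' c' e' f' h' v' w') = 0 := by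
  simp [mul_gdiag, D.delta_of_ne hne]

lemma counit_diagₗ (a b c e f h : D.L) (v : D.Bot a b c e) (w : D.Top a b f h) :
    D.counit (D.diagₗ a b c e f h v w) =
      D.coeff h (D.delta h c ≫ v ≫ triMap (𝟙 _) (D.delta e f) (𝟙 _) ≫ w) := by
  simp only [counit, diagₗ, LinearMap.sum_apply, LinearMap.compr₂_apply, LinearMap.comp_apply,
    TensorProduct.mk_apply, LinearMap.coe_proj, Function.eval, LinearMap.coe_single]
  rw [Finset.sum_eq_single (⟨a, b, c, e, f, h⟩ : TubeLabel D.L)]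
  · rw [Pi.single_eq_same]
    simp only [counitSector, TensorProduct.lift.tmul, LinearMap.mk₂_apply, triMap, tensorHom_id,
      id_tensorHom]
  · intro l _ hl
    rw [Pi.single_eq_of_ne hl, map_zero]
  · simp

lemma counit_gdiag (A B : C) (c e f h : D.L)
    (v : D.obj c ⟶ (A ⊗ D.obj e) ⊗ B) (w : (A ⊗ D.obj f) ⊗ B ⟶ D.obj h) :
    D.counit (D.gdiag A B c e f h v w) =
      D.coeff h (D.delta h c ≫ v ≫ triMap (𝟙 _) (D.delta e f) (𝟙 _) ≫ w) := by
  rw [gdiag_def]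
  simp only [map_sum, counit_diagₗ]
  simp only [← map_sum, Category.assoc, triMap_comp_assoc, ← Preadditive.comp_sum,
    ← Preadditive.sum_comp, Category.id_comp, Category.comp_id]
  congr 3
  simp only [← triMap_sum_right, ← triMap_sum_left, Resolution.complete]

/-- The two parallel moves in the definition are exactly the resolution of `(a ⊗ i) ⊗ b` by pairs of
vertices. -/
lemma comul_diagₗ (a b c e f h : D.L) (v : D.Bot a b c e) (w : D.Top a b f h) :
    D.comul (D.diagₗ a b c e f h v w) = ∑ i, ∑ m,
      D.diagₗ a b ((D.triResolution a b i).lab m) i f h ((D.triResolution a b i).inc m) w ⊗ₜ[ℂ]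
        D.diagₗ a b c e i ((D.triResolution a b i).lab m) v ((D.triResolution a b i).prj m) := by
  have h1 : D.comul (D.diagₗ a b c e f h v w) = D.comulSector ⟨a, b, c, e, f, h⟩ (v ⊗ₜ[ℂ] w) := by
    simp only [comul, diagₗ, LinearMap.sum_apply, LinearMap.compr₂_apply, LinearMap.comp_apply,
      TensorProduct.mk_apply, LinearMap.coe_proj, Function.eval, LinearMap.coe_single]
    rw [Finset.sum_eq_single (⟨a, b, c, e, f, h⟩ : TubeLabel D.L)]
    · rw [Pi.single_eq_same]
    · intro l _ hl
      rw [Pi.single_eq_of_ne hl, map_zero]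
    · simp
  rw [h1]
  simp only [comulSector, LinearMap.sum_apply, LinearMap.smul_apply, LinearMap.comp_apply,
    LinearEquiv.coe_coe, TensorProduct.comm_tmul, TensorProduct.map_tmul, LinearMap.flip_apply]
  refine Finset.sum_congr rfl fun i _ => ?_
  refine Eq.symm ((Fintype.sum_sigma _).trans (Finset.sum_congr rfl fun j _ => ?_))
  refine (Fintype.sum_sigma _).trans (Finset.sum_congr rfl fun k _ => ?_)
  refine (Fintype.sum_prod_type _).trans
    (Finset.sum_congr rfl fun ρ _ => Finset.sum_congr rfl fun σ _ => ?_)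
  change D.diagₗ a b k i f h (((D.Y a i j)⁻¹ * (D.Y j b k)⁻¹) • _) w ⊗ₜ[ℂ] _ = _
  rw [map_smul, LinearMap.smul_apply, TensorProduct.smul_tmul']
  rfl

/-- `gdiag` with one half fixed on each side, as a bilinear map in the other two halves. -/
noncomputable def comulForm (A B : C) (c e f h i k : D.L) (v : D.obj c ⟶ (A ⊗ D.obj e) ⊗ B)
    (w : (A ⊗ D.obj f) ⊗ B ⟶ D.obj h) :
    (D.obj k ⟶ (A ⊗ D.obj i) ⊗ B) →ₗ[ℂ] ((A ⊗ D.obj i) ⊗ B ⟶ D.obj k) →ₗ[ℂ]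
      D.Tube ⊗[ℂ] D.Tube :=
  (TensorProduct.mk ℂ D.Tube D.Tube).compl₁₂ ((D.gdiag A B k i f h).flip w)
    (D.gdiag A B c e i k v)

/-- The comultiplication cuts a diagram along any resolution. -/
lemma comul_gdiag (A B : C) (R : ∀ i, D.Resolution ((A ⊗ D.obj i) ⊗ B)) (c e f h : D.L)
    (v : D.obj c ⟶ (A ⊗ D.obj e) ⊗ B) (w : (A ⊗ D.obj f) ⊗ B ⟶ D.obj h) :
    D.comul (D.gdiag A B c e f h v w) = ∑ i, ∑ m,
      D.gdiag A B ((R i).lab m) i f h ((R i).inc m) w ⊗ₜ[ℂ]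
        D.gdiag A B c e i ((R i).lab m) v ((R i).prj m) := by
  -- This resolution first splits the arcs into simple ones and then uses pairs of vertices, so that
  -- cutting along it matches the coproducts of the simple summands term by term. Passing from `R`
  -- to it is allowed because the two pieces depend bilinearly on the inclusion and the projection.
  set S : ∀ i, D.Resolution ((A ⊗ D.obj i) ⊗ B) := fun i =>
    Resolution.triOuter (D.obj i) (D.resolution A) (D.resolution B)
      (fun m n => D.triResolution _ _ i) with hS
  have hRS : ∀ i, ∑ m, D.gdiag A B ((R i).lab m) i f h ((R i).inc m) w ⊗ₜ[ℂ]
        D.gdiag A B c e i ((R i).lab m) v ((R i).prj m) =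
      ∑ m, D.gdiag A B ((S i).lab m) i f h ((S i).inc m) w ⊗ₜ[ℂ]
        D.gdiag A B c e i ((S i).lab m) v ((S i).prj m) := fun i =>
    D.sum_resolution_eq (fun k => D.comulForm A B c e f h i k v w) (R i) (S i)
  simp only [hRS]
  rw [gdiag_def]
  simp only [map_sum, comul_diagₗ]
  have h1 : ∀ i, ∑ m, D.gdiag A B ((S i).lab m) i f h ((S i).inc m) w ⊗ₜ[ℂ]
        D.gdiag A B c e i ((S i).lab m) v ((S i).prj m) = 
      ∑ m, ∑ n, ∑ x, D.diagₗ ((D.resolution A).lab m) ((D.resolution B).lab n)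
          ((D.triResolution _ _ i).lab x) i f h
          ((D.triResolution _ _ i).inc x)
          (triMap ((D.resolution A).inc m) (𝟙 _) ((D.resolution B).inc n) ≫ w) ⊗ₜ[ℂ]
        D.diagₗ ((D.resolution A).lab m) ((D.resolution B).lab n) c e i
          ((D.triResolution _ _ i).lab x)
          (v ≫ triMap ((D.resolution A).prj m) (𝟙 _) ((D.resolution B).prj n))
          ((D.triResolution _ _ i).prj x) := by
    intro i
    refine (Fintype.sum_sigma _).trans ((Fintype.sum_prod_type _).trans ?_)
    refine Finset.sum_congr rfl fun m _ => Finset.sum_congr rfl fun n _ =>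
      Finset.sum_congr rfl fun x _ => ?_
    exact congrArg₂ (· ⊗ₜ[ℂ] ·) ((D.gdiag_dinatural _ _ _ _ _ _ _ _).trans (D.gdiag_obj ..))
      ((D.gdiag_dinatural _ _ _ _ _ _ _ _).symm.trans (D.gdiag_obj ..))
  simp only [h1]
  rw [Finset.sum_comm_cycle]

/-- The unit diagram with upper wall `x` and lower wall `y`. -/
noncomputable def unitDiag (y x : D.L) : D.Tube :=
  D.gdiag (𝟙_ C) (𝟙_ C) y y x x (triUnitor _).inv (triUnitor _).hom

/-- The summands of the tensor unit form a resolution of `𝟙`, so the double sum over them assembles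
into one diagram with both arcs `𝟙`. -/
lemma one_eq : D.one = ∑ x, ∑ y, D.unitDiag y x := by
  refine Finset.sum_congr rfl fun x _ => Finset.sum_congr rfl fun y _ => ?_
  rw [unitDiag, D.gdiag_eq_sum D.unitResolution D.unitResolution]
  refine Finset.sum_congr rfl fun i _ => Finset.sum_congr rfl fun j _ => ?_
  change _ = D.diagₗ (D.unit i) (D.unit j) y y x x
    (_ ≫ triMap (dag (D.unitIncl i)) (𝟙 _) (dag (D.unitIncl j)))
    (triMap (D.unitIncl i) (𝟙 _) (D.unitIncl j) ≫ _)
  simp only [triMap, triUnitor, Iso.trans_inv, Iso.trans_hom, whiskerRightIso_inv,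
    whiskerRightIso_hom, tensorHom_id, Category.assoc, diagₗ_apply]

end StringData

/-! ### Further coherence of the two-sided associator -/

namespace TwoSided

variable {C : Type u} [Category.{v} C] [MonoidalCategory C]

lemma triAssoc_hom_triMap_mid (A A' B' B : C) {X Y : C} (f : X ⟶ Y) :
    (triAssoc A A' X B' B).hom ≫ triMap (𝟙 _) f (𝟙 _) =
      triMap (𝟙 A) (triMap (𝟙 A') f (𝟙 B')) (𝟙 B) ≫ (triAssoc A A' Y B' B).hom := by
  rw [triMap_triMap, id_tensorHom_id, id_tensorHom_id]

lemma triMap_mid_triAssoc_inv (A A' B' B : C) {X Y : C} (f : X ⟶ Y) :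
    triMap (𝟙 _) f (𝟙 _) ≫ (triAssoc A A' Y B' B).inv =
      (triAssoc A A' X B' B).inv ≫ triMap (𝟙 A) (triMap (𝟙 A') f (𝟙 B')) (𝟙 B) := by
  rw [triMap_triMap_inv, id_tensorHom_id, id_tensorHom_id]

lemma triAssoc_inv_triAssoc_inv (A A' A'' X B'' B' B : C) :
    (triAssoc A (A' ⊗ A'') X (B'' ⊗ B') B).inv ≫
      triMap (𝟙 A) (triAssoc A' A'' X B'' B').inv (𝟙 B) =
    triMap (α_ A A' A'').inv (𝟙 X) (α_ B'' B' B).hom ≫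
      (triAssoc (A ⊗ A') A'' X B'' (B' ⊗ B)).inv ≫
        (triAssoc A A' ((A'' ⊗ X) ⊗ B'') B' B).inv := by
  simp only [triMap, StringData.reassoc, Iso.trans_inv, whiskerRightIso_inv, Iso.symm_inv]
  monoidal

end TwoSided

namespace StringData

open DaggerCategory UnitaryMultifusionCategory TwoSided
open scoped TensorProduct

variable {C : Type u} [Category.{v} C] [Preadditive C] [Linear ℂ C] [MonoidalCategory C]
  [MonoidalPreadditive C] [MonoidalLinear ℂ C] [RigidCategory C] [DaggerCategory C]
  [UnitaryMultifusionCategory C] (D : StringData C)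

lemma tube_induction {P : D.Tube → Prop} (zero : P 0) (add : ∀ x y, P x → P y → P (x + y))
    (diag : ∀ a b c e f h (v : D.Bot a b c e) (w : D.Top a b f h),
      P (D.gdiag (D.obj a) (D.obj b) c e f h v w)) (x : D.Tube) : P x := by
  have hs : ∀ l (t : D.Sector l), P (Pi.single l t) := by
    intro l t
    induction t using TensorProduct.induction_on with
    | zero => simpa using zero
    | tmul v w =>
      have := diag l.a l.b l.c l.e l.f l.h v w
      rw [gdiag_obj] at this
      exact this
    | add s t hs ht => rw [Pi.single_add]; exact add _ _ hs ht
  rw [← Finset.univ_sum_single x]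
  exact Finset.sum_induction _ P add zero fun l _ => hs l (x l)

/-! ### Product and unit -/

/-- Both bracketings nest the same three diagrams. The pentagon leaves associators on the arcs of
the lower half, and sliding these to the upper half matches the other side. -/
lemma mul_assoc_tube (x y z : D.Tube) : D.mul (D.mul x y) z = D.mul x (D.mul y z) := by
  induction x using D.tube_induction with
  | zero => simp
  | add x x' hx hx' => simp [hx, hx']
  | diag a b c e f h v w =>
  induction y using D.tube_induction with
  | zero => simp
  | add y y' hy hy' => simp [hy, hy']
  | diag a' b' c' e' f' h' v' w' =>
  induction z using D.tube_induction with
  | zero => simp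
  | add z z' hz hz' => simp [hz, hz']
  | diag a'' b'' c'' e'' f'' h'' v'' w'' =>
  simp only [mul_gdiag, Category.assoc]
  have h1 : v ≫ triMap (𝟙 (D.obj a)) (D.delta e c' ≫ v' ≫
        triMap (𝟙 _) (D.delta e' c'' ≫ v'') (𝟙 _) ≫ (triAssoc _ _ _ _ _).hom) (𝟙 (D.obj b)) ≫
        (triAssoc _ _ _ _ _).hom =
      (v ≫ triMap (𝟙 (D.obj a)) (D.delta e c' ≫ v') (𝟙 (D.obj b)) ≫ (triAssoc _ _ _ _ _).hom ≫
        triMap (𝟙 _) (D.delta e' c'' ≫ v'') (𝟙 _) ≫ (triAssoc _ _ _ _ _).hom) ≫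
          triMap (α_ _ _ _).hom (𝟙 _) (α_ _ _ _).inv := by
    have : triMap (𝟙 (D.obj a)) (D.delta e c' ≫ v' ≫
        triMap (𝟙 (D.obj a')) (D.delta e' c'' ≫ v'') (𝟙 (D.obj b')) ≫ (triAssoc _ _ _ _ _).hom)
          (𝟙 (D.obj b)) = triMap (𝟙 (D.obj a)) (D.delta e c' ≫ v') (𝟙 (D.obj b)) ≫
        triMap (𝟙 (D.obj a)) (triMap (𝟙 (D.obj a')) (D.delta e' c'' ≫ v'') (𝟙 (D.obj b')))
          (𝟙 (D.obj b)) ≫ triMap (𝟙 (D.obj a)) (triAssoc _ _ _ _ _).hom (𝟙 (D.obj b)) := by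
      simp
    rw [this]
    simp only [Category.assoc]
    rw [triAssoc_triAssoc, ← reassoc_of% triAssoc_hom_triMap_mid]
  rw [h1, gdiag_dinatural]
  congr 1
  have : triMap (𝟙 (D.obj a)) ((triAssoc (D.obj a') (D.obj a'') (D.obj f'') (D.obj b'')
      (D.obj b')).inv ≫ triMap (𝟙 (D.obj a')) (w'' ≫ D.delta h'' f') (𝟙 (D.obj b')) ≫
        w' ≫ D.delta h' f) (𝟙 (D.obj b)) =
      triMap (𝟙 (D.obj a)) (triAssoc (D.obj a') (D.obj a'') (D.obj f'') (D.obj b'')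
        (D.obj b')).inv (𝟙 (D.obj b)) ≫
      triMap (𝟙 (D.obj a)) (triMap (𝟙 (D.obj a')) (w'' ≫ D.delta h'' f') (𝟙 (D.obj b')))
        (𝟙 (D.obj b)) ≫ triMap (𝟙 (D.obj a)) (w' ≫ D.delta h' f) (𝟙 (D.obj b)) := by
    simp
  rw [this]
  simp only [Category.assoc]
  rw [reassoc_of% triAssoc_inv_triAssoc_inv, reassoc_of% triMap_mid_triAssoc_inv]
  simp

/-- When the walls match, the product has arcs `𝟙 ⊗ A` and `B ⊗ 𝟙`; the triangle identities exhibit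
unitors on the arcs, and these cancel after sliding from one half to the other. -/
lemma unitDiag_mul (y x c e f h : D.L) (A B : C) (v : D.obj c ⟶ (A ⊗ D.obj e) ⊗ B)
    (w : (A ⊗ D.obj f) ⊗ B ⟶ D.obj h) :
    D.mul (D.unitDiag y x) (D.gdiag A B c e f h v w) =
      if y = c ∧ x = h then D.gdiag A B c e f h v w else 0 := by
  by_cases hy : y = c
  · subst hy
    by_cases hx : x = h
    · subst hx
      rw [if_pos ⟨rfl, rfl⟩, unitDiag, mul_gdiag_same, reassoc_of% triUnitor_inv_triMap,
        triMap_triUnitor, ← triAssoc_unit_left]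
      simp only [Category.assoc, Iso.inv_hom_id_assoc]
      rw [← gdiag_dinatural]
      congr 2
      simp only [Category.assoc]
      rw [triAssoc_unit_left, Iso.inv_hom_id, Category.comp_id]
    · rw [if_neg (by tauto), unitDiag, mul_gdiag_top _ _ _ _ _ _ _ _ _ _ _ _ _ (Ne.symm hx)]
  · rw [if_neg (by tauto), unitDiag, mul_gdiag_bot _ _ _ _ _ _ _ _ _ _ _ _ _ (Ne.symm hy)]

lemma mul_unitDiag (y x c e f h : D.L) (A B : C) (v : D.obj c ⟶ (A ⊗ D.obj e) ⊗ B)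
    (w : (A ⊗ D.obj f) ⊗ B ⟶ D.obj h) :
    D.mul (D.gdiag A B c e f h v w) (D.unitDiag y x) =
      if y = e ∧ x = f then D.gdiag A B c e f h v w else 0 := by
  by_cases hy : y = e
  · subst hy
    by_cases hx : x = f
    · subst hx
      rw [if_pos ⟨rfl, rfl⟩, unitDiag, mul_gdiag_same, ← triAssoc_unit_right]
      simp only [Category.assoc, Iso.inv_hom_id_assoc]
      rw [← gdiag_dinatural]
      congr 2
      simp only [Category.assoc]
      rw [triAssoc_unit_right, triMap_comp, Iso.inv_hom_id]
      simp
    · rw [if_neg (by tauto), unitDiag, mul_gdiag_top _ _ _ _ _ _ _ _ _ _ _ _ _ hx]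
  · rw [if_neg (by tauto), unitDiag, mul_gdiag_bot _ _ _ _ _ _ _ _ _ _ _ _ _ hy]

lemma sum_ite_pair {M : Type*} [AddCommMonoid M] (x₀ y₀ : D.L) (t : M) :
    ∑ x : D.L, ∑ y : D.L, (if y = y₀ ∧ x = x₀ then t else 0) = t := by
  simp [ite_and]

lemma one_mul_tube (x : D.Tube) : D.mul D.one x = x := by
  induction x using D.tube_induction with
  | zero => simp
  | add x x' hx hx' => simp [hx, hx']
  | diag a b c e f h v w =>
  simp only [one_eq, map_sum, LinearMap.sum_apply, unitDiag_mul, sum_ite_pair]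

lemma mul_one_tube (x : D.Tube) : D.mul x D.one = x := by
  induction x using D.tube_induction with
  | zero => simp
  | add x x' hx hx' => simp [hx, hx']
  | diag a b c e f h v w =>
  simp only [one_eq, map_sum, mul_unitDiag, sum_ite_pair]

/-! ### Coproduct and counit -/

/-- By Schur's lemma a number produced by the counit can be traded for a morphism composed onto a
half-diagram. Only in that form can the sum over a resolution be carried out. -/
lemma coeff_smul_gdiag_top {A B : C} (c e f k h : D.L) (v : D.obj c ⟶ (A ⊗ D.obj e) ⊗ B)
    (p : (A ⊗ D.obj f) ⊗ B ⟶ D.obj k) (φ : D.obj k ⟶ D.obj h) :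
    D.coeff h (D.delta h k ≫ φ) • D.gdiag A B c e f k v p = D.gdiag A B c e f h v (p ≫ φ) := by
  by_cases hk : k = h
  · subst hk
    obtain ⟨z, rfl⟩ := (D.simple k).exists_smul φ
    simp
  · simp [D.hom_eq_zero hk φ]

lemma coeff_smul_gdiag_bot {A B : C} (c e f k h : D.L) (φ : D.obj c ⟶ D.obj k)
    (u : D.obj k ⟶ (A ⊗ D.obj e) ⊗ B) (w : (A ⊗ D.obj f) ⊗ B ⟶ D.obj h) :
    D.coeff k (D.delta k c ≫ φ) • D.gdiag A B k e f h u w = D.gdiag A B c e f h (φ ≫ u) w := by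
  by_cases hk : c = k
  · subst hk
    obtain ⟨z, rfl⟩ := (D.simple c).exists_smul φ
    simp
  · simp [D.hom_eq_zero hk φ]

lemma sum_comm_sigma {ι κ M : Type*} {α : ι → Type*} {β : κ → Type*} [Fintype ι] [Fintype κ]
    [∀ i, Fintype (α i)] [∀ j, Fintype (β j)] [AddCommMonoid M]
    (F : ∀ i, α i → ∀ j, β j → M) :
    ∑ i, ∑ m, ∑ j, ∑ n, F i m j n = ∑ j, ∑ n, ∑ i, ∑ m, F i m j n := by
  have := Finset.sum_comm (s := (Finset.univ : Finset (Σ i, α i)))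
    (t := (Finset.univ : Finset (Σ j, β j))) (f := fun p q => F p.1 p.2 q.1 q.2)
  simpa only [Fintype.sum_sigma] using this

/-- Cutting twice along the same resolutions gives the same triple sum from either end; only the
order of summation differs. -/
lemma coassoc_tube (x : D.Tube) : TensorProduct.assoc ℂ _ _ _ (D.comul.rTensor _ (D.comul x)) =
    D.comul.lTensor _ (D.comul x) := by
  induction x using D.tube_induction with
  | zero => simp
  | add x x' hx hx' => simp [hx, hx']
  | diag a b c e f h v w =>
  have H := fun c e f h v w => D.comul_gdiag (D.obj a) (D.obj b) (fun i => D.triResolution a b i)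
    c e f h v w
  simp only [H, map_sum, LinearMap.rTensor_tmul, LinearMap.lTensor_tmul, TensorProduct.sum_tmul,
    TensorProduct.tmul_sum, TensorProduct.assoc_tmul]
  exact sum_comm_sigma _

/-- The number read off from the first piece is absorbed into the upper half of the second. The new
wall must be `f`, and the pieces of the resolution recombine to the identity. -/
lemma counit_comul_tube (x : D.Tube) :
    TensorProduct.lid ℂ _ (D.counit.rTensor _ (D.comul x)) = x := by
  induction x using D.tube_induction with
  | zero => simp
  | add x x' hx hx' => simp [hx, hx']
  | diag a b c e f h v w =>
  rw [D.comul_gdiag (D.obj a) (D.obj b) (fun i => D.triResolution a b i)]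
  simp only [map_sum, LinearMap.rTensor_tmul, TensorProduct.lid_tmul, counit_gdiag]
  simp only [coeff_smul_gdiag_top]
  rw [Finset.sum_eq_single f]
  · simp only [delta_self, triMap_id, Category.id_comp, ← map_sum, Resolution.sum_comp_left]
  · intro i _ hi
    simp [D.delta_of_ne hi]
  · simp

lemma comul_counit_tube (x : D.Tube) :
    TensorProduct.rid ℂ _ (D.counit.lTensor _ (D.comul x)) = x := by
  induction x using D.tube_induction with
  | zero => simp
  | add x x' hx hx' => simp [hx, hx']
  | diag a b c e f h v w =>
  rw [D.comul_gdiag (D.obj a) (D.obj b) (fun i => D.triResolution a b i)]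
  simp only [map_sum, LinearMap.lTensor_tmul, TensorProduct.rid_tmul, counit_gdiag]
  simp only [coeff_smul_gdiag_bot]
  rw [Finset.sum_eq_single e]
  · simp only [delta_self, triMap_id, Category.id_comp, ← map_sum, ← LinearMap.sum_apply, 
      Resolution.sum_comp_right]
  · intro i _ hi
    simp [D.delta_of_ne hi.symm]
  · simp

end StringData

/-! ### Multiplicativity of the coproduct and the weak axioms for unit and counit -/

namespace StringData

open DaggerCategory UnitaryMultifusionCategory TwoSided
open scoped TensorProduct

variable {C : Type u} [Category.{v} C] [Preadditive C] [Linear ℂ C] [MonoidalCategory C]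
  [MonoidalPreadditive C] [MonoidalLinear ℂ C] [RigidCategory C] [DaggerCategory C]
  [UnitaryMultifusionCategory C] (D : StringData C)

/-- The nested diagram is cut along an adapted resolution: first the inner product with the arcs of
`y`, then the outer one with the arcs of `x`. Its terms are the products of the pieces of `x` and
`y`. -/
lemma comul_mul_tube (x y : D.Tube) :
    D.comul (D.mul x y) = TensorProduct.map₂ D.mul D.mul (D.comul x) (D.comul y) := by
  induction x using D.tube_induction with
  | zero => simp
  | add x x' hx hx' => simp [hx, hx']
  | diag a b c e f h v w =>
  induction y using D.tube_induction with
  | zero => simp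
  | add y y' hy hy' => simp [hy, hy']
  | diag a' b' c' e' f' h' v' w' =>
  rw [mul_gdiag, D.comul_gdiag (D.obj a) (D.obj b) (fun i => D.triResolution a b i),
    D.comul_gdiag (D.obj a') (D.obj b') (fun i => D.triResolution a' b' i),
    D.comul_gdiag (D.obj a ⊗ D.obj a') (D.obj b' ⊗ D.obj b)
      (fun i => ((D.triResolution a' b' i).triMid (D.obj a) (D.obj b)
        (fun m => D.triResolution a b _)).ofIso (triAssoc _ _ _ _ _))]
  simp only [map_sum, LinearMap.sum_apply, TensorProduct.map₂_apply_tmul, TensorProduct.map_tmul,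
    mul_gdiag]
  refine Finset.sum_congr rfl fun i _ => (Fintype.sum_sigma _).trans
    (Finset.sum_congr rfl fun m _ => ?_)
  -- The wall inserted into `x` has to carry the outer label of the cut through `y`; every other
  -- term contains a vanishing `delta`.
  rw [Finset.sum_eq_single ((D.triResolution a' b' i).lab m)]
  · refine Finset.sum_congr rfl fun n _ => ?_
    rw [delta_self]
    simp only [Category.id_comp, Category.comp_id]
    refine congrArg₂ (fun s t => D.gdiag _ _ _ _ _ _ s _ ⊗ₜ[ℂ] D.gdiag _ _ _ _ _ _ _ t) ?_ ?_
    · simp [Resolution.ofIso, Resolution.triMid]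
    · simp [Resolution.ofIso, Resolution.triMid]
  · intro j _ hj
    refine Finset.sum_eq_zero fun n _ => ?_
    simp [D.delta_of_ne hj]
  · simp

/-- With unit arcs, `(𝟙 ⊗ i) ⊗ 𝟙` is already simple, so each inserted wall `i` contributes a single
term. -/
lemma comul_unitDiag (y x : D.L) :
    D.comul (D.unitDiag y x) = ∑ i, D.unitDiag i x ⊗ₜ[ℂ] D.unitDiag y i := by
  rw [unitDiag, D.comul_gdiag _ _ (fun i => (D.simpleResolution i).ofIso (triUnitor _).symm)]
  refine Finset.sum_congr rfl fun i _ => (Finset.sum_singleton _ ()).trans ?_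
  refine congrArg₂ (fun s t => D.gdiag _ _ _ _ _ _ s _ ⊗ₜ[ℂ] D.gdiag _ _ _ _ _ _ _ t) ?_ ?_
  · simp [Resolution.ofIso, simpleResolution]
  · simp [Resolution.ofIso, simpleResolution]

lemma unitDiag_mul_unitDiag (y x y' x' : D.L) :
    D.mul (D.unitDiag y x) (D.unitDiag y' x') =
      if y = y' ∧ x = x' then D.unitDiag y' x' else 0 :=
  D.unitDiag_mul ..

lemma comul_one_eq : D.comul D.one = ∑ x, ∑ y, ∑ i, D.unitDiag i x ⊗ₜ[ℂ] D.unitDiag y i := by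
  simp only [one_eq, map_sum, comul_unitDiag]

lemma comul_comul_one : TensorProduct.assoc ℂ _ _ _ (D.comul.rTensor _ (D.comul D.one)) =
    ∑ x, ∑ y, ∑ i, ∑ j, D.unitDiag j x ⊗ₜ[ℂ] (D.unitDiag i j ⊗ₜ[ℂ] D.unitDiag y i) := by
  simp only [comul_one_eq, map_sum, LinearMap.rTensor_tmul, comul_unitDiag,
    TensorProduct.sum_tmul, TensorProduct.assoc_tmul]

/-- The unit diagrams are pairwise orthogonal idempotents. In the middle tensor factor their
products force the labels of the two copies of `Δ(1)` to chain together. -/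
lemma comul_one_mul_tube : TensorProduct.assoc ℂ _ _ _ (D.comul.rTensor _ (D.comul D.one)) =
    TensorProduct.map₂ D.mul (TensorProduct.map₂ D.mul D.mul)
      (TensorProduct.assoc ℂ _ _ _ (D.comul D.one ⊗ₜ[ℂ] D.one)) (D.one ⊗ₜ[ℂ] D.comul D.one) := by
  rw [comul_comul_one, comul_one_eq]
  simp only [map_sum, TensorProduct.sum_tmul, TensorProduct.tmul_sum, TensorProduct.assoc_tmul,
    LinearMap.sum_apply, TensorProduct.map₂_apply_tmul, TensorProduct.map_tmul, mul_one_tube,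
    one_mul_tube, unitDiag_mul_unitDiag]
  simp only [ite_and, TensorProduct.ite_tmul, TensorProduct.tmul_ite, Finset.sum_ite_eq',
    Finset.mem_univ, if_true, Finset.sum_ite_irrel, Finset.sum_const_zero]
  calc _ = ∑ x, ∑ j, ∑ y, ∑ i,
        D.unitDiag j x ⊗ₜ[ℂ] (D.unitDiag i j ⊗ₜ[ℂ] D.unitDiag y i) := by
        refine Finset.sum_congr rfl fun x _ => ?_
        rw [Finset.sum_comm_cycle, Finset.sum_comm_cycle]
    _ = ∑ j, ∑ x, ∑ y, ∑ i,
        D.unitDiag j x ⊗ₜ[ℂ] (D.unitDiag i j ⊗ₜ[ℂ] D.unitDiag y i) := Finset.sum_comm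
    _ = _ := Finset.sum_congr rfl fun j _ => by
        rw [Finset.sum_comm_cycle, Finset.sum_comm_cycle]

lemma one_comul_mul_tube : TensorProduct.assoc ℂ _ _ _ (D.comul.rTensor _ (D.comul D.one)) =
    TensorProduct.map₂ D.mul (TensorProduct.map₂ D.mul D.mul)
      (D.one ⊗ₜ[ℂ] D.comul D.one) (TensorProduct.assoc ℂ _ _ _ (D.comul D.one ⊗ₜ[ℂ] D.one)) := by
  rw [comul_comul_one, comul_one_eq]
  simp only [map_sum, TensorProduct.sum_tmul, TensorProduct.tmul_sum, TensorProduct.assoc_tmul,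
    LinearMap.sum_apply, TensorProduct.map₂_apply_tmul, TensorProduct.map_tmul, mul_one_tube,
    one_mul_tube, unitDiag_mul_unitDiag]
  simp only [ite_and, TensorProduct.ite_tmul, TensorProduct.tmul_ite, Finset.sum_ite_eq',
    Finset.mem_univ, if_true, Finset.sum_ite_irrel, Finset.sum_const_zero]
  exact Finset.sum_congr rfl fun x _ => by rw [Finset.sum_comm_cycle, Finset.sum_comm_cycle]

/-- The associators of the two halves meet and cancel, so the counit of a product is a nested
evaluation without any reference to the fused arcs. -/
lemma counit_mul_gdiag (A B A' B' : C) (c e f h c' e' f' h' : D.L)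
    (v : D.obj c ⟶ (A ⊗ D.obj e) ⊗ B) (w : (A ⊗ D.obj f) ⊗ B ⟶ D.obj h)
    (v' : D.obj c' ⟶ (A' ⊗ D.obj e') ⊗ B') (w' : (A' ⊗ D.obj f') ⊗ B' ⟶ D.obj h') :
    D.counit (D.mul (D.gdiag A B c e f h v w) (D.gdiag A' B' c' e' f' h' v' w')) =
      D.coeff h (D.delta h c ≫ v ≫ triMap (𝟙 _) (D.delta e c' ≫ v' ≫
        triMap (𝟙 _) (D.delta e' f') (𝟙 _) ≫ w' ≫ D.delta h' f) (𝟙 _) ≫ w) := by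
  rw [mul_gdiag, counit_gdiag]
  simp only [Category.assoc]
  rw [reassoc_of% triAssoc_hom_triMap_mid, Iso.hom_inv_id_assoc]
  simp

lemma coeff_smul_delta_comp {Z : C} (c e k : D.L) (ψ : D.obj c ⟶ D.obj k) (u : D.obj k ⟶ Z) :
    D.coeff k (D.delta k c ≫ ψ) • (D.delta e k ≫ u) = D.delta e c ≫ ψ ≫ u := by
  by_cases hk : c = k
  · subst hk
    obtain ⟨z, rfl⟩ := (D.simple c).exists_smul ψ
    simp
  · simp [D.hom_eq_zero hk ψ]

lemma coeff_smul_comp_delta {Z : C} (h f k : D.L) (ψ : D.obj k ⟶ D.obj h) (p : Z ⟶ D.obj k) :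
    D.coeff h (D.delta h k ≫ ψ) • (p ≫ D.delta k f) = p ≫ ψ ≫ D.delta h f := by
  by_cases hk : k = h
  · subst hk
    obtain ⟨z, rfl⟩ := (D.simple k).exists_smul ψ
    simp
  · simp [D.hom_eq_zero hk ψ]

lemma sum_delta_comp_delta (x y : D.L) : ∑ i, D.delta x i ≫ D.delta i y = D.delta x y := by
  rw [Finset.sum_eq_single x]
  · simp
  · intro i _ hi
    simp [D.delta_of_ne hi.symm]
  · simp

lemma counit_mul_mul_gdiag (A B A' B' A'' B'' : C) (c e f h c' e' f' h' c'' e'' f'' h'' : D.L)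
    (v : D.obj c ⟶ (A ⊗ D.obj e) ⊗ B) (w : (A ⊗ D.obj f) ⊗ B ⟶ D.obj h)
    (v' : D.obj c' ⟶ (A' ⊗ D.obj e') ⊗ B') (w' : (A' ⊗ D.obj f') ⊗ B' ⟶ D.obj h')
    (v'' : D.obj c'' ⟶ (A'' ⊗ D.obj e'') ⊗ B'') (w'' : (A'' ⊗ D.obj f'') ⊗ B'' ⟶ D.obj h'') :
    D.counit (D.mul (D.mul (D.gdiag A B c e f h v w) (D.gdiag A' B' c' e' f' h' v' w'))
      (D.gdiag A'' B'' c'' e'' f'' h'' v'' w'')) =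
      D.coeff h (D.delta h c ≫ v ≫ triMap (𝟙 _) (D.delta e c' ≫ v' ≫
        triMap (𝟙 _) (D.delta e' c'' ≫ v'' ≫ triMap (𝟙 _) (D.delta e'' f'') (𝟙 _) ≫
          w'' ≫ D.delta h'' f') (𝟙 _) ≫ w' ≫ D.delta h' f) (𝟙 _) ≫ w) := by
  rw [mul_gdiag, counit_mul_gdiag]
  simp only [Category.assoc]
  rw [reassoc_of% triAssoc_hom_triMap_mid, Iso.hom_inv_id_assoc]
  simp

/-- `z ↦ coeff (δ ≫ v ≫ (𝟙 ⊗ z ⊗ 𝟙) ≫ w)` as a linear map. -/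
noncomputable def coeffMid {A B : C} (c e f h : D.L) (v : D.obj c ⟶ (A ⊗ D.obj e) ⊗ B)
    (w : (A ⊗ D.obj f) ⊗ B ⟶ D.obj h) : (D.obj e ⟶ D.obj f) →ₗ[ℂ] ℂ where
  toFun g := D.coeff h (D.delta h c ≫ v ≫ triMap (𝟙 _) g (𝟙 _) ≫ w)
  map_add' _ _ := by simp [triMap_add_mid]
  map_smul' _ _ := by simp

/-- In each term of the coproduct of `y` the scalar from the inner evaluation merges, by Schur's
lemma, into the outer one. There the projection meets its inclusion, the resolution sums to the
identity, and the sum over `i` joins the two `delta`s. The other order of the legs differs only in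
which end of the wall absorbs the scalar. -/
lemma counit_mul_tube (x y z : D.Tube) : D.counit (D.mul (D.mul x y) z) =
    TensorProduct.lid ℂ ℂ (TensorProduct.map (D.counit ∘ₗ D.mul x) (D.counit ∘ₗ D.mul.flip z)
      (D.comul y)) := by
  induction x using D.tube_induction with
  | zero => simp
  | add x x' hx hx' =>
    simp only [map_add, LinearMap.add_apply, hx, hx', LinearMap.comp_add, TensorProduct.map_add_left]
  | diag a b c e f h v w =>
  induction z using D.tube_induction with
  | zero => simp
  | add z z' hz hz' =>
    simp only [map_add, hz, hz', LinearMap.comp_add, TensorProduct.map_add_right,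
      LinearMap.add_apply]
  | diag a'' b'' c'' e'' f'' h'' v'' w'' =>
  induction y using D.tube_induction with
  | zero => simp
  | add y y' hy hy' => simp only [map_add, LinearMap.add_apply, hy, hy']
  | diag a' b' c' e' f' h' v' w' =>
  rw [D.comul_gdiag (D.obj a') (D.obj b') (fun i => D.triResolution a' b' i),
    counit_mul_mul_gdiag]
  simp only [map_sum, TensorProduct.map_tmul, LinearMap.comp_apply, LinearMap.flip_apply,
    TensorProduct.lid_tmul, counit_mul_gdiag]
  have key : ∀ i (m : (D.triResolution a' b' i).ι),
      D.coeffMid c e f h v w (D.delta e _ ≫ (D.triResolution a' b' i).inc m ≫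
        triMap (𝟙 _) (D.delta i f') (𝟙 _) ≫ w' ≫ D.delta h' f) •
      D.coeff _ (D.delta _ c' ≫ v' ≫ triMap (𝟙 _) (D.delta e' c'' ≫ v'' ≫
        triMap (𝟙 _) (D.delta e'' f'') (𝟙 _) ≫ w'' ≫ D.delta h'' i) (𝟙 _) ≫
          (D.triResolution a' b' i).prj m) =
      D.coeffMid c e f h v w (D.delta e c' ≫ v' ≫ triMap (𝟙 _) (D.delta e' c'' ≫ v'' ≫
        triMap (𝟙 _) (D.delta e'' f'') (𝟙 _) ≫ w'' ≫ D.delta h'' i) (𝟙 _) ≫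
          ((D.triResolution a' b' i).prj m ≫ (D.triResolution a' b' i).inc m ≫
        triMap (𝟙 _) (D.delta i f') (𝟙 _) ≫ w' ≫ D.delta h' f)) := by
    intro i m
    rw [smul_eq_mul, mul_comm, ← smul_eq_mul, ← map_smul, coeff_smul_delta_comp]
    simp only [Category.assoc]
  refine Eq.trans ?_ (Finset.sum_congr rfl fun i _ => Finset.sum_congr rfl fun m _ =>
    (key i m).symm)
  simp only [← map_sum, ← Preadditive.comp_sum, Resolution.sum_comp_left]
  simp only [triMap_comp_assoc, Category.assoc, ← Preadditive.comp_sum, ← Preadditive.sum_comp,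
    ← triMap_sum_mid, Category.comp_id, sum_delta_comp_delta]
  rfl

lemma counit_mul_tube' (x y z : D.Tube) : D.counit (D.mul (D.mul x y) z) =
    TensorProduct.lid ℂ ℂ (TensorProduct.map (D.counit ∘ₗ D.mul.flip z) (D.counit ∘ₗ D.mul x)
      (D.comul y)) := by
  induction x using D.tube_induction with
  | zero => simp
  | add x x' hx hx' =>
    simp only [map_add, LinearMap.add_apply, hx, hx', LinearMap.comp_add,
      TensorProduct.map_add_right]
  | diag a b c e f h v w =>
  induction z using D.tube_induction with
  | zero => simp
  | add z z' hz hz' =>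
    simp only [map_add, hz, hz', LinearMap.comp_add, TensorProduct.map_add_left,
      LinearMap.add_apply]
  | diag a'' b'' c'' e'' f'' h'' v'' w'' =>
  induction y using D.tube_induction with
  | zero => simp
  | add y y' hy hy' => simp only [map_add, LinearMap.add_apply, hy, hy']
  | diag a' b' c' e' f' h' v' w' =>
  rw [D.comul_gdiag (D.obj a') (D.obj b') (fun i => D.triResolution a' b' i),
    counit_mul_mul_gdiag]
  simp only [map_sum, TensorProduct.map_tmul, LinearMap.comp_apply, LinearMap.flip_apply,
    TensorProduct.lid_tmul, counit_mul_gdiag]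
  have key : ∀ i (m : (D.triResolution a' b' i).ι),
      D.coeff h' (D.delta h' _ ≫ (D.triResolution a' b' i).inc m ≫
        triMap (𝟙 _) (D.delta i c'' ≫ v'' ≫ triMap (𝟙 _) (D.delta e'' f'') (𝟙 _) ≫ w'' ≫
          D.delta h'' f') (𝟙 _) ≫ w') •
      D.coeffMid c e f h v w (D.delta e c' ≫ v' ≫ triMap (𝟙 _) (D.delta e' i) (𝟙 _) ≫
        (D.triResolution a' b' i).prj m ≫ D.delta _ f) =
      D.coeffMid c e f h v w (D.delta e c' ≫ v' ≫ triMap (𝟙 _) (D.delta e' i) (𝟙 _) ≫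
        ((D.triResolution a' b' i).prj m ≫ (D.triResolution a' b' i).inc m ≫
        triMap (𝟙 _) (D.delta i c'' ≫ v'' ≫ triMap (𝟙 _) (D.delta e'' f'') (𝟙 _) ≫ w'' ≫
          D.delta h'' f') (𝟙 _) ≫ w' ≫ D.delta h' f)) := by
    intro i m
    rw [← map_smul, ← Linear.comp_smul, ← Linear.comp_smul, ← Linear.comp_smul,
      coeff_smul_comp_delta]
    simp only [Category.assoc]
  refine Eq.trans ?_ (Finset.sum_congr rfl fun i _ => Finset.sum_congr rfl fun m _ =>
    (key i m).symm)
  simp only [← map_sum, ← Preadditive.comp_sum, Resolution.sum_comp_left]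
  simp only [triMap_comp_assoc, ← Preadditive.sum_comp, ← triMap_sum_mid, Category.comp_id]
  simp only [← Category.assoc (D.delta e' _), ← Preadditive.sum_comp, sum_delta_comp_delta]
  rfl

lemma isWeakBialgebra : WeakHopf.IsWeakBialgebra D.mul D.one D.comul D.counit where
  finite := by
    have : ∀ X Y : C, Module.Finite ℂ (X ⟶ Y) := finite_hom
    infer_instance
  mul_assoc := D.mul_assoc_tube
  one_mul := D.one_mul_tube
  mul_one := D.mul_one_tube
  coassoc := D.coassoc_tube
  counit_comul := D.counit_comul_tube
  comul_counit := D.comul_counit_tube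
  comul_mul := D.comul_mul_tube
  comul_one := D.comul_one_mul_tube
  comul_one' := D.one_comul_mul_tube
  counit_mul := D.counit_mul_tube
  counit_mul' := D.counit_mul_tube'

end StringData

/-! ### Mates, nested cups and partial traces -/

namespace PartialTrace

variable {C : Type u} [Category.{v} C] [MonoidalCategory C]

/-- Partial trace over a left tensor factor. -/
def leftTrace {A A' X Y : C} (η : 𝟙_ C ⟶ A' ⊗ A) (ε : A' ⊗ A ⟶ 𝟙_ C) (F : A ⊗ X ⟶ A ⊗ Y) :
    X ⟶ Y :=
  (λ_ X).inv ≫ η ▷ X ≫ (α_ _ _ _).hom ≫ A' ◁ F ≫ (α_ _ _ _).inv ≫ ε ▷ Y ≫ (λ_ Y).hom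

/-- Partial trace over a right tensor factor. -/
def rightTrace {B B' X Y : C} (η : 𝟙_ C ⟶ B ⊗ B') (ε : B ⊗ B' ⟶ 𝟙_ C) (F : X ⊗ B ⟶ Y ⊗ B) :
    X ⟶ Y :=
  (ρ_ X).inv ≫ X ◁ η ≫ (α_ _ _ _).inv ≫ F ▷ B' ≫ (α_ _ _ _).hom ≫ Y ◁ ε ≫ (ρ_ Y).hom

/-- A cap inside a cap. -/
def nestedCap {A A' B B' : C} (ε : A' ⊗ A ⟶ 𝟙_ C) (ε' : B' ⊗ B ⟶ 𝟙_ C) :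
    (B' ⊗ A') ⊗ (A ⊗ B) ⟶ 𝟙_ C :=
  (α_ _ _ _).hom ≫ B' ◁ ((α_ _ _ _).inv ≫ ε ▷ B ≫ (λ_ B).hom) ≫ ε'

/-- A cup inside a cup. -/
def nestedCup {A A' B B' : C} (η : 𝟙_ C ⟶ A' ⊗ A) (η' : 𝟙_ C ⟶ B' ⊗ B) :
    𝟙_ C ⟶ (B' ⊗ A') ⊗ (A ⊗ B) :=
  η' ≫ B' ◁ ((λ_ B).inv ≫ η ▷ B ≫ (α_ _ _ _).hom) ≫ (α_ _ _ _).inv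

lemma nestedCup_whiskerLeft_nestedCap {A A' B B' : C} (η : 𝟙_ C ⟶ A' ⊗ A) (η' : 𝟙_ C ⟶ B' ⊗ B)
    (ε : A' ⊗ A ⟶ 𝟙_ C) (ε' : B' ⊗ B ⟶ 𝟙_ C) (F : A ⊗ B ⟶ A ⊗ B) :
    nestedCup η η' ≫ (B' ⊗ A') ◁ F ≫ nestedCap ε ε' = η' ≫ B' ◁ leftTrace η ε F ≫ ε' := by
  simp only [nestedCup, nestedCap, leftTrace]
  monoidal

lemma nestedCup_whiskerRight_nestedCap {A A' B B' : C} (η : 𝟙_ C ⟶ B ⊗ B') (η' : 𝟙_ C ⟶ A ⊗ A')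
    (ε : B ⊗ B' ⟶ 𝟙_ C) (ε' : A ⊗ A' ⟶ 𝟙_ C) (F : A ⊗ B ⟶ A ⊗ B) :
    nestedCup η η' ≫ F ▷ (B' ⊗ A') ≫ nestedCap ε ε' = η' ≫ rightTrace η ε F ▷ A' ≫ ε' := by
  simp only [nestedCup, nestedCap, rightTrace]
  monoidal

/-- Closing a strand on the left and one on the right commute: the interchange law moves the cup of
one past the cup of the other, and likewise for the caps. Both sides are scalars of the tensor unit.
-/
lemma leftTrace_rightTrace {A A' B B' : C} (η : 𝟙_ C ⟶ A' ⊗ A) (ε : A' ⊗ A ⟶ 𝟙_ C)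
    (η' : 𝟙_ C ⟶ B ⊗ B') (ε' : B ⊗ B' ⟶ 𝟙_ C) (F : A ⊗ B ⟶ A ⊗ B) :
    η' ≫ leftTrace η ε F ▷ B' ≫ ε' = η ≫ A' ◁ rightTrace η' ε' F ≫ ε := by
  have h1 : η' ≫ ((λ_ B).inv ≫ η ▷ B) ▷ B' =
      η ≫ (ρ_ _).inv ≫ (A' ⊗ A) ◁ η' ≫ (α_ _ _ _).inv := by
    calc _ = 𝟙 _ ⊗≫ (𝟙_ C ◁ η' ≫ η ▷ (B ⊗ B')) ⊗≫ 𝟙 _ := by monoidal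
      _ = _ := by rw [whisker_exchange]; monoidal
  have h2 : (ε ▷ B ≫ (λ_ B).hom) ▷ B' ≫ ε' =
      (α_ _ _ _).hom ≫ (A' ⊗ A) ◁ ε' ≫ (ρ_ _).hom ≫ ε := by
    calc _ = 𝟙 _ ⊗≫ (ε ▷ (B ⊗ B') ≫ 𝟙_ C ◁ ε') ⊗≫ 𝟙 _ := by monoidal
      _ = _ := by rw [← whisker_exchange]; monoidal
  calc η' ≫ leftTrace η ε F ▷ B' ≫ ε'
      = (η' ≫ ((λ_ B).inv ≫ η ▷ B) ▷ B') ≫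
        ((α_ _ _ _).hom ≫ A' ◁ F ≫ (α_ _ _ _).inv) ▷ B' ≫ (ε ▷ B ≫ (λ_ B).hom) ▷ B' ≫ ε' := by
        simp [leftTrace]
    _ = _ := by
        rw [h1, h2, rightTrace]
        monoidal

/-- Action of a scalar of the tensor unit from the left. -/
def leftScalar (θ : 𝟙_ C ⟶ 𝟙_ C) (X : C) : X ⟶ X := (λ_ X).inv ≫ θ ▷ X ≫ (λ_ X).hom

/-- Action of a scalar of the tensor unit from the right. -/
def rightScalar (θ : 𝟙_ C ⟶ 𝟙_ C) (X : C) : X ⟶ X := (ρ_ X).inv ≫ X ◁ θ ≫ (ρ_ X).hom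

lemma leftScalar_naturality (θ : 𝟙_ C ⟶ 𝟙_ C) {X Y : C} (f : X ⟶ Y) :
    leftScalar θ X ≫ f = f ≫ leftScalar θ Y := by
  simp only [leftScalar, Category.assoc]
  rw [← leftUnitor_naturality, ← whisker_exchange_assoc, ← leftUnitor_inv_naturality_assoc]

lemma rightScalar_naturality (θ : 𝟙_ C ⟶ 𝟙_ C) {X Y : C} (f : X ⟶ Y) :
    rightScalar θ X ≫ f = f ≫ rightScalar θ Y := by
  simp only [rightScalar, Category.assoc]
  rw [← rightUnitor_naturality, whisker_exchange_assoc, ← rightUnitor_inv_naturality_assoc]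

lemma leftScalar_tensor (θ : 𝟙_ C ⟶ 𝟙_ C) (X Y : C) :
    leftScalar θ (X ⊗ Y) = leftScalar θ X ▷ Y := by
  simp only [leftScalar]; monoidal

lemma rightScalar_tensor (θ : 𝟙_ C ⟶ 𝟙_ C) (X Y : C) :
    rightScalar θ (X ⊗ Y) = X ◁ rightScalar θ Y := by
  simp only [rightScalar]; monoidal

/-- A closed diagram floating between two strands may be attributed to either of them. In the
multifusion case this replaces the statement that endomorphisms of `𝟙` are numbers. -/
lemma rightScalar_whiskerRight (θ : 𝟙_ C ⟶ 𝟙_ C) (X Y : C) :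
    rightScalar θ X ▷ Y = X ◁ leftScalar θ Y := by
  simp only [rightScalar, leftScalar]; monoidal

/-- The right adjoint mate of a morphism, for explicitly given pairings. -/
def mate {X X' Y Y' : C} (p : ExactPairing X X') (q : ExactPairing Y Y') (f : X ⟶ Y) : Y' ⟶ X' :=
  @rightAdjointMate C _ _ X Y ⟨X'⟩ ⟨Y'⟩ f

section

variable {X X' Y Y' Z Z' : C} (p : ExactPairing X X') (q : ExactPairing Y Y')
  (r : ExactPairing Z Z')

lemma mate_id : mate p p (𝟙 X) = 𝟙 X' := @rightAdjointMate_id C _ _ X ⟨X'⟩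

lemma mate_comp (f : X ⟶ Y) (g : Y ⟶ Z) : mate p r (f ≫ g) = mate q r g ≫ mate p q f :=
  @comp_rightAdjointMate C _ _ X Y Z ⟨X'⟩ ⟨Y'⟩ ⟨Z'⟩ f g

lemma mate_evaluation (f : X ⟶ Y) :
    mate p q f ▷ X ≫ p.evaluation' = Y' ◁ f ≫ q.evaluation' :=
  @rightAdjointMate_comp_evaluation C _ _ X Y ⟨X'⟩ ⟨Y'⟩ f

lemma coevaluation_mate (f : X ⟶ Y) :
    q.coevaluation' ≫ Y ◁ mate p q f = p.coevaluation' ≫ f ▷ X' :=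
  @coevaluation_comp_rightAdjointMate C _ _ X Y ⟨X'⟩ ⟨Y'⟩ f

lemma mate_sum [Preadditive C] [MonoidalPreadditive C] {ι : Type*} (s : Finset ι)
    (f : ι → (X ⟶ Y)) : mate p q (∑ i ∈ s, f i) = ∑ i ∈ s, mate p q (f i) := by
  simp only [mate, rightAdjointMate, sum_whiskerRight, whiskerLeft_sum, Preadditive.comp_sum,
    Preadditive.sum_comp]

lemma mate_smul [Preadditive C] [MonoidalPreadditive C] [Linear ℂ C] [MonoidalLinear ℂ C] (z : ℂ)
    (f : X ⟶ Y) : mate p q (z • f) = z • mate p q f := by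
  simp only [mate, rightAdjointMate, MonoidalLinear.smul_whiskerRight,
    MonoidalLinear.whiskerLeft_smul, Linear.comp_smul, Linear.smul_comp]

/-- The tensor product of explicitly given pairings. -/
abbrev tensorPairing : ExactPairing (X ⊗ Y) (Y' ⊗ X') := @ExactPairing.tensor C _ _ X Y X' Y' p q

lemma tensorPairing_evaluation :
    (tensorPairing p q).evaluation' = nestedCap p.evaluation' q.evaluation' := by
  refine (@ExactPairing.tensor_evaluation C _ _ X Y X' Y' p q).trans ?_
  simp only [nestedCap]
  change _ = _ ≫ _ ◁ (_ ≫ @ExactPairing.evaluation C _ _ X X' p ▷ _ ≫ _) ≫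
    @ExactPairing.evaluation C _ _ Y Y' q
  monoidal

lemma tensorPairing_coevaluation :
    (tensorPairing p q).coevaluation' = nestedCup q.coevaluation' p.coevaluation' := by
  refine (@ExactPairing.tensor_coevaluation C _ _ X Y X' Y' p q).trans ?_
  simp only [nestedCup]
  change _ = @ExactPairing.coevaluation C _ _ X X' p ≫ _ ◁
    (_ ≫ @ExactPairing.coevaluation C _ _ Y Y' q ▷ _ ≫ _) ≫ _
  monoidal

end

end PartialTrace

namespace PartialTrace

variable {C : Type u} [Category.{v} C] [Preadditive C] [Linear ℂ C] [MonoidalCategory C]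
  [MonoidalPreadditive C] [MonoidalLinear ℂ C]

lemma leftScalar_smul (z : ℂ) (θ : 𝟙_ C ⟶ 𝟙_ C) (X : C) :
    leftScalar (z • θ) X = z • leftScalar θ X := by
  simp [leftScalar]

lemma rightScalar_smul (z : ℂ) (θ : 𝟙_ C ⟶ 𝟙_ C) (X : C) :
    rightScalar (z • θ) X = z • rightScalar θ X := by
  simp [rightScalar]

variable [RigidCategory C] [DaggerCategory C] [UnitaryMultifusionCategory C]

open DaggerCategory UnitaryMultifusionCategory

lemma dag_nestedCap {A A' B B' : C} (ε : A' ⊗ A ⟶ 𝟙_ C) (ε' : B' ⊗ B ⟶ 𝟙_ C) :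
    dag (nestedCap ε ε') = nestedCup (dag ε) (dag ε') := by
  simp [nestedCap, nestedCup, dag_comp, dag_whiskerLeft, dag_whiskerRight, dag_associator,
    dag_associator_inv, dag_leftUnitor]

lemma dag_nestedCup {A A' B B' : C} (η : 𝟙_ C ⟶ A' ⊗ A) (η' : 𝟙_ C ⟶ B' ⊗ B) :
    dag (nestedCup η η') = nestedCap (dag η) (dag η') := by
  rw [← dag_dag (nestedCap _ _), dag_nestedCap, dag_dag, dag_dag]

end PartialTrace

/-! ### Mates of vertices and the action of loops on strands -/

namespace StringData

open DaggerCategory UnitaryMultifusionCategory TwoSided PartialTrace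
open scoped TensorProduct

variable {C : Type u} [Category.{v} C] [Preadditive C] [Linear ℂ C] [MonoidalCategory C]
  [MonoidalPreadditive C] [MonoidalLinear ℂ C] [RigidCategory C] [DaggerCategory C]
  [UnitaryMultifusionCategory C] (D : StringData C)

lemma bar_injective : Function.Injective D.bar := by
  intro k k' h
  have p := D.pairing k
  have q := D.pairing k'
  rw [h] at p
  exact D.eq_of_iso k k' ⟨leftDualIso p q⟩

lemma rightScalar_ev (a : D.L) :
    rightScalar (dag (D.ev a) ≫ D.ev a) (D.obj a) = (D.dim a : ℂ) • 𝟙 _ := D.loop_right a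

lemma leftScalar_coev (a : D.L) :
    leftScalar (D.coev a ≫ dag (D.coev a)) (D.obj a) = (D.dim a : ℂ) • 𝟙 _ := D.loop_left a

variable {D} in
-- A nonzero `t` shows that `k` and `b` border the same region on their right, so `θ` acts on both
-- by the same number; formally this is naturality of `θ` along `t`.
lemma rightScalar_eq_of_ne_zero {a b k : D.L} {t : D.obj k ⟶ D.obj a ⊗ D.obj b} (ht : t ≠ 0)
    {θ : 𝟙_ C ⟶ 𝟙_ C} {z : ℂ} (hθ : rightScalar θ (D.obj b) = z • 𝟙 _) :
    rightScalar θ (D.obj k) = z • 𝟙 _ := by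
  obtain ⟨y, hy⟩ := (D.simple k).exists_smul (rightScalar θ (D.obj k))
  have h := rightScalar_naturality θ t
  rw [rightScalar_tensor, hθ, hy, Linear.smul_comp, Category.id_comp,
    MonoidalLinear.whiskerLeft_smul, Linear.comp_smul, MonoidalCategory.whiskerLeft_id,
    Category.comp_id] at h
  rw [hy, smul_left_injective ℂ ht h]

variable {D} in
lemma leftScalar_eq_of_ne_zero {a b k : D.L} {t : D.obj k ⟶ D.obj a ⊗ D.obj b} (ht : t ≠ 0)
    {θ : 𝟙_ C ⟶ 𝟙_ C} {z : ℂ} (hθ : leftScalar θ (D.obj a) = z • 𝟙 _) :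
    leftScalar θ (D.obj k) = z • 𝟙 _ := by
  obtain ⟨y, hy⟩ := (D.simple k).exists_smul (leftScalar θ (D.obj k))
  have h := leftScalar_naturality θ t
  rw [leftScalar_tensor, hθ, hy, Linear.smul_comp, Category.id_comp,
    MonoidalLinear.smul_whiskerRight, Linear.comp_smul, MonoidalCategory.id_whiskerRight,
    Category.comp_id] at h
  rw [hy, smul_left_injective ℂ ht h]

variable {D} in
-- The nonzero `t` ensures that `a ⊗ b` is not zero, so the region to the right of `a` is the one to
-- the left of `b`.
lemma leftScalar_eq_rightScalar {a b k : D.L} {t : D.obj k ⟶ D.obj a ⊗ D.obj b} (ht : t ≠ 0)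
    {θ : 𝟙_ C ⟶ 𝟙_ C} {z : ℂ} (hθ : rightScalar θ (D.obj a) = z • 𝟙 _) :
    leftScalar θ (D.obj b) = z • 𝟙 _ := by
  obtain ⟨y, hy⟩ := (D.simple b).exists_smul (leftScalar θ (D.obj b))
  have h := rightScalar_whiskerRight θ (D.obj a) (D.obj b)
  rw [hθ, hy, MonoidalLinear.smul_whiskerRight, MonoidalLinear.whiskerLeft_smul,
    MonoidalCategory.id_whiskerRight, MonoidalCategory.whiskerLeft_id] at h
  have h' := congrArg (t ≫ ·) h
  simp only [Linear.comp_smul, Category.comp_id] at h'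
  rw [hy, smul_left_injective ℂ ht h']

/-- The left mate of a splitting vertex, see `rightAdjointMate`. -/
noncomputable abbrev mateIn {a b k : D.L} (f : D.obj k ⟶ D.obj a ⊗ D.obj b) :
    D.obj (D.bar b) ⊗ D.obj (D.bar a) ⟶ D.obj (D.bar k) :=
  mate (D.pairing k) (tensorPairing (D.pairing a) (D.pairing b)) f

/-- The mate of a fusion vertex. -/
noncomputable abbrev mateOut {a b k : D.L} (g : D.obj a ⊗ D.obj b ⟶ D.obj k) :
    D.obj (D.bar k) ⟶ D.obj (D.bar b) ⊗ D.obj (D.bar a) :=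
  mate (tensorPairing (D.pairing a) (D.pairing b)) (D.pairing k) g

variable {D}

/-- A vertex that slides over a cap or a cup becomes its mate, and the cap or cup of `k` becomes a
nested pair for `a` and `b`. This lemma and the next three are the four instances. -/
lemma mateIn_ev {a b k : D.L} (f : D.obj k ⟶ D.obj a ⊗ D.obj b) :
    D.mateIn f ▷ D.obj k ≫ D.ev k = _ ◁ f ≫ nestedCap (D.ev a) (D.ev b) := by
  rw [ev, mateIn, mate_evaluation, tensorPairing_evaluation]
  rfl

lemma mateOut_ev {a b k : D.L} (g : D.obj a ⊗ D.obj b ⟶ D.obj k) :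
    D.mateOut g ▷ _ ≫ nestedCap (D.ev a) (D.ev b) = _ ◁ g ≫ D.ev k := by
  rw [ev, ev, ev, ← tensorPairing_evaluation, mateOut, mate_evaluation]

lemma coev_mateIn {a b k : D.L} (f : D.obj k ⟶ D.obj a ⊗ D.obj b) :
    nestedCup (D.coev b) (D.coev a) ≫ _ ◁ D.mateIn f = D.coev k ≫ f ▷ _ := by
  rw [coev, coev, coev, ← tensorPairing_coevaluation, mateIn, coevaluation_mate]

lemma coev_mateOut {a b k : D.L} (g : D.obj a ⊗ D.obj b ⟶ D.obj k) :
    D.coev k ≫ _ ◁ D.mateOut g = nestedCup (D.coev b) (D.coev a) ≫ g ▷ _ := by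
  rw [coev, coev, coev, ← tensorPairing_coevaluation, mateOut, coevaluation_mate]

lemma dag_ev_mateIn {a b k : D.L} (f : D.obj k ⟶ D.obj a ⊗ D.obj b) :
    nestedCup (dag (D.ev a)) (dag (D.ev b)) ≫ _ ◁ dag f =
      dag (D.ev k) ≫ dag (D.mateIn f) ▷ _ := by
  have := congrArg dag (mateIn_ev f)
  simpa only [dag_comp, dag_whiskerLeft, dag_whiskerRight, dag_nestedCap] using this.symm

lemma dag_coev_mateOut {a b k : D.L} (g : D.obj a ⊗ D.obj b ⟶ D.obj k) :
    dag g ▷ _ ≫ nestedCap (dag (D.coev b)) (dag (D.coev a)) =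
      _ ◁ dag (D.mateOut g) ≫ dag (D.coev k) := by
  have := congrArg dag (coev_mateOut g)
  simpa only [dag_comp, dag_whiskerLeft, dag_whiskerRight, dag_nestedCup] using this.symm

lemma mateOut_mateIn {a b k k' : D.L} (f : D.obj k' ⟶ D.obj a ⊗ D.obj b)
    (g : D.obj a ⊗ D.obj b ⟶ D.obj k) :
    D.mateOut g ≫ D.mateIn f = mate (D.pairing k') (D.pairing k) (f ≫ g) :=
  (mate_comp _ _ _ _ _).symm

lemma mateIn_mateOut {a b k : D.L} (f : D.obj k ⟶ D.obj a ⊗ D.obj b)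
    (g : D.obj a ⊗ D.obj b ⟶ D.obj k) :
    D.mateIn f ≫ D.mateOut g = mate (tensorPairing (D.pairing a) (D.pairing b))
      (tensorPairing (D.pairing a) (D.pairing b)) (g ≫ f) :=
  (mate_comp _ _ _ _ _).symm

/-- The Gram matrix of the mates of splitting vertices is the same as that of the mates of the
fusion vertices, by sphericality. -/
lemma gram_eq {a b k : D.L} (f g : D.obj k ⟶ D.obj a ⊗ D.obj b) :
    dag (D.mateIn g) ≫ D.mateIn f = D.mateOut (dag g) ≫ dag (D.mateOut (dag f)) := by
  by_cases hf : f = 0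
  · subst hf
    have h1 : D.mateIn (0 : D.obj k ⟶ D.obj a ⊗ D.obj b) = 0 := by
      simpa using mate_smul (D.pairing k) (tensorPairing (D.pairing a) (D.pairing b)) 0 0
    have h2 : D.mateOut (0 : D.obj a ⊗ D.obj b ⟶ D.obj k) = 0 := by
      simpa using mate_smul (tensorPairing (D.pairing a) (D.pairing b)) (D.pairing k) 0 0
    rw [h1, dag_zero, h2, dag_zero, Limits.comp_zero, Limits.comp_zero]
  obtain ⟨l, hl⟩ := (D.simple (D.bar k)).exists_smul (dag (D.mateIn g) ≫ D.mateIn f)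
  obtain ⟨r, hr⟩ := (D.simple (D.bar k)).exists_smul
    (D.mateOut (dag g) ≫ dag (D.mateOut (dag f)))
  obtain ⟨x, hx⟩ := (D.simple b).exists_smul (leftTrace (dag (D.ev a)) (D.ev a) (dag g ≫ f))
  obtain ⟨y, hy⟩ := (D.simple a).exists_smul
    (rightTrace (D.coev b) (dag (D.coev b)) (dag g ≫ f))
  -- Closed diagrams are compared in `End 𝟙`. Closing `dag g ≫ f` to the left gives `l` loops of `k`
  -- or `x` loops of `b`; closing it to the right gives `e2`; closing one strand on each side, in
  -- either order, gives `e3`.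
  have e1 : l • (dag (D.ev k) ≫ D.ev k) = x • (dag (D.ev b) ≫ D.ev b) := by
    have h := nestedCup_whiskerLeft_nestedCap (dag (D.ev a)) (dag (D.ev b)) (D.ev a) (D.ev b)
      (dag g ≫ f)
    rw [hx, MonoidalCategory.whiskerLeft_comp, Category.assoc, ← mateIn_ev,
      reassoc_of% dag_ev_mateIn, ← comp_whiskerRight_assoc, hl] at h
    simpa using h
  have e2 : r • (D.coev k ≫ dag (D.coev k)) = y • (D.coev a ≫ dag (D.coev a)) := by
    have h := nestedCup_whiskerRight_nestedCap (D.coev b) (D.coev a) (dag (D.coev b))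
      (dag (D.coev a)) (dag g ≫ f)
    have h' := dag_coev_mateOut (dag f)
    rw [dag_dag] at h'
    rw [hy, comp_whiskerRight, Category.assoc, h', ← reassoc_of% coev_mateOut,
      ← MonoidalCategory.whiskerLeft_comp_assoc, hr] at h
    simpa using h
  have e3 : x • (D.coev b ≫ dag (D.coev b)) = y • (dag (D.ev a) ≫ D.ev a) := by
    have h := leftTrace_rightTrace (dag (D.ev a)) (D.ev a) (D.coev b) (dag (D.coev b))
      (dag g ≫ f)
    rw [hx, hy] at h
    simpa using h
  -- As `End 𝟙` need not be one-dimensional, numbers are extracted by letting both sides act on a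
  -- strand. Every loop then acts by its quantum dimension, which is where the equality of left and
  -- right loops enters.
  have d1 : l * D.dim k = x * D.dim b := by
    have h := congrArg (fun θ => rightScalar θ (D.obj k)) e1
    simp only [rightScalar_smul, rightScalar_ev,
      rightScalar_eq_of_ne_zero hf (D.rightScalar_ev b), smul_smul] at h
    exact (D.simple k).smul_id_injective h
  have d2 : r * D.dim k = y * D.dim a := by
    have h := congrArg (fun θ => leftScalar θ (D.obj k)) e2
    simp only [leftScalar_smul, leftScalar_coev,
      leftScalar_eq_of_ne_zero hf (D.leftScalar_coev a), smul_smul] at h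
    exact (D.simple k).smul_id_injective h
  have d3 : x * D.dim b = y * D.dim a := by
    have h := congrArg (fun θ => leftScalar θ (D.obj b)) e3
    simp only [leftScalar_smul, leftScalar_coev,
      leftScalar_eq_rightScalar hf (D.rightScalar_ev a), smul_smul] at h
    exact (D.simple b).smul_id_injective h
  rw [hl, hr, mul_right_cancel₀ (D.dim_ne_zero k) (d1.trans (d3.trans d2.symm))]

end StringData

/-! ### Duality commutes with the dagger; partial traces of vertices -/

namespace StringData

open DaggerCategory UnitaryMultifusionCategory TwoSided PartialTrace
open scoped TensorProduct

variable {C : Type u} [Category.{v} C] [Preadditive C] [Linear ℂ C] [MonoidalCategory C]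
  [MonoidalPreadditive C] [MonoidalLinear ℂ C] [RigidCategory C] [DaggerCategory C]
  [UnitaryMultifusionCategory C] (D : StringData C)

variable {D}

lemma mateOut_add {a b k : D.L} (f g : D.obj a ⊗ D.obj b ⟶ D.obj k) :
    D.mateOut (f + g) = D.mateOut f + D.mateOut g := by
  simpa using mate_sum (tensorPairing (D.pairing a) (D.pairing b)) (D.pairing k)
    (Finset.univ : Finset Bool) (fun i => if i then f else g)

lemma mateIn_add {a b k : D.L} (f g : D.obj k ⟶ D.obj a ⊗ D.obj b) :
    D.mateIn (f + g) = D.mateIn f + D.mateIn g := by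
  simpa using mate_sum (D.pairing k) (tensorPairing (D.pairing a) (D.pairing b))
    (Finset.univ : Finset Bool) (fun i => if i then f else g)

/-- Taking mates is contravariant and additive, so it turns a resolution of `a ⊗ b` into one of the
tensor product of the duals in the opposite order. -/
lemma sum_mateIn_mateOut {a b : D.L} (R : D.Resolution (D.obj a ⊗ D.obj b)) :
    ∑ m, D.mateIn (R.inc m) ≫ D.mateOut (R.prj m) = 𝟙 _ := by
  simp only [mateIn_mateOut]
  rw [← mate_sum, R.complete, mate_id]

/-- Inserting the mates of a resolution expands `φ` in mates of its projections; the coefficients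
are scalars by Schur's lemma, since `bar` separates labels. -/
lemma exists_mateOut_eq {a b k : D.L} (φ : D.obj (D.bar k) ⟶ D.obj (D.bar b) ⊗ D.obj (D.bar a)) :
    ∃ g : D.obj a ⊗ D.obj b ⟶ D.obj k, D.mateOut g = φ := by
  have key : ∀ k' (ψ : D.obj (D.bar k) ⟶ D.obj (D.bar k')) (p : D.obj a ⊗ D.obj b ⟶ D.obj k'),
      ∃ g : D.obj a ⊗ D.obj b ⟶ D.obj k, D.mateOut g = ψ ≫ D.mateOut p := by
    intro k' ψ p
    by_cases h : k = k'
    · subst h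
      obtain ⟨z, rfl⟩ := (D.simple _).exists_smul ψ
      refine ⟨z • p, ?_⟩
      rw [mateOut, mate_smul, Linear.smul_comp, Category.id_comp]
    · refine ⟨0, ?_⟩
      rw [D.hom_eq_zero (D.bar_injective.ne h) ψ, Limits.zero_comp]
      simpa using mate_smul (tensorPairing (D.pairing a) (D.pairing b)) (D.pairing k) 0 0
  choose g hg using fun m => key _ (φ ≫ D.mateIn ((D.vtxResolution a b).inc m))
    ((D.vtxResolution a b).prj m)
  refine ⟨∑ m, g m, ?_⟩
  rw [mateOut, mate_sum]
  calc _ = ∑ m, (φ ≫ D.mateIn ((D.vtxResolution a b).inc m)) ≫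
        D.mateOut ((D.vtxResolution a b).prj m) := Finset.sum_congr rfl fun m _ => hg m
    _ = φ := by
      simp only [Category.assoc, ← Preadditive.comp_sum, sum_mateIn_mateOut, Category.comp_id]

lemma eq_of_comp_mateIn {a b k : D.L}
    {φ ψ : D.obj (D.bar k) ⟶ D.obj (D.bar b) ⊗ D.obj (D.bar a)}
    (h : ∀ f : D.obj k ⟶ D.obj a ⊗ D.obj b, φ ≫ D.mateIn f = ψ ≫ D.mateIn f) : φ = ψ := by
  have key : ∀ k' (f : D.obj k' ⟶ D.obj a ⊗ D.obj b), φ ≫ D.mateIn f = ψ ≫ D.mateIn f := by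
    intro k' f
    by_cases hk : k = k'
    · subst hk
      exact h f
    · rw [D.hom_eq_zero (D.bar_injective.ne hk) (φ ≫ _),
        D.hom_eq_zero (D.bar_injective.ne hk) (ψ ≫ _)]
  rw [← Category.comp_id φ, ← Category.comp_id ψ, ← sum_mateIn_mateOut (D.vtxResolution a b)]
  simp only [Preadditive.comp_sum, ← Category.assoc, key]

lemma mateOut_dag_comp_mateIn {a b k : D.L} (f g : D.obj k ⟶ D.obj a ⊗ D.obj b) :
    D.mateOut (dag g) ≫ D.mateIn f = D.coeff k (f ≫ dag g) • 𝟙 _ := by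
  rw [mateOut_mateIn, ← D.coeff_smul_id k (f ≫ dag g), mate_smul, mate_id, coeff_smul_id]

lemma coeff_dag {k : D.L} (f : D.obj k ⟶ D.obj k) :
    D.coeff k (dag f) = (starRingEnd ℂ) (D.coeff k f) := by
  apply D.eq_coeff
  conv_lhs => rw [← D.coeff_smul_id k f]
  rw [dag_smul, dag_id]

/-- Duality commutes with the dagger. -/
theorem dag_mateIn {a b k : D.L} (f : D.obj k ⟶ D.obj a ⊗ D.obj b) :
    dag (D.mateIn f) = D.mateOut (dag f) := by
  obtain ⟨g', hg'⟩ := exists_mateOut_eq (dag (D.mateIn f))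
  obtain ⟨g, rfl⟩ : ∃ g, dag g = g' := ⟨dag g', dag_dag _⟩
  -- The relation between `f` and `g` is symmetric: by `gram_eq`, pairing the dagger of the mate of
  -- `g` with an arbitrary mate gives the same number as pairing with `mateOut (dag f)`, and mates
  -- separate morphisms.
  have hgf : dag (D.mateIn g) = D.mateOut (dag f) := by
    refine eq_of_comp_mateIn fun h => ?_
    have h1 := gram_eq h g
    rw [h1, hg', ← dag_comp, mateOut_dag_comp_mateIn, mateOut_dag_comp_mateIn, dag_smul, dag_id,
      ← coeff_dag, dag_comp, dag_dag]
  -- Symmetry makes `f - g` an eigenvector of eigenvalue `-1` for the antilinear correspondence. The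
  -- norm of its mate would then be minus its own norm, so positivity forces `f = g`.
  have hd : dag (D.mateIn (f - g)) = - D.mateOut (dag (f - g)) := by
    have h1 : D.mateIn (f - g) + D.mateIn g = D.mateIn f := by rw [← mateIn_add, sub_add_cancel]
    have h2 : D.mateOut (dag (f - g)) + D.mateOut (dag g) = D.mateOut (dag f) := by
      rw [← mateOut_add, ← dag_add, sub_add_cancel]
    have h3 := congrArg dag h1
    rw [dag_add, hgf, ← hg', ← h2] at h3
    have h4 : dag (D.mateIn (f - g)) + D.mateOut (dag (f - g)) = 0 := by
      rwa [← add_assoc, add_eq_right] at h3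
    exact eq_neg_of_add_eq_zero_left h4
  have hfg : f - g = 0 := by
    by_contra hne
    obtain ⟨z, hz, hzz⟩ := (D.simple k).exists_pos hne
    obtain ⟨w, hw, hww⟩ := (D.simple (D.bar k)).exists_nonneg (dag (D.mateIn (f - g)))
    rw [dag_dag, hd, Preadditive.neg_comp, mateOut_dag_comp_mateIn, D.eq_coeff hzz, ← neg_smul]
      at hww
    have := (D.simple (D.bar k)).smul_id_injective hww
    rw [← Complex.ofReal_neg, Complex.ofReal_inj] at this
    linarith
  rw [← hg', ← sub_eq_zero.1 hfg]

theorem dag_mateOut {a b k : D.L} (g : D.obj a ⊗ D.obj b ⟶ D.obj k) :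
    dag (D.mateOut g) = D.mateIn (dag g) := by
  rw [← dag_dag (D.mateIn (dag g)), dag_mateIn, dag_dag]

lemma mateOut_comp_mateIn {a b k : D.L} (f : D.obj k ⟶ D.obj a ⊗ D.obj b)
    (g : D.obj a ⊗ D.obj b ⟶ D.obj k) :
    D.mateOut g ≫ D.mateIn f = D.coeff k (f ≫ g) • 𝟙 _ := by
  simpa [dag_dag] using mateOut_dag_comp_mateIn f (dag g)

/-- Rotating a closed diagram: the left partial trace. -/
theorem leftTrace_comp {a b k : D.L} (f : D.obj k ⟶ D.obj a ⊗ D.obj b)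
    (g : D.obj a ⊗ D.obj b ⟶ D.obj k) :
    leftTrace (dag (D.ev a)) (D.ev a) (g ≫ f) =
      ((D.dim k : ℂ) / D.dim b * D.coeff k (f ≫ g)) • 𝟙 _ := by
  by_cases hf : f = 0
  · subst hf
    simp [leftTrace]
  obtain ⟨x, hx⟩ := (D.simple b).exists_smul (leftTrace (dag (D.ev a)) (D.ev a) (g ≫ f))
  have e1 : D.coeff k (f ≫ g) • (dag (D.ev k) ≫ D.ev k) = x • (dag (D.ev b) ≫ D.ev b) := by
    have h := nestedCup_whiskerLeft_nestedCap (dag (D.ev a)) (dag (D.ev b)) (D.ev a) (D.ev b)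
      (g ≫ f)
    have h' := dag_ev_mateIn (dag g)
    rw [dag_dag, dag_mateIn, dag_dag] at h'
    rw [hx, MonoidalCategory.whiskerLeft_comp, Category.assoc, ← mateIn_ev,
      reassoc_of% h', ← comp_whiskerRight_assoc, mateOut_comp_mateIn] at h
    simpa using h
  have d1 : D.coeff k (f ≫ g) * D.dim k = x * D.dim b := by
    have h := congrArg (fun θ => rightScalar θ (D.obj k)) e1
    simp only [rightScalar_smul, rightScalar_ev,
      rightScalar_eq_of_ne_zero hf (D.rightScalar_ev b), smul_smul] at h
    exact (D.simple k).smul_id_injective h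
  rw [hx, div_mul_eq_mul_div, mul_comm (D.dim k : ℂ), d1, mul_div_cancel_right₀ _ (D.dim_ne_zero b)]

/-- Rotating a closed diagram: the right partial trace. -/
theorem rightTrace_comp {a b k : D.L} (f : D.obj k ⟶ D.obj a ⊗ D.obj b)
    (g : D.obj a ⊗ D.obj b ⟶ D.obj k) :
    rightTrace (D.coev b) (dag (D.coev b)) (g ≫ f) =
      ((D.dim k : ℂ) / D.dim a * D.coeff k (f ≫ g)) • 𝟙 _ := by
  by_cases hf : f = 0
  · subst hf
    simp [rightTrace]
  obtain ⟨y, hy⟩ := (D.simple a).exists_smul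
    (rightTrace (D.coev b) (dag (D.coev b)) (g ≫ f))
  have e2 : D.coeff k (f ≫ g) • (D.coev k ≫ dag (D.coev k)) =
      y • (D.coev a ≫ dag (D.coev a)) := by
    have h := nestedCup_whiskerRight_nestedCap (D.coev b) (D.coev a) (dag (D.coev b))
      (dag (D.coev a)) (g ≫ f)
    have h' := dag_coev_mateOut (dag f)
    rw [dag_dag, dag_mateOut, dag_dag] at h'
    rw [hy, comp_whiskerRight, Category.assoc, h', ← reassoc_of% coev_mateOut,
      ← MonoidalCategory.whiskerLeft_comp_assoc, mateOut_comp_mateIn] at h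
    simpa using h
  have d2 : D.coeff k (f ≫ g) * D.dim k = y * D.dim a := by
    have h := congrArg (fun θ => leftScalar θ (D.obj k)) e2
    simp only [leftScalar_smul, leftScalar_coev,
      leftScalar_eq_of_ne_zero hf (D.leftScalar_coev a), smul_smul] at h
    exact (D.simple k).smul_id_injective h
  rw [hy, div_mul_eq_mul_div, mul_comm (D.dim k : ℂ), d2, mul_div_cancel_right₀ _ (D.dim_ne_zero a)]

end StringData

/-! ### Bending -/

namespace TwoSided

open PartialTrace

variable {C : Type u} [Category.{v} C] [MonoidalCategory C]

/-- The two-sided cup `X ⟶ A' (A X B) B'`. -/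
def triCup {A A' B B' : C} (η : 𝟙_ C ⟶ A' ⊗ A) (ζ : 𝟙_ C ⟶ B ⊗ B') (X : C) :
    X ⟶ (A' ⊗ ((A ⊗ X) ⊗ B)) ⊗ B' :=
  (triUnitor X).inv ≫ triMap η (𝟙 X) ζ ≫ (triAssoc A' A X B B').inv

/-- The two-sided cap `A' (A X B) B' ⟶ X`. -/
def triCap {A A' B B' : C} (ε : A' ⊗ A ⟶ 𝟙_ C) (κ : B ⊗ B' ⟶ 𝟙_ C) (X : C) :
    (A' ⊗ ((A ⊗ X) ⊗ B)) ⊗ B' ⟶ X :=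
  (triAssoc A' A X B B').hom ≫ triMap ε (𝟙 X) κ ≫ (triUnitor X).hom

lemma triCup_naturality {A A' B B' : C} (η : 𝟙_ C ⟶ A' ⊗ A) (ζ : 𝟙_ C ⟶ B ⊗ B') {X Y : C}
    (f : X ⟶ Y) :
    f ≫ triCup η ζ Y = triCup η ζ X ≫ triMap (𝟙 _) (triMap (𝟙 _) f (𝟙 _)) (𝟙 _) := by
  simp only [triCup, Category.assoc]
  rw [← triMap_mid_triAssoc_inv, ← reassoc_of% triUnitor_inv_triMap]
  simp

lemma triCap_naturality {A A' B B' : C} (ε : A' ⊗ A ⟶ 𝟙_ C) (κ : B ⊗ B' ⟶ 𝟙_ C) {X Y : C}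
    (f : X ⟶ Y) :
    triCap ε κ X ≫ f = triMap (𝟙 _) (triMap (𝟙 _) f (𝟙 _)) (𝟙 _) ≫ triCap ε κ Y := by
  simp only [triCap, Category.assoc]
  rw [← reassoc_of% triAssoc_hom_triMap_mid, ← triMap_triUnitor]
  simp

lemma triMap_triCup_triCap {A A' B B' : C} (η : 𝟙_ C ⟶ A' ⊗ A) (ζ : 𝟙_ C ⟶ B ⊗ B')
    (ε : A ⊗ A' ⟶ 𝟙_ C) (κ : B' ⊗ B ⟶ 𝟙_ C)
    (hA : A ◁ η ≫ (α_ _ _ _).inv ≫ ε ▷ A = (ρ_ A).hom ≫ (λ_ A).inv)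
    (hB : ζ ▷ B ≫ (α_ _ _ _).hom ≫ B ◁ κ = (λ_ B).hom ≫ (ρ_ B).inv) (X : C) :
    triMap (𝟙 A) (triCup η ζ X) (𝟙 B) ≫ triCap ε κ ((A ⊗ X) ⊗ B) = 𝟙 _ := by
  have h1 : triMap (𝟙 A) (triCup η ζ X) (𝟙 B) = triMap (𝟙 A) (triUnitor X).inv (𝟙 B) ≫
      triMap (𝟙 A) (triMap η (𝟙 X) ζ) (𝟙 B) ≫
        triMap (𝟙 A) (triAssoc A' A X B B').inv (𝟙 B) := by
    simp [triCup]
  have h2 : triMap (𝟙 A) (triAssoc A' A X B B').inv (𝟙 B) ≫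
      (triAssoc A A' ((A ⊗ X) ⊗ B) B' B).hom = (triAssoc A (A' ⊗ A) X (B ⊗ B') B).hom ≫
        triMap (α_ _ _ _).inv (𝟙 X) (α_ _ _ _).hom ≫
          (triAssoc (A ⊗ A') A X B (B' ⊗ B)).inv := by
    have := triAssoc_inv_triAssoc_inv A A' A X B B' B
    rw [Iso.inv_comp_eq] at this
    rw [this]
    simp
  have h3 : (triAssoc (A ⊗ A') A X B (B' ⊗ B)).inv ≫ triMap ε (𝟙 ((A ⊗ X) ⊗ B)) κ =
      triMap (ε ▷ A) (𝟙 X) (B ◁ κ) ≫ (triAssoc (𝟙_ C) A X B (𝟙_ C)).inv := by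
    rw [← triMap_id, triMap_triMap_inv, tensorHom_id, id_tensorHom]
  have h4 : (triAssoc (𝟙_ C) A X B (𝟙_ C)).inv ≫ (triUnitor ((A ⊗ X) ⊗ B)).hom =
      triMap (λ_ A).hom (𝟙 X) (ρ_ B).hom := by
    rw [← triAssoc_unit_left, Iso.inv_hom_id_assoc]
  have h5 : triMap (𝟙 A) (triUnitor X).inv (𝟙 B) ≫ triMap (𝟙 A) (triMap η (𝟙 X) ζ) (𝟙 B) ≫
      (triAssoc A (A' ⊗ A) X (B ⊗ B') B).hom =
      triMap (𝟙 A) (triUnitor X).inv (𝟙 B) ≫ (triAssoc A (𝟙_ C) X (𝟙_ C) B).hom ≫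
        triMap (A ◁ η) (𝟙 X) (ζ ▷ B) := by
    rw [triMap_triMap, tensorHom_id, id_tensorHom]
  have h6 : triMap (𝟙 A) (triUnitor X).inv (𝟙 B) ≫ (triAssoc A (𝟙_ C) X (𝟙_ C) B).hom =
      triMap (ρ_ A).inv (𝟙 X) (λ_ B).inv := by
    have h := congrArg (fun t => triMap (𝟙 A) (triUnitor X).inv (𝟙 B) ≫ t ≫
      triMap (ρ_ A).inv (𝟙 X) (λ_ B).inv) (triAssoc_unit_right A X B)
    simpa using h
  rw [h1, triCap]
  simp only [Category.assoc]
  rw [reassoc_of% h2, reassoc_of% h5, reassoc_of% h6, reassoc_of% h3, h4]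
  simp only [triMap_comp, Category.comp_id]
  rw [reassoc_of% hA, reassoc_of% hB]
  simp

/-- The cup and the cap may belong to different duals `A''` and `A'`. They straighten to comparison
morphisms on each side: the identity when they match, the double dual when arcs are bent twice. -/
lemma triCup_triMap_triCap_eq {A A' A'' B B' B'' : C} (η : 𝟙_ C ⟶ A'' ⊗ A) (ζ : 𝟙_ C ⟶ B ⊗ B'')
    (ε : A ⊗ A' ⟶ 𝟙_ C) (κ : B' ⊗ B ⟶ 𝟙_ C) (X : C) :
    triCup η ζ ((A' ⊗ X) ⊗ B') ≫ triMap (𝟙 A'') (triCap ε κ X) (𝟙 B'') =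
      triMap ((λ_ A').inv ≫ η ▷ A' ≫ (α_ _ _ _).hom ≫ A'' ◁ ε ≫ (ρ_ A'').hom) (𝟙 X)
        ((ρ_ B').inv ≫ B' ◁ ζ ≫ (α_ _ _ _).inv ≫ κ ▷ B'' ≫ (λ_ B'').hom) := by
  have h1 : triMap (𝟙 A'') (triCap ε κ X) (𝟙 B'') =
      triMap (𝟙 A'') (triAssoc A A' X B' B).hom (𝟙 B'') ≫
      triMap (𝟙 A'') (triMap ε (𝟙 X) κ) (𝟙 B'') ≫
        triMap (𝟙 A'') (triUnitor X).hom (𝟙 B'') := by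
    simp [triCap]
  have h2 : (triAssoc A'' A ((A' ⊗ X) ⊗ B') B B'').inv ≫
      triMap (𝟙 A'') (triAssoc A A' X B' B).hom (𝟙 B'') =
      (triAssoc (A'' ⊗ A) A' X B' (B ⊗ B'')).hom ≫ triMap (α_ _ _ _).hom (𝟙 X) (α_ _ _ _).inv ≫
        (triAssoc A'' (A ⊗ A') X (B' ⊗ B) B'').inv := by
    have := triAssoc_triAssoc A'' A A' X B' B B''
    rw [Iso.inv_comp_eq, ← reassoc_of% this, Iso.hom_inv_id, Category.comp_id]
  have h3 : triMap η (𝟙 ((A' ⊗ X) ⊗ B')) ζ ≫ (triAssoc (A'' ⊗ A) A' X B' (B ⊗ B'')).hom =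
      (triAssoc (𝟙_ C) A' X B' (𝟙_ C)).hom ≫ triMap (η ▷ A') (𝟙 X) (B' ◁ ζ) := by
    rw [← triMap_id, triMap_triMap, tensorHom_id, id_tensorHom]
  have h4 : (triUnitor ((A' ⊗ X) ⊗ B')).inv ≫ (triAssoc (𝟙_ C) A' X B' (𝟙_ C)).hom =
      triMap (λ_ A').inv (𝟙 X) (ρ_ B').inv := by
    have h := congrArg (fun t => (triUnitor ((A' ⊗ X) ⊗ B')).inv ≫ t ≫
      triMap (λ_ A').inv (𝟙 X) (ρ_ B').inv) (triAssoc_unit_left A' X B')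
    simpa using h
  have h5 : (triAssoc A'' (A ⊗ A') X (B' ⊗ B) B'').inv ≫
      triMap (𝟙 A'') (triMap ε (𝟙 X) κ) (𝟙 B'') =
      triMap (A'' ◁ ε) (𝟙 X) (κ ▷ B'') ≫ (triAssoc A'' (𝟙_ C) X (𝟙_ C) B'').inv := by
    rw [triMap_triMap_inv, tensorHom_id, id_tensorHom]
  have h6 : (triAssoc A'' (𝟙_ C) X (𝟙_ C) B'').inv ≫ triMap (𝟙 A'') (triUnitor X).hom (𝟙 B'') =
      triMap (ρ_ A'').hom (𝟙 X) (λ_ B'').hom := by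
    rw [← triAssoc_unit_right, Iso.inv_hom_id_assoc]
  rw [h1, triCup]
  simp only [Category.assoc]
  rw [reassoc_of% h2, reassoc_of% h5, h6, reassoc_of% h3, reassoc_of% h4]
  simp only [triMap_comp, Category.comp_id]

lemma triCup_triMap_triCap {A A' B B' : C} (η : 𝟙_ C ⟶ A' ⊗ A) (ζ : 𝟙_ C ⟶ B ⊗ B')
    (ε : A ⊗ A' ⟶ 𝟙_ C) (κ : B' ⊗ B ⟶ 𝟙_ C)
    (hA : η ▷ A' ≫ (α_ _ _ _).hom ≫ A' ◁ ε = (λ_ A').hom ≫ (ρ_ A').inv)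
    (hB : B' ◁ ζ ≫ (α_ _ _ _).inv ≫ κ ▷ B' = (ρ_ B').hom ≫ (λ_ B').inv) (X : C) :
    triCup η ζ ((A' ⊗ X) ⊗ B') ≫ triMap (𝟙 A') (triCap ε κ X) (𝟙 B') = 𝟙 _ := by
  rw [triCup_triMap_triCap_eq, reassoc_of% hA, reassoc_of% hB]
  simp

/-- By the interchange law the cap on the right can be closed before the cap on the left, which
splits the two-sided closure into two one-sided partial traces. -/
lemma triCup_triMap_triCap_eq_trace {A A' B B' X Y : C} (η : 𝟙_ C ⟶ A' ⊗ A) (ζ : 𝟙_ C ⟶ B ⊗ B')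
    (ε : A' ⊗ A ⟶ 𝟙_ C) (κ : B ⊗ B' ⟶ 𝟙_ C) (F : (A ⊗ X) ⊗ B ⟶ (A ⊗ Y) ⊗ B) :
    triCup η ζ X ≫ triMap (𝟙 A') F (𝟙 B') ≫ triCap ε κ Y = leftTrace η ε (rightTrace ζ κ F) := by
  have h1 : (triAssoc A' A Y B B').hom ≫ triMap ε (𝟙 Y) κ ≫ (triUnitor Y).hom =
      (α_ A' (A ⊗ Y) B).inv ▷ B' ≫ (α_ _ _ _).hom ≫ (A' ⊗ (A ⊗ Y)) ◁ κ ≫ (ρ_ _).hom ≫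
        (α_ _ _ _).inv ≫ ε ▷ Y ≫ (λ_ Y).hom := by
    calc _ = 𝟙 _ ⊗≫ ((ε ▷ Y) ▷ (B ⊗ B') ≫ (𝟙_ C ⊗ Y) ◁ κ) ⊗≫ 𝟙 _ := by
          simp only [triMap, triUnitor, StringData.reassoc, MonoidalCategory.tensorHom_def,
            Iso.trans_hom, whiskerRightIso_hom, Iso.symm_hom]
          monoidal
      _ = _ := by rw [← whisker_exchange]; monoidal
  rw [triCap, h1]
  simp only [triCup, triMap, triUnitor, StringData.reassoc, leftTrace, rightTrace,
    MonoidalCategory.tensorHom_def, Iso.trans_inv, whiskerRightIso_inv, Iso.symm_inv]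
  monoidal

/-- Bending a pair of parallel arcs at once is bending the inner arcs first and the outer ones
around them. This is used to bend the fused arcs of a product. -/
lemma triCup_nestedCup {A A₁ A' A₁' B B₁ B' B₁' : C} (η : 𝟙_ C ⟶ A₁ ⊗ A) (η' : 𝟙_ C ⟶ A₁' ⊗ A')
    (ζ : 𝟙_ C ⟶ B ⊗ B₁) (ζ' : 𝟙_ C ⟶ B' ⊗ B₁') (X : C) :
    triCup (nestedCup η η') (nestedCup ζ ζ') X ≫
      triMap (𝟙 _) (triAssoc A A' X B' B).inv (𝟙 _) =
    triCup η' ζ' X ≫ triMap (𝟙 _) (triCup η ζ ((A' ⊗ X) ⊗ B')) (𝟙 _) ≫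
      (triAssoc _ _ _ _ _).hom := by
  have h1 : triMap (nestedCup η η') (𝟙 X) (nestedCup ζ ζ') = triMap η' (𝟙 X) ζ' ≫
      triMap (A₁' ◁ ((λ_ _).inv ≫ η ▷ A' ≫ (α_ _ _ _).hom) ≫ (α_ _ _ _).inv) (𝟙 X)
        (B' ◁ ((λ_ _).inv ≫ ζ ▷ B₁' ≫ (α_ _ _ _).hom) ≫ (α_ _ _ _).inv) := by
    simp [nestedCup]
  have h2 : triMap (A₁' ◁ ((λ_ _).inv ≫ η ▷ A' ≫ (α_ _ _ _).hom) ≫ (α_ _ _ _).inv) (𝟙 X)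
        (B' ◁ ((λ_ _).inv ≫ ζ ▷ B₁' ≫ (α_ _ _ _).hom) ≫ (α_ _ _ _).inv) ≫
      (triAssoc _ _ _ _ _).inv ≫ triMap (𝟙 _) (triAssoc A A' X B' B).inv (𝟙 _) =
      (triAssoc _ _ _ _ _).inv ≫ triMap (𝟙 _) (triCup η ζ ((A' ⊗ X) ⊗ B')) (𝟙 _) ≫
        (triAssoc _ _ _ _ _).hom := by
    simp only [triCup, triMap, triUnitor, StringData.reassoc,
      MonoidalCategory.tensorHom_def, Iso.trans_hom, Iso.trans_inv, whiskerRightIso_hom,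
      whiskerRightIso_inv, Iso.symm_hom, Iso.symm_inv]
    monoidal
  rw [triCup, h1]
  simp only [Category.assoc]
  rw [h2]
  simp only [triCup, Category.assoc]

end TwoSided

namespace PartialTrace

variable {C : Type u} [Category.{v} C] [MonoidalCategory C]

lemma rightTrace_naturality {B B' X Y X' Y' : C} (η : 𝟙_ C ⟶ B ⊗ B') (ε : B ⊗ B' ⟶ 𝟙_ C)
    (f : X' ⟶ X) (F : X ⊗ B ⟶ Y ⊗ B) (g : Y ⟶ Y') :
    rightTrace η ε (f ▷ B ≫ F ≫ g ▷ B) = f ≫ rightTrace η ε F ≫ g := by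
  calc _ = (ρ_ X').inv ≫ (X' ◁ η ≫ f ▷ (B ⊗ B')) ≫ (α_ _ _ _).inv ≫ F ▷ B' ≫ (α_ _ _ _).hom ≫
        (g ▷ (B ⊗ B') ≫ Y' ◁ ε) ≫ (ρ_ Y').hom := by
        simp only [rightTrace]; monoidal
    _ = _ := by
        rw [whisker_exchange f η, ← whisker_exchange g ε]
        simp only [rightTrace]
        monoidal

section

variable [Preadditive C] [MonoidalPreadditive C]

lemma leftTrace_sum {ι : Type*} (s : Finset ι) {A A' X Y : C} (η : 𝟙_ C ⟶ A' ⊗ A)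
    (ε : A' ⊗ A ⟶ 𝟙_ C) (F : ι → (A ⊗ X ⟶ A ⊗ Y)) :
    leftTrace η ε (∑ i ∈ s, F i) = ∑ i ∈ s, leftTrace η ε (F i) := by
  simp only [leftTrace, whiskerLeft_sum, Preadditive.comp_sum, Preadditive.sum_comp]

end

end PartialTrace

namespace StringData

open DaggerCategory UnitaryMultifusionCategory TwoSided PartialTrace
open scoped TensorProduct

variable {C : Type u} [Category.{v} C] [Preadditive C] [Linear ℂ C] [MonoidalCategory C]
  [MonoidalPreadditive C] [MonoidalLinear ℂ C] [RigidCategory C] [DaggerCategory C]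
  [UnitaryMultifusionCategory C] (D : StringData C)

/-! #### Bending the arcs of half-diagrams -/

lemma ev_zigzag (a : D.L) :
    D.obj (D.bar a) ◁ D.coev a ≫ (α_ _ _ _).inv ≫ D.ev a ▷ _ = (ρ_ _).hom ≫ (λ_ _).inv :=
  (D.pairing a).coevaluation_evaluation'

lemma coev_zigzag (a : D.L) :
    D.coev a ▷ D.obj a ≫ (α_ _ _ _).hom ≫ _ ◁ D.ev a = (λ_ _).hom ≫ (ρ_ _).inv :=
  (D.pairing a).evaluation_coevaluation'

lemma dag_ev_zigzag (a : D.L) :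
    dag (D.ev a) ▷ D.obj (D.bar a) ≫ (α_ _ _ _).hom ≫ _ ◁ dag (D.coev a) =
      (λ_ _).hom ≫ (ρ_ _).inv := by
  have := congrArg dag (D.ev_zigzag a)
  simpa only [dag_comp, dag_whiskerLeft, dag_whiskerRight, dag_associator_inv,
    dag_leftUnitor_inv, dag_rightUnitor, Category.assoc] using this

lemma dag_coev_zigzag (a : D.L) :
    D.obj a ◁ dag (D.ev a) ≫ (α_ _ _ _).inv ≫ dag (D.coev a) ▷ _ = (ρ_ _).hom ≫ (λ_ _).inv := by
  have := congrArg dag (D.coev_zigzag a)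
  simpa only [dag_comp, dag_whiskerLeft, dag_whiskerRight, dag_associator,
    dag_rightUnitor_inv, dag_leftUnitor, Category.assoc] using this

/-- The cups creating the arcs `ā, a` and `b, b̄` around `X`. -/
abbrev outerCup (a b : D.L) (X : C) := triCup (dag (D.ev a)) (D.coev b) X

/-- The caps closing the arcs `ā, a` and `b, b̄` around `X`. -/
abbrev outerCap (a b : D.L) (X : C) := triCap (D.ev a) (dag (D.coev b)) X

/-- The cups creating the arcs `a, ā` and `b̄, b` around `X`. -/
abbrev innerCup (a b : D.L) (X : C) := triCup (D.coev a) (dag (D.ev b)) X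

lemma _root_.TwoSided.dag_triCup {A A' B B' : C} (η : 𝟙_ C ⟶ A' ⊗ A) (ζ : 𝟙_ C ⟶ B ⊗ B')
    (X : C) : dag (triCup η ζ X) = triCap (dag η) (dag ζ) X := by
  simp only [triCup, triCap, dag_comp, dag_triAssoc_inv, dag_triUnitor_inv, dag_triMap, dag_id,
    Category.assoc]

lemma _root_.TwoSided.dag_triCap {A A' B B' : C} (ε : A' ⊗ A ⟶ 𝟙_ C) (κ : B ⊗ B' ⟶ 𝟙_ C)
    (X : C) : dag (triCap ε κ X) = triCup (dag ε) (dag κ) X := by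
  simp only [triCup, triCap, dag_comp, dag_triAssoc_hom, dag_triUnitor_hom, dag_triMap, dag_id,
    Category.assoc]

lemma innerCup_outerCap (a b : D.L) (X : C) :
    D.innerCup a b ((D.obj a ⊗ X) ⊗ D.obj b) ≫ triMap (𝟙 _) (D.outerCap a b X) (𝟙 _) = 𝟙 _ :=
  triCup_triMap_triCap _ _ _ _ (D.coev_zigzag a) (D.dag_coev_zigzag b) X

lemma innerCup_outerCap' (a b : D.L) (X : C) :
    triMap (𝟙 _) (D.innerCup a b X) (𝟙 _) ≫
      D.outerCap a b ((D.obj (D.bar a) ⊗ X) ⊗ D.obj (D.bar b)) = 𝟙 _ :=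
  triMap_triCup_triCap _ _ _ _ (D.ev_zigzag a) (D.dag_ev_zigzag b) X

lemma cups_eq (a b x : D.L) : D.cups a b x = D.outerCup a b (D.obj x) := by
  simp only [cups, triCup, triMap, triUnitor, StringData.reassoc, MonoidalCategory.tensorHom_def,
    Iso.trans_inv, whiskerRightIso_inv, Iso.symm_inv]
  monoidal

/-- Bend the arcs of `a X b ⟶ Z` down. -/
def bendDown (a b : D.L) {X Z : C} (w : (D.obj a ⊗ X) ⊗ D.obj b ⟶ Z) :
    X ⟶ (D.obj (D.bar a) ⊗ Z) ⊗ D.obj (D.bar b) :=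
  D.outerCup a b X ≫ triMap (𝟙 _) w (𝟙 _)

/-- Bend the arcs of `Z ⟶ a X b` up. -/
def bendUp (a b : D.L) {X Z : C} (v : Z ⟶ (D.obj a ⊗ X) ⊗ D.obj b) :
    (D.obj (D.bar a) ⊗ Z) ⊗ D.obj (D.bar b) ⟶ X :=
  triMap (𝟙 _) v (𝟙 _) ≫ D.outerCap a b X

lemma bendTop_eq (a b f h : D.L) (w : D.Top a b f h) : D.bendTop a b f h w = D.bendDown a b w := by
  simp [bendTop, bendDown, triMap, cups_eq]

lemma bendBot_eq (a b c e : D.L) (v : D.Bot a b c e) : D.bendBot a b c e v = D.bendUp a b v := by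
  simp [bendBot, bendUp, triMap, cups_eq, dag_triCup, dag_dag]

lemma dag_bendDown (a b : D.L) {X Z : C} (w : (D.obj a ⊗ X) ⊗ D.obj b ⟶ Z) :
    dag (D.bendDown a b w) = D.bendUp a b (dag w) := by
  simp [bendDown, bendUp, dag_comp, dag_triMap, dag_triCup, dag_dag, dag_id]

lemma dag_bendUp (a b : D.L) {X Z : C} (v : Z ⟶ (D.obj a ⊗ X) ⊗ D.obj b) :
    dag (D.bendUp a b v) = D.bendDown a b (dag v) := by
  simp [bendDown, bendUp, dag_comp, dag_triMap, dag_triCap, dag_dag, dag_id]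

/-- Bending is undone by the opposite cups, by a zigzag on each side; with `bendUp_innerCup` it is a
bijection. -/
lemma innerCup_bendUp (a b : D.L) {X Z : C} (v : Z ⟶ (D.obj a ⊗ X) ⊗ D.obj b) :
    D.innerCup a b Z ≫ triMap (𝟙 _) (D.bendUp a b v) (𝟙 _) = v := by
  have h := triCup_naturality (D.coev a) (dag (D.ev b)) v
  have h2 : triMap (𝟙 (D.obj a)) (D.bendUp a b v) (𝟙 (D.obj b)) =
      triMap (𝟙 _) (triMap (𝟙 _) v (𝟙 _)) (𝟙 _) ≫ triMap (𝟙 _) (D.outerCap a b X) (𝟙 _) := by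
    simp [bendUp]
  rw [h2, ← reassoc_of% h, D.innerCup_outerCap a b X, Category.comp_id]

lemma bendUp_innerCup (a b : D.L) {X Z : C}
    (p : (D.obj (D.bar a) ⊗ Z) ⊗ D.obj (D.bar b) ⟶ X) :
    D.bendUp a b (D.innerCup a b Z ≫ triMap (𝟙 _) p (𝟙 _)) = p := by
  have h := triCap_naturality (D.ev a) (dag (D.coev b)) p
  have h2 : triMap (𝟙 (D.obj (D.bar a))) (D.innerCup a b Z ≫ triMap (𝟙 _) p (𝟙 _))
      (𝟙 (D.obj (D.bar b))) = triMap (𝟙 _) (D.innerCup a b Z) (𝟙 _) ≫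
        triMap (𝟙 _) (triMap (𝟙 _) p (𝟙 _)) (𝟙 _) := by
    simp
  rw [bendUp, h2, Category.assoc, ← h, reassoc_of% (D.innerCup_outerCap' a b Z)]

lemma bendDown_bendUp (a b : D.L) {X X' Z : C} (w : (D.obj a ⊗ X) ⊗ D.obj b ⟶ Z)
    (v : Z ⟶ (D.obj a ⊗ X') ⊗ D.obj b) :
    D.bendDown a b w ≫ D.bendUp a b v = leftTrace (dag (D.ev a)) (D.ev a)
      (rightTrace (D.coev b) (dag (D.coev b)) (w ≫ v)) := by
  rw [← triCup_triMap_triCap_eq_trace]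
  simp [bendDown, bendUp]

/-- Closing the arcs `a` and `b` of `a i b ⟶ k ⟶ a i b`. -/
theorem bend_trace (a b i k : D.L) (v : D.Bot a b k i) (w : D.Top a b i k) :
    D.bendDown a b w ≫ D.bendUp a b v =
      ((D.dim k : ℂ) / D.dim i * D.coeff k (v ≫ w)) • 𝟙 _ := by
  rw [bendDown_bendUp]
  set R := D.vtxResolution a i
  have h1 : rightTrace (D.coev b) (dag (D.coev b)) (w ≫ v) =
      ∑ m, rightTrace (D.coev b) (dag (D.coev b)) (w ≫ v ≫ R.prj m ▷ D.obj b) ≫ R.inc m := by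
    rw [← R.sum_comp_right (rightTrace (D.coev b) (dag (D.coev b)) (w ≫ v))]
    refine Finset.sum_congr rfl fun m _ => ?_
    have := rightTrace_naturality (D.coev b) (dag (D.coev b)) (𝟙 _) (w ≫ v) (R.prj m)
    simp only [id_whiskerRight, Category.id_comp, Category.assoc] at this
    rw [this]
  -- Resolving `a ⊗ i` through a label `j` reduces the closure to vertices. The right trace
  -- contributes `d_k / d_j`, the left one `d_j / d_i`, and the intermediate dimension cancels.
  have h2 : ∀ m, leftTrace (dag (D.ev a)) (D.ev a)
      (rightTrace (D.coev b) (dag (D.coev b)) (w ≫ v ≫ R.prj m ▷ D.obj b) ≫ R.inc m) =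
      ((D.dim k : ℂ) / D.dim i *
        D.coeff k ((v ≫ R.prj m ▷ D.obj b) ≫ R.inc m ▷ D.obj b ≫ w)) • 𝟙 _ := by
    intro m
    rw [leftTrace_comp]
    have := rightTrace_naturality (D.coev b) (dag (D.coev b)) (R.inc m)
      (w ≫ v ≫ R.prj m ▷ D.obj b) (𝟙 _)
    simp only [id_whiskerRight, Category.comp_id] at this
    rw [← this, ← Category.assoc, rightTrace_comp]
    rw [D.coeff (R.lab m) |>.map_smul, coeff_id]
    congr 1
    have := D.dim_ne_zero (R.lab m)
    simp only [smul_eq_mul]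
    field_simp
  rw [h1, leftTrace_sum]
  simp only [h2]
  rw [← Finset.sum_smul, ← Finset.mul_sum, ← map_sum]
  congr 3
  have h3 : v = ∑ m, (v ≫ R.prj m ▷ D.obj b) ≫ R.inc m ▷ D.obj b := by
    have := congrArg (· ▷ D.obj b) R.complete
    simp only [sum_whiskerRight, id_whiskerRight, comp_whiskerRight] at this
    simp only [Category.assoc, ← Preadditive.comp_sum, this, Category.comp_id]
  conv_rhs => rw [h3]
  simp only [Preadditive.sum_comp, Category.assoc]

end StringData

namespace StringData

open DaggerCategory UnitaryMultifusionCategory TwoSided PartialTrace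
open scoped TensorProduct

variable {C : Type u} [Category.{v} C] [Preadditive C] [Linear ℂ C] [MonoidalCategory C]
  [MonoidalPreadditive C] [MonoidalLinear ℂ C] [RigidCategory C] [DaggerCategory C]
  [UnitaryMultifusionCategory C] (D : StringData C)

/-! #### The antipode -/

/-- The pairs of vertices `k ⟶ j ⊗ b`, `j ⟶ a ⊗ i`. -/
abbrev VtxPair (a b i k : D.L) := Σ j, Fin (D.N j b k) × Fin (D.N a i j)

/-- The normalized morphism `k ⟶ (a ⊗ i) ⊗ b` of a pair of vertices. -/
noncomputable def pairInc (a b i k : D.L) (x : D.VtxPair a b i k) : D.Bot a b k i :=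
  ((D.Y a i x.1)⁻¹ * (D.Y x.1 b k)⁻¹) •
    (D.vtx x.1 b k x.2.1 ≫ (D.vtx a i x.1 x.2.2 ▷ D.obj b))

/-- The morphism `(a ⊗ i) ⊗ b ⟶ k` of a pair of vertices. -/
def pairPrj (a b i k : D.L) (x : D.VtxPair a b i k) : D.Top a b i k :=
  dag (D.vtx a i x.1 x.2.2) ▷ D.obj b ≫ dag (D.vtx x.1 b k x.2.1)

/-- Grouping by the outer label `k` allows `k` to be fixed while the inner labels vary, as in the
resolution of `(ā ⊗ k) ⊗ b̄` by bent vertices. -/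
lemma sum_triResolution {M : Type*} [AddCommMonoid M] (a b i : D.L)
    (Φ : ∀ k, D.Bot a b k i → D.Top a b i k → M) :
    ∑ m, Φ ((D.triResolution a b i).lab m) ((D.triResolution a b i).inc m)
      ((D.triResolution a b i).prj m) =
    ∑ k, ∑ x : D.VtxPair a b i k, Φ k (D.pairInc a b i k x) (D.pairPrj a b i k x) := by
  trans ∑ j, ∑ k, ∑ x : Fin (D.N j b k) × Fin (D.N a i j),
    Φ k (D.pairInc a b i k ⟨j, x⟩) (D.pairPrj a b i k ⟨j, x⟩)
  · refine (Fintype.sum_sigma _).trans (Finset.sum_congr rfl fun j _ => ?_)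
    exact Fintype.sum_sigma _
  · rw [Finset.sum_comm]
    exact Finset.sum_congr rfl fun k _ => (Fintype.sum_sigma fun x : D.VtxPair a b i k =>
      Φ k (D.pairInc a b i k x) (D.pairPrj a b i k x)).symm

lemma sum_pairPrj_pairInc (a b i : D.L) :
    ∑ k, ∑ x : D.VtxPair a b i k, D.pairPrj a b i k x ≫ D.pairInc a b i k x = 𝟙 _ :=
  (D.sum_triResolution a b i fun _ p q => q ≫ p).symm.trans (D.triResolution a b i).complete

lemma sum_comp_pairPrj_pairInc (a b i k : D.L) (u : D.Bot a b k i) :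
    ∑ x : D.VtxPair a b i k, (u ≫ D.pairPrj a b i k x) ≫ D.pairInc a b i k x = u := by
  have h := congrArg (u ≫ ·) (D.sum_pairPrj_pairInc a b i)
  simp only [Preadditive.comp_sum, Category.comp_id] at h
  rw [Finset.sum_eq_single k] at h
  · simpa only [Category.assoc] using h
  · intro k' _ hk'
    refine Finset.sum_eq_zero fun x _ => ?_
    rw [← Category.assoc, D.hom_eq_zero (Ne.symm hk') (u ≫ _), Limits.zero_comp]
  · simp

lemma comul_gdiag_obj (a b c e f h : D.L) (v : D.Bot a b c e) (w : D.Top a b f h) :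
    D.comul (D.gdiag (D.obj a) (D.obj b) c e f h v w) =
      ∑ i, ∑ k, ∑ x : D.VtxPair a b i k,
      D.gdiag (D.obj a) (D.obj b) k i f h (D.pairInc a b i k x) w ⊗ₜ[ℂ]
        D.gdiag (D.obj a) (D.obj b) c e i k v (D.pairPrj a b i k x) := by
  rw [D.comul_gdiag _ _ (fun i => D.triResolution a b i)]
  exact Finset.sum_congr rfl fun i _ => D.sum_triResolution a b i fun k p q =>
    D.gdiag (D.obj a) (D.obj b) k i f h p w ⊗ₜ[ℂ] D.gdiag (D.obj a) (D.obj b) c e i k v q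

lemma bendUp_sum {ι : Type*} (s : Finset ι) (a b : D.L) {X Z : C}
    (v : ι → (Z ⟶ (D.obj a ⊗ X) ⊗ D.obj b)) :
    D.bendUp a b (∑ m ∈ s, v m) = ∑ m ∈ s, D.bendUp a b (v m) := by
  simp only [bendUp, triMap_sum_mid, Preadditive.sum_comp]

lemma bendUp_smul (a b : D.L) {X Z : C} (z : ℂ) (v : Z ⟶ (D.obj a ⊗ X) ⊗ D.obj b) :
    D.bendUp a b (z • v) = z • D.bendUp a b v := by
  simp only [bendUp, triMap_smul_mid, Linear.smul_comp]

/-- Bending the resolutions of the objects `(a ⊗ i) ⊗ b` resolves `(ā ⊗ k) ⊗ b̄`. -/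
lemma sum_bend (a b k : D.L) :
    ∑ i, ∑ x : D.VtxPair a b i k, D.bendUp a b (D.pairInc a b i k x) ≫
      (((D.dim i : ℂ) / D.dim k) • D.bendDown a b (D.pairPrj a b i k x)) = 𝟙 _ := by
  have key : ∀ i (p : (D.obj (D.bar a) ⊗ D.obj k) ⊗ D.obj (D.bar b) ⟶ D.obj i),
      (∑ i, ∑ x : D.VtxPair a b i k, D.bendUp a b (D.pairInc a b i k x) ≫
      (((D.dim i : ℂ) / D.dim k) • D.bendDown a b (D.pairPrj a b i k x))) ≫ p = p := by
    intro i p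
    -- It suffices to test against morphisms to simple objects, all of which are bent. Expanding `u`
    -- in vertex pairs and closing by `bend_trace` produces `d_k / d_i`, which the weight `d_i /
    -- d_k` cancels.
    obtain ⟨u, rfl⟩ : ∃ u, D.bendUp a b u = p := ⟨_, D.bendUp_innerCup a b p⟩
    simp only [Preadditive.sum_comp]
    rw [Finset.sum_eq_single i]
    · conv_rhs => rw [← D.sum_comp_pairPrj_pairInc a b i k u, bendUp_sum]
      refine Finset.sum_congr rfl fun x _ => ?_
      conv_rhs => rw [← D.coeff_smul_id k (u ≫ D.pairPrj a b i k x)]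
      rw [Category.assoc, Linear.smul_comp, bend_trace, Linear.smul_comp, Category.id_comp,
        bendUp_smul, smul_smul, Linear.comp_smul, Category.comp_id]
      congr 1
      have := D.dim_ne_zero i
      have := D.dim_ne_zero k
      field_simp
    · intro i' _ hi'
      refine Finset.sum_eq_zero fun x _ => ?_
      rw [Category.assoc, Linear.smul_comp, D.hom_eq_zero hi' (_ ≫ _), smul_zero,
        Limits.comp_zero]
    · simp
  set T := ∑ i, ∑ x : D.VtxPair a b i k, D.bendUp a b (D.pairInc a b i k x) ≫
      (((D.dim i : ℂ) / D.dim k) • D.bendDown a b (D.pairPrj a b i k x))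
  set R := D.resolution ((D.obj (D.bar a) ⊗ D.obj k) ⊗ D.obj (D.bar b))
  have h := R.sum_comp_right T
  simp only [key, R.complete] at h
  exact h.symm

lemma antipode_gdiag_obj (a b c e f h : D.L) (v : D.Bot a b c e) (w : D.Top a b f h) :
    D.antipode (D.gdiag (D.obj a) (D.obj b) c e f h v w) =
      ((D.dim f : ℂ) / D.dim h) • D.gdiag (D.obj (D.bar a)) (D.obj (D.bar b)) f h c e
        (D.bendDown a b w) (D.bendUp a b v) := by
  rw [gdiag_obj, gdiag_obj, antipode, LinearMap.sum_apply,
    Finset.sum_eq_single (⟨a, b, c, e, f, h⟩ : TubeLabel D.L)]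
  · simp only [LinearMap.comp_apply, LinearMap.proj_apply, diagₗ_apply, diag, Pi.single_eq_same,
      antipodeSector, LinearMap.smul_apply, LinearEquiv.coe_coe, TensorProduct.comm_tmul,
      TensorProduct.map_tmul, bendTop_eq, bendBot_eq, LinearMap.single_apply]
    push_cast
    rfl
  · intro l _ hl
    simp only [LinearMap.comp_apply, LinearMap.proj_apply, diagₗ_apply, diag]
    rw [Pi.single_eq_of_ne hl, map_zero]
  · simp

lemma gdiag_unit_top (y f h : D.L) (φ : D.obj f ⟶ D.obj h) :
    D.gdiag (𝟙_ C) (𝟙_ C) y y f h (triUnitor _).inv ((triUnitor _).hom ≫ φ) =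
      D.coeff h (D.delta h f ≫ φ) • D.unitDiag y f := by
  rw [unitDiag, coeff_smul_gdiag_top]

/-- `∑ x₍₁₎ S(x₍₂₎)` for a diagram. -/
lemma mul_antipode_gdiag (a b c e f h : D.L) (v : D.Bot a b c e) (w : D.Top a b f h) :
    TensorProduct.lift D.mul (D.antipode.lTensor _
      (D.comul (D.gdiag (D.obj a) (D.obj b) c e f h v w))) =
      ∑ y, D.counit (D.gdiag (D.obj a) (D.obj b) c e f h v w) • D.unitDiag y c := by
  rw [comul_gdiag_obj]
  simp only [map_sum, LinearMap.lTensor_tmul, TensorProduct.lift.tmul]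
  rw [Finset.sum_comm]
  refine Finset.sum_congr rfl fun k _ => ?_
  have h1 : ∀ i (x : D.VtxPair a b i k),
      D.mul (D.gdiag (D.obj a) (D.obj b) k i f h (D.pairInc a b i k x) w)
      (D.antipode (D.gdiag (D.obj a) (D.obj b) c e i k v (D.pairPrj a b i k x))) =
      D.gdiag _ _ k k c h (D.innerCup a b (D.obj k) ≫ triMap (𝟙 _)
        (D.bendUp a b (D.pairInc a b i k x) ≫
          (((D.dim i : ℂ) / D.dim k) • D.bendDown a b (D.pairPrj a b i k x))) (𝟙 _) ≫
          (triAssoc _ _ _ _ _).hom)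
        ((triAssoc _ _ _ _ _).inv ≫ triMap (𝟙 _) (D.bendUp a b v ≫ D.delta e f) (𝟙 _) ≫ w) := by
    intro i x
    -- Writing the first lower half as the unbending of its bent form makes both lower halves meet
    -- as in `sum_bend`; the antipode of the second piece supplies precisely the required weight.
    have h2 : D.innerCup a b (D.obj k) ≫ triMap (𝟙 _) (D.bendUp a b (D.pairInc a b i k x) ≫
          (((D.dim i : ℂ) / D.dim k) • D.bendDown a b (D.pairPrj a b i k x))) (𝟙 _) =
        ((D.dim i : ℂ) / D.dim k) • (D.pairInc a b i k x ≫
          triMap (𝟙 _) (D.bendDown a b (D.pairPrj a b i k x)) (𝟙 _)) := by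
      conv_rhs => rw [← D.innerCup_bendUp a b (D.pairInc a b i k x)]
      rw [Linear.comp_smul, triMap_smul_mid, Linear.comp_smul, Category.assoc, triMap_comp,
        Category.comp_id, Category.comp_id]
    rw [antipode_gdiag_obj, map_smul, mul_gdiag, delta_self, Category.id_comp,
      ← LinearMap.smul_apply, ← map_smul, ← Category.assoc (D.innerCup a b _), h2,
      Linear.smul_comp, Category.assoc]
  simp only [h1, ← LinearMap.sum_apply, ← map_sum]
  -- After summation the lower half consists of cups only. These slide to the upper half, where they
  -- straighten the bent `v` and leave the morphism evaluated by the counit.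
  have h3 : ∑ i, ∑ x : D.VtxPair a b i k, D.innerCup a b (D.obj k) ≫ triMap (𝟙 _)
        (D.bendUp a b (D.pairInc a b i k x) ≫
          (((D.dim i : ℂ) / D.dim k) • D.bendDown a b (D.pairPrj a b i k x))) (𝟙 _) ≫
          (triAssoc _ _ _ _ _).hom = (triUnitor _).inv ≫ triMap (D.coev a) (𝟙 _) (dag (D.ev b)) := by
    simp only [← Preadditive.comp_sum, ← Preadditive.sum_comp, ← triMap_sum_mid, sum_bend]
    simp [triCup]
  rw [h3, gdiag_dinatural, counit_gdiag, ← gdiag_unit_top]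
  congr 1
  have h4 : triMap (D.coev a) (𝟙 (D.obj c)) (dag (D.ev b)) ≫ (triAssoc _ _ _ _ _).inv =
      (triUnitor _).hom ≫ D.innerCup a b (D.obj c) := by
    simp [triCup]
  have h5 : D.innerCup a b (D.obj c) ≫ triMap (𝟙 _) (D.bendUp a b v ≫ D.delta e f) (𝟙 _) =
      v ≫ triMap (𝟙 _) (D.delta e f) (𝟙 _) := by
    conv_rhs => rw [← D.innerCup_bendUp a b v]
    simp
  rw [reassoc_of% h4, reassoc_of% h5]

/-- `∑ S(x₍₁₎) x₍₂₎` for a diagram. -/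
lemma antipode_mul_gdiag (a b c e f h : D.L) (v : D.Bot a b c e) (w : D.Top a b f h) :
    TensorProduct.lift D.mul (D.antipode.rTensor _
      (D.comul (D.gdiag (D.obj a) (D.obj b) c e f h v w))) =
      ∑ x, D.counit (D.gdiag (D.obj a) (D.obj b) c e f h v w) • D.unitDiag f x := by
  rw [comul_gdiag_obj]
  simp only [map_sum, LinearMap.rTensor_tmul, TensorProduct.lift.tmul]
  refine Finset.sum_congr rfl fun i _ => ?_
  simp only [antipode_gdiag_obj, map_smul, LinearMap.smul_apply, mul_gdiag, delta_self,
    Category.comp_id, ← Finset.smul_sum, ← map_sum]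
  -- Here the completeness sum appears in the upper half and needs no weight. It leaves caps, which
  -- slide to the lower half and close `w` against `v`.
  have h3 : ∑ k, ∑ x : D.VtxPair a b i k, (triAssoc (D.obj (D.bar a)) (D.obj a) (D.obj i)
      (D.obj b) (D.obj (D.bar b))).inv ≫ triMap (𝟙 _) (D.pairPrj a b i k x) (𝟙 _) ≫
      D.bendUp a b (D.pairInc a b i k x) = triMap (D.ev a) (𝟙 _) (dag (D.coev b)) ≫
        (triUnitor _).hom := by
    have h4 := congrArg (fun t => triMap (𝟙 (D.obj (D.bar a))) t (𝟙 (D.obj (D.bar b))) ≫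
      D.outerCap a b (D.obj i)) (D.sum_pairPrj_pairInc a b i)
    simp only [triMap_sum_mid, Preadditive.sum_comp] at h4
    simp only [← Preadditive.comp_sum, bendUp, triMap_comp_assoc, Category.comp_id, h4]
    simp [triCap]
  rw [h3, ← gdiag_dinatural, counit_gdiag]
  have h4 : (D.bendDown a b w ≫ triMap (𝟙 _) (D.delta h c ≫ v) (𝟙 _) ≫
      (triAssoc _ _ _ _ _).hom) ≫ triMap (D.ev a) (𝟙 _) (dag (D.coev b)) =
      (D.bendDown a b w ≫ D.bendUp a b (D.delta h c ≫ v)) ≫ (triUnitor _).inv := by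
    simp [bendUp, triCap]
  rw [h4]
  -- The factor `d_f / d_h` of the antipode cancels `d_h / d_e` from `bend_trace` exactly when `e =
  -- f`; for other labels Schur's lemma and the counit both give zero.
  by_cases hef : e = f
  · subst hef
    rw [bend_trace, delta_self, triMap_id, Category.id_comp, Linear.smul_comp, Category.id_comp,
      map_smul, LinearMap.smul_apply, smul_smul, Category.assoc, unitDiag]
    congr 1
    have := D.dim_ne_zero e
    have := D.dim_ne_zero h
    field_simp
  · rw [D.hom_eq_zero (Ne.symm hef) (_ ≫ _), D.delta_of_ne hef, triMap_zero_mid]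
    simp

lemma mul_antipode_tube (x : D.Tube) :
    TensorProduct.lift D.mul (D.antipode.lTensor _ (D.comul x)) =
      TensorProduct.lid ℂ _ (TensorProduct.map (D.counit ∘ₗ D.mul.flip x) LinearMap.id
        (D.comul D.one)) := by
  induction x using D.tube_induction with
  | zero => simp
  | add x x' hx hx' => simp [hx, hx', TensorProduct.map_add_left, LinearMap.comp_add]
  | diag a b c e f h v w =>
  rw [mul_antipode_gdiag, comul_one_eq]
  simp only [map_sum, TensorProduct.map_tmul, TensorProduct.lid_tmul, LinearMap.comp_apply,
    LinearMap.flip_apply, LinearMap.id_apply, unitDiag_mul]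
  rw [Finset.sum_comm]
  refine Finset.sum_congr rfl fun y _ => ?_
  rw [Finset.sum_eq_single h, Finset.sum_eq_single c]
  · simp
  · intro i _ hi
    simp [hi]
  · simp
  · intro x _ hx
    simp [hx]
  · simp

lemma antipode_mul_tube (x : D.Tube) :
    TensorProduct.lift D.mul (D.antipode.rTensor _ (D.comul x)) =
      TensorProduct.rid ℂ _ (TensorProduct.map LinearMap.id (D.counit ∘ₗ D.mul x)
        (D.comul D.one)) := by
  induction x using D.tube_induction with
  | zero => simp
  | add x x' hx hx' => simp [hx, hx', TensorProduct.map_add_right, LinearMap.comp_add]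
  | diag a b c e f h v w =>
  rw [antipode_mul_gdiag, comul_one_eq]
  simp only [map_sum, TensorProduct.map_tmul, TensorProduct.rid_tmul, LinearMap.comp_apply,
    LinearMap.id_apply, mul_unitDiag]
  refine Finset.sum_congr rfl fun y _ => ?_
  rw [Finset.sum_eq_single e, Finset.sum_eq_single f]
  · simp
  · intro i _ hi
    simp [hi]
  · simp
  · intro x _ hx
    simp [hx]
  · simp

/-- The product of the first two legs is a counit times unit diagrams, which act as the identity on
the last leg; what remains is the antipode applied to the counit identity. -/
lemma antipode_mul_antipode_tube (x : D.Tube) :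
    TensorProduct.lift D.mul (TensorProduct.map
      (TensorProduct.lift D.mul ∘ₗ D.antipode.rTensor _) D.antipode
        (D.comul.rTensor _ (D.comul x))) = D.antipode x := by
  induction x using D.tube_induction with
  | zero => simp
  | add x x' hx hx' => simp only [map_add, hx, hx']
  | diag a b c e f h v w =>
  conv_rhs => rw [← D.counit_comul_tube (D.gdiag (D.obj a) (D.obj b) c e f h v w)]
  rw [comul_gdiag_obj]
  simp only [map_sum, LinearMap.rTensor_tmul, TensorProduct.map_tmul, TensorProduct.lift.tmul,
    LinearMap.comp_apply, TensorProduct.lid_tmul, map_smul]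
  refine Finset.sum_congr rfl fun i _ => Finset.sum_congr rfl fun k _ =>
    Finset.sum_congr rfl fun y _ => ?_
  rw [antipode_mul_gdiag, ← Finset.smul_sum, map_smul, LinearMap.smul_apply]
  by_cases hif : i = f
  · subst hif
    congr 1
    rw [antipode_gdiag_obj, map_smul]
    congr 1
    rw [map_sum, LinearMap.sum_apply]
    simp [unitDiag_mul]
  · have : D.counit (D.gdiag (D.obj a) (D.obj b) k i f h (D.pairInc a b i k y) w) = 0 := by
      rw [counit_gdiag, D.delta_of_ne hif, triMap_zero_mid]
      simp
    rw [this, zero_smul, zero_smul]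

theorem isWeakHopfAlgebra :
    WeakHopf.IsWeakHopfAlgebra D.mul D.one D.comul D.counit D.antipode where
  toIsWeakBialgebra := D.isWeakBialgebra
  mul_antipode := D.mul_antipode_tube
  antipode_mul := D.antipode_mul_tube
  antipode_mul_antipode := D.antipode_mul_antipode_tube

end StringData

/-! ### Comparison of two pairings with a common factor -/

namespace PartialTrace

variable {C : Type u} [Category.{v} C] [MonoidalCategory C]

/-- One half of Frobenius reciprocity: since `Y` is paired with `X`, every cup `θ` into `X' ⊗ Y` is
the standard cup followed by a morphism `X ⟶ X'`, obtained by closing `θ` with `ε`. The next lemma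
treats caps. -/
lemma coevaluation_comp_comparison {X X' Y : C} (η : 𝟙_ C ⟶ X ⊗ Y) (ε : Y ⊗ X ⟶ 𝟙_ C)
    (h : Y ◁ η ≫ (α_ _ _ _).inv ≫ ε ▷ Y = (ρ_ Y).hom ≫ (λ_ Y).inv) (θ : 𝟙_ C ⟶ X' ⊗ Y) :
    η ≫ ((λ_ X).inv ≫ θ ▷ X ≫ (α_ _ _ _).hom ≫ X' ◁ ε ≫ (ρ_ X').hom) ▷ Y = θ := by
  calc _ = 𝟙 _ ⊗≫ (𝟙_ C ◁ η ≫ θ ▷ (X ⊗ Y)) ⊗≫ (X' ◁ ε) ▷ Y ⊗≫ 𝟙 _ := by monoidal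
    _ = θ ⊗≫ X' ◁ (Y ◁ η ≫ (α_ _ _ _).inv ≫ ε ▷ Y) ⊗≫ 𝟙 _ := by
        rw [whisker_exchange]; monoidal
    _ = _ := by rw [h]; monoidal

lemma comparison_comp_evaluation {X X' Y : C} (η : 𝟙_ C ⟶ X ⊗ Y) (ε : Y ⊗ X ⟶ 𝟙_ C)
    (h : Y ◁ η ≫ (α_ _ _ _).inv ≫ ε ▷ Y = (ρ_ Y).hom ≫ (λ_ Y).inv) (σ : Y ⊗ X' ⟶ 𝟙_ C) :
    Y ◁ ((λ_ X').inv ≫ η ▷ X' ≫ (α_ _ _ _).hom ≫ X ◁ σ ≫ (ρ_ X).hom) ≫ ε = σ := by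
  calc _ = 𝟙 _ ⊗≫ Y ◁ η ▷ X' ⊗≫ ((Y ⊗ X) ◁ σ ≫ ε ▷ 𝟙_ C) ⊗≫ 𝟙 _ := by monoidal
    _ = 𝟙 _ ⊗≫ (Y ◁ η ≫ (α_ _ _ _).inv ≫ ε ▷ Y) ▷ X' ⊗≫ σ := by
        rw [whisker_exchange]; monoidal
    _ = _ := by rw [h]; monoidal

end PartialTrace

namespace StringData

open DaggerCategory UnitaryMultifusionCategory TwoSided PartialTrace
open scoped TensorProduct

variable {C : Type u} [Category.{v} C] [Preadditive C] [Linear ℂ C] [MonoidalCategory C]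
  [MonoidalPreadditive C] [MonoidalLinear ℂ C] [RigidCategory C] [DaggerCategory C]
  [UnitaryMultifusionCategory C] (D : StringData C)

/-! #### The comparison of a label with its double dual -/

/-- The comparison `a ⟶ ā̄`. -/
def doubleDual (a : D.L) : D.obj a ⟶ D.obj (D.bar (D.bar a)) :=
  (λ_ _).inv ≫ dag (D.ev (D.bar a)) ▷ D.obj a ≫ (α_ _ _ _).hom ≫ _ ◁ D.ev a ≫ (ρ_ _).hom

/-- The comparison `ā̄ ⟶ a`. -/
def doubleDualInv (a : D.L) : D.obj (D.bar (D.bar a)) ⟶ D.obj a :=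
  (λ_ _).inv ≫ D.coev a ▷ _ ≫ (α_ _ _ _).hom ≫ _ ◁ dag (D.coev (D.bar a)) ≫ (ρ_ _).hom

lemma coev_doubleDual (a : D.L) :
    D.coev a ≫ D.doubleDual a ▷ _ = dag (D.ev (D.bar a)) :=
  coevaluation_comp_comparison _ _ (D.ev_zigzag a) _

lemma dag_ev_doubleDualInv (a : D.L) :
    dag (D.ev (D.bar a)) ≫ D.doubleDualInv a ▷ _ = D.coev a :=
  coevaluation_comp_comparison _ _ (D.dag_coev_zigzag (D.bar a)) _

lemma doubleDualInv_ev (a : D.L) :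
    _ ◁ D.doubleDualInv a ≫ D.ev a = dag (D.coev (D.bar a)) :=
  comparison_comp_evaluation _ _ (D.ev_zigzag a) _

lemma coev_ne_zero (a : D.L) : D.coev a ≠ 0 := by
  intro h
  have := D.leftScalar_coev a
  rw [h] at this
  simp only [Limits.zero_comp, leftScalar, MonoidalPreadditive.zero_whiskerRight,
    Limits.comp_zero] at this
  exact smul_ne_zero (D.dim_ne_zero a) (D.id_ne_zero a) this.symm

/-- The composite is a scalar by simplicity, and it fixes the nonzero cup `coev a`. -/
lemma doubleDual_doubleDualInv (a : D.L) : D.doubleDual a ≫ D.doubleDualInv a = 𝟙 _ := by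
  obtain ⟨z, hz⟩ := (D.simple a).exists_smul (D.doubleDual a ≫ D.doubleDualInv a)
  have h : D.coev a ≫ (D.doubleDual a ≫ D.doubleDualInv a) ▷ _ = D.coev a := by
    rw [comp_whiskerRight, reassoc_of% (D.coev_doubleDual a), dag_ev_doubleDualInv]
  rw [hz, MonoidalLinear.smul_whiskerRight, Linear.comp_smul, id_whiskerRight,
    Category.comp_id] at h
  have h2 : (z - 1) • D.coev a = 0 := by rw [sub_smul, h, one_smul, sub_self]
  rw [smul_eq_zero, sub_eq_zero] at h2
  rw [hz, h2.resolve_right (D.coev_ne_zero a), one_smul]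

lemma ev_ne_zero (a : D.L) : D.ev a ≠ 0 := by
  intro h
  have h2 := D.coev_zigzag a
  rw [h] at h2
  refine D.id_ne_zero a ?_
  have := congrArg (fun t => (λ_ _).inv ≫ t ≫ (ρ_ _).hom) h2
  simpa using this.symm

lemma _root_.PartialTrace.rightScalar_eq_leftScalar {X Y : C} (h : 𝟙 (X ⊗ Y) ≠ 0)
    {θ : 𝟙_ C ⟶ 𝟙_ C} {z z' : ℂ} (hX : rightScalar θ X = z • 𝟙 _)
    (hY : leftScalar θ Y = z' • 𝟙 _) : z = z' := by
  have h1 := rightScalar_whiskerRight θ X Y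
  rw [hX, hY, MonoidalLinear.smul_whiskerRight, MonoidalLinear.whiskerLeft_smul, id_whiskerRight,
    whiskerLeft_id] at h1
  have h2 : (z - z') • 𝟙 (X ⊗ Y) = 0 := by rw [sub_smul, h1, sub_self]
  rw [smul_eq_zero, sub_eq_zero] at h2
  exact h2.resolve_right h

/-- A priori the comparison is an isometry up to a number `z > 0`. It transports the cup of `a` to
the dagger of the cap of `ā`, so the normalization of loops gives `d_ā = z d_a`; its inverse gives
`d_a = z d_ā`. Hence `z² = 1`, and `z = 1` by positivity. -/
theorem doubleDual_isometry (a : D.L) : D.doubleDual a ≫ dag (D.doubleDual a) = 𝟙 _ := by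
  set φ := D.doubleDual a
  set χ := D.doubleDualInv a
  have hφχ : φ ≫ χ = 𝟙 _ := D.doubleDual_doubleDualInv a
  have hφ : φ ≠ 0 := by
    intro h
    rw [h, Limits.zero_comp] at hφχ
    exact D.id_ne_zero a hφχ.symm
  obtain ⟨z, hz0, hz⟩ := (D.simple a).exists_pos hφ
  have hz' : dag φ ≫ φ = (z : ℂ) • 𝟙 _ := by
    obtain ⟨w, hw⟩ := (D.simple (D.bar (D.bar a))).exists_smul (dag φ ≫ φ)
    have h1 : ((z : ℂ) - w) • φ = 0 := by
      have : (φ ≫ dag φ) ≫ φ = φ ≫ dag φ ≫ φ := Category.assoc _ _ _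
      rw [hz, hw, Linear.smul_comp, Linear.comp_smul, Category.id_comp, Category.comp_id] at this
      rw [sub_smul, this, sub_self]
    rw [smul_eq_zero, sub_eq_zero] at h1
    rw [hw, h1.resolve_right hφ]
  have hχ : (z : ℂ) • (dag χ ≫ χ) = 𝟙 _ := by
    have h1 : dag χ ≫ dag φ = 𝟙 _ := by rw [← dag_comp, hφχ, dag_id]
    calc _ = dag χ ≫ (dag φ ≫ φ) ≫ χ := by
          rw [hz', Linear.smul_comp, Linear.comp_smul, Category.id_comp]
      _ = 𝟙 _ := by rw [Category.assoc, hφχ, Category.comp_id, h1]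
  have hid : 𝟙 (D.obj (D.bar a) ⊗ D.obj a) ≠ 0 := fun h => D.ev_ne_zero a <| by
    rw [← Category.id_comp (D.ev a), h, Limits.zero_comp]
  have hid' : 𝟙 (D.obj a ⊗ D.obj (D.bar a)) ≠ 0 := fun h => D.coev_ne_zero a <| by
    rw [← Category.comp_id (D.coev a), h, Limits.comp_zero]
  -- The loop of the cap of `ā` is `z` times that of the cup of `a`. It lies in the region between
  -- `ā` and `a`, so its action to the right of `ā` can be compared with its action to the left of
  -- `a`.
  have h1 : (D.dim (D.bar a) : ℂ) = z * D.dim a := by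
    have e1 : dag (D.ev (D.bar a)) ≫ D.ev (D.bar a) =
        (z : ℂ) • (D.coev a ≫ dag (D.coev a)) := by
      have e2 : D.ev (D.bar a) = dag φ ▷ _ ≫ dag (D.coev a) := by
        have := congrArg dag (D.coev_doubleDual a)
        rw [dag_dag, dag_comp, dag_whiskerRight] at this
        exact this.symm
      rw [← D.coev_doubleDual a, e2, Category.assoc, ← comp_whiskerRight_assoc, hz]
      rw [MonoidalLinear.smul_whiskerRight, Linear.smul_comp, Linear.comp_smul, id_whiskerRight,
        Category.id_comp]
    have e3 := D.rightScalar_ev (D.bar a)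
    have e4 : leftScalar ((z : ℂ) • (D.coev a ≫ dag (D.coev a))) (D.obj a) =
        ((z : ℂ) * D.dim a) • 𝟙 _ := by
      rw [leftScalar_smul, D.leftScalar_coev, smul_smul]
    rw [e1] at e3
    exact rightScalar_eq_leftScalar hid e3 e4
  have h2 : (D.dim a : ℂ) = z * D.dim (D.bar a) := by
    have e1 : dag (D.ev a) ≫ D.ev a =
        (z : ℂ) • (D.coev (D.bar a) ≫ dag (D.coev (D.bar a))) := by
      have e2 : D.coev (D.bar a) = dag (D.ev a) ≫ _ ◁ dag χ := by
        have := congrArg dag (D.doubleDualInv_ev a)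
        rw [dag_dag, dag_comp, dag_whiskerLeft] at this
        exact this.symm
      rw [← D.doubleDualInv_ev a, e2, Category.assoc, ← whiskerLeft_comp_assoc,
        ← Linear.comp_smul, ← Linear.smul_comp, ← MonoidalLinear.whiskerLeft_smul, hχ,
        whiskerLeft_id, Category.id_comp]
    have e3 := D.rightScalar_ev a
    have e4 : leftScalar ((z : ℂ) • (D.coev (D.bar a) ≫ dag (D.coev (D.bar a))))
        (D.obj (D.bar a)) = ((z : ℂ) * D.dim (D.bar a)) • 𝟙 _ := by
      rw [leftScalar_smul, D.leftScalar_coev, smul_smul]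
    rw [e1] at e3
    exact rightScalar_eq_leftScalar hid' e3 e4
  have h3 : z = 1 := by
    have h4 : D.dim (D.bar a) = z * D.dim a := by exact_mod_cast h1
    have h5 : D.dim a = z * D.dim (D.bar a) := by exact_mod_cast h2
    have := D.dim_pos a
    have h6 : (z * z - 1) * D.dim a = 0 := by linear_combination -z * h4 - h5
    have h7 : z * z - 1 = 0 := (mul_eq_zero.1 h6).resolve_right this.ne'
    nlinarith
  rw [hz, h3, Complex.ofReal_one, one_smul]

/-- An isometry between simple objects is unitary, so its one-sided inverse is its dagger. -/
lemma doubleDualInv_eq (a : D.L) : D.doubleDualInv a = dag (D.doubleDual a) := by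
  have h : D.doubleDual a ≠ 0 := by
    intro h
    have := D.doubleDual_doubleDualInv a
    rw [h, Limits.zero_comp] at this
    exact D.id_ne_zero a this.symm
  have h1 : D.bar (D.bar a) = a := by
    by_contra hne
    exact h (D.hom_eq_zero (Ne.symm hne) _)
  obtain ⟨w, hw⟩ := (D.simple (D.bar (D.bar a))).exists_smul
    (dag (D.doubleDual a) ≫ D.doubleDual a)
  have h2 : dag (D.doubleDual a) ≫ D.doubleDual a = 𝟙 _ := by
    have h3 : (1 - w) • D.doubleDual a = 0 := by
      have : (D.doubleDual a ≫ dag (D.doubleDual a)) ≫ D.doubleDual a =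
        D.doubleDual a ≫ dag (D.doubleDual a) ≫ D.doubleDual a := Category.assoc _ _ _
      rw [doubleDual_isometry, hw, Linear.comp_smul, Category.id_comp, Category.comp_id] at this
      rw [sub_smul, one_smul, ← this, sub_self]
    rw [smul_eq_zero, sub_eq_zero] at h3
    rw [hw, ← h3.resolve_right h, one_smul]
  calc D.doubleDualInv a = (dag (D.doubleDual a) ≫ D.doubleDual a) ≫ D.doubleDualInv a := by
        rw [h2, Category.id_comp]
    _ = _ := by rw [Category.assoc, doubleDual_doubleDualInv, Category.comp_id]

/-- Straightening leaves `doubleDual a` on the left by construction. On the right the cups have the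
opposite orientation and leave the dagger of `doubleDualInv b`, which agrees with `doubleDual b` by
unitarity. -/
lemma bendDown_bar_bendUp (a b : D.L) {X Z : C} (v : Z ⟶ (D.obj a ⊗ X) ⊗ D.obj b) :
    D.bendDown (D.bar a) (D.bar b) (D.bendUp a b v) =
      v ≫ triMap (D.doubleDual a) (𝟙 _) (D.doubleDual b) := by
  have h1 : D.doubleDual b = (ρ_ _).inv ≫ _ ◁ D.coev (D.bar b) ≫ (α_ _ _ _).inv ≫
      dag (D.coev b) ▷ _ ≫ (λ_ _).hom := by
    have := congrArg dag (D.doubleDualInv_eq b)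
    rw [dag_dag] at this
    rw [← this, doubleDualInv]
    simp only [dag_comp, dag_whiskerLeft, dag_whiskerRight, dag_associator, dag_rightUnitor,
      dag_leftUnitor_inv, dag_dag, Category.assoc]
  have h2 := triCup_triMap_triCap_eq (dag (D.ev (D.bar a))) (D.coev (D.bar b)) (D.ev a)
    (dag (D.coev b)) X
  have h3 : triMap (𝟙 (D.obj (D.bar (D.bar a)))) (D.bendUp a b v) (𝟙 (D.obj (D.bar (D.bar b)))) =
      triMap (𝟙 _) (triMap (𝟙 _) v (𝟙 _)) (𝟙 _) ≫ triMap (𝟙 _) (D.outerCap a b X) (𝟙 _) := by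
    simp [bendUp]
  rw [bendDown, h3, ← reassoc_of% (triCup_naturality (dag (D.ev (D.bar a))) (D.coev (D.bar b)) v),
    h2, ← h1]
  rfl

lemma bendUp_bar_bendDown (a b : D.L) {X Z : C} (w : (D.obj a ⊗ X) ⊗ D.obj b ⟶ Z) :
    D.bendUp (D.bar a) (D.bar b) (D.bendDown a b w) =
      triMap (dag (D.doubleDual a)) (𝟙 _) (dag (D.doubleDual b)) ≫ w := by
  apply dag_injective
  rw [dag_bendUp, dag_bendDown, bendDown_bar_bendUp, dag_comp, dag_triMap, dag_dag, dag_dag,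
    dag_id]

end StringData

namespace StringData

open DaggerCategory UnitaryMultifusionCategory TwoSided PartialTrace
open scoped TensorProduct

variable {C : Type u} [Category.{v} C] [Preadditive C] [Linear ℂ C] [MonoidalCategory C]
  [MonoidalPreadditive C] [MonoidalLinear ℂ C] [RigidCategory C] [DaggerCategory C]
  [UnitaryMultifusionCategory C] (D : StringData C)

/-! #### The conjugation and the star -/

/-- Taking daggers of both halves of a diagram, with the walls exchanged. -/
noncomputable def conj : D.Tube →ₛₗ[starRingEnd ℂ] D.Tube :=
  ∑ l : TubeLabel D.L, ((LinearMap.single ℂ D.Sector ⟨l.a, l.b, l.h, l.f, l.e, l.c⟩).comp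
    (TensorProduct.comm ℂ _ _).toLinearMap |>.comp
      (TensorProduct.map (dagₛₗ _ _) (dagₛₗ _ _))).comp
        (LinearMap.proj l : D.Tube →ₗ[ℂ] D.Sector l)

lemma conj_gdiag_obj (a b c e f h : D.L) (v : D.Bot a b c e) (w : D.Top a b f h) :
    D.conj (D.gdiag (D.obj a) (D.obj b) c e f h v w) =
      D.gdiag (D.obj a) (D.obj b) h f e c (dag w) (dag v) := by
  rw [gdiag_obj, gdiag_obj, conj, LinearMap.sum_apply,
    Finset.sum_eq_single (⟨a, b, c, e, f, h⟩ : TubeLabel D.L)]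
  · simp only [LinearMap.comp_apply, LinearMap.proj_apply, diagₗ_apply, diag, Pi.single_eq_same,
      LinearEquiv.coe_coe, TensorProduct.comm_tmul,
      TensorProduct.map_tmul, LinearMap.single_apply]
    rfl
  · intro l _ hl
    simp only [LinearMap.comp_apply, LinearMap.proj_apply, diagₗ_apply, diag]
    rw [Pi.single_eq_of_ne hl, map_zero, map_zero, map_zero]
  · simp

lemma star_gdiag_obj (a b c e f h : D.L) (v : D.Bot a b c e) (w : D.Top a b f h) :
    D.star (D.gdiag (D.obj a) (D.obj b) c e f h v w) =
      ((D.dim e : ℂ) / D.dim c) • D.gdiag (D.obj (D.bar a)) (D.obj (D.bar b)) e c h f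
        (D.bendDown a b (dag v)) (D.bendUp a b (dag w)) := by
  rw [gdiag_obj, gdiag_obj, star, LinearMap.sum_apply,
    Finset.sum_eq_single (⟨a, b, c, e, f, h⟩ : TubeLabel D.L)]
  · simp only [LinearMap.comp_apply, LinearMap.proj_apply, diagₗ_apply, diag, Pi.single_eq_same,
      starSector, LinearMap.smul_apply, 
      TensorProduct.map_tmul, LinearMap.single_apply, bendTop_eq, bendBot_eq]
    push_cast
    rfl
  · intro l _ hl
    simp only [LinearMap.comp_apply, LinearMap.proj_apply, diagₗ_apply, diag]
    rw [Pi.single_eq_of_ne hl, map_zero]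
  · simp

/-- This splits the star into a linear part carrying the bending and the dimensions, and an
antilinear involution without either. -/
lemma star_eq (x : D.Tube) : D.star x = D.antipode (D.conj x) := by
  induction x using D.tube_induction with
  | zero => simp
  | add x x' hx hx' => simp only [map_add, hx, hx']
  | diag a b c e f h v w => rw [conj_gdiag_obj, antipode_gdiag_obj, star_gdiag_obj]

lemma conj_conj (x : D.Tube) : D.conj (D.conj x) = x := by
  induction x using D.tube_induction with
  | zero => simp
  | add x x' hx hx' => simp only [map_add, hx, hx']
  | diag a b c e f h v w => rw [conj_gdiag_obj, conj_gdiag_obj, dag_dag, dag_dag]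

/-- The dagger of a resolution. -/
def Resolution.dagger {D : StringData C} {Z : C} (R : D.Resolution Z) : D.Resolution Z where
  ι := R.ι
  lab := R.lab
  inc m := dag (R.prj m)
  prj m := dag (R.inc m)
  complete := by
    have := congrArg dag R.complete
    simpa only [dag_sum, dag_comp, dag_id] using this

lemma conj_gdiag (A B : C) (c e f h : D.L) (v : D.obj c ⟶ (A ⊗ D.obj e) ⊗ B)
    (w : (A ⊗ D.obj f) ⊗ B ⟶ D.obj h) :
    D.conj (D.gdiag A B c e f h v w) = D.gdiag A B h f e c (dag w) (dag v) := by
  rw [D.gdiag_eq_sum (D.resolution A) (D.resolution B),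
    D.gdiag_eq_sum (D.resolution A).dagger (D.resolution B).dagger]
  simp only [map_sum]
  refine Finset.sum_congr rfl fun m _ => Finset.sum_congr rfl fun n _ => ?_
  rw [← gdiag_obj, conj_gdiag_obj, ← gdiag_obj]
  simp only [dag_comp, dag_triMap, dag_id]
  rfl

lemma dag_delta (x y : D.L) : dag (D.delta x y) = D.delta y x := by
  by_cases h : x = y
  · subst h
    rw [delta_self, dag_id]
  · rw [D.delta_of_ne h, D.delta_of_ne (Ne.symm h), dag_zero]

/-- Daggers exchange the lower and upper halves but keep the nesting of the arcs, so the order of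
the factors is preserved; the reversal in the star comes from the antipode. -/
lemma conj_mul (x y : D.Tube) : D.conj (D.mul x y) = D.mul (D.conj x) (D.conj y) := by
  induction x using D.tube_induction with
  | zero => simp
  | add x x' hx hx' => simp only [map_add, LinearMap.add_apply, hx, hx']
  | diag a b c e f h v w =>
  induction y using D.tube_induction with
  | zero => simp
  | add y y' hy hy' => simp only [map_add, hy, hy']
  | diag a' b' c' e' f' h' v' w' =>
  rw [mul_gdiag, conj_gdiag, conj_gdiag, conj_gdiag, mul_gdiag]
  simp only [dag_comp, dag_triMap, dag_id, dag_triAssoc_hom, dag_triAssoc_inv, dag_delta,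
    Category.assoc]

lemma _root_.TwoSided.triCup_slide {A₁ A₂ A₁' A₂' B₁ B₂ B₁' B₂' : C} {η₁ : 𝟙_ C ⟶ A₁' ⊗ A₁}
    {ζ₁ : 𝟙_ C ⟶ B₁ ⊗ B₁'} {η₂ : 𝟙_ C ⟶ A₂' ⊗ A₂} {ζ₂ : 𝟙_ C ⟶ B₂ ⊗ B₂'} {f : A₁ ⟶ A₂}
    {g : B₁ ⟶ B₂} {φ : A₂' ⟶ A₁'} {ψ : B₂' ⟶ B₁'} (hA : η₁ ≫ _ ◁ f = η₂ ≫ φ ▷ _)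
    (hB : ζ₁ ≫ g ▷ _ = ζ₂ ≫ _ ◁ ψ) (X : C) :
    triCup η₁ ζ₁ X ≫ triMap (𝟙 _) (triMap f (𝟙 X) g) (𝟙 _) =
      triCup η₂ ζ₂ X ≫ triMap φ (𝟙 _) ψ := by
  have h : (triAssoc A₂' A₂ X B₂ B₂').inv ≫ triMap φ (𝟙 _) ψ =
      triMap (φ ▷ A₂) (𝟙 X) (B₂ ◁ ψ) ≫ (triAssoc A₁' A₂ X B₂ B₁').inv := by
    rw [← triMap_id, triMap_triMap_inv, tensorHom_id, id_tensorHom]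
  simp only [triCup, Category.assoc]
  rw [triMap_triMap_inv, h, triMap_comp_assoc, triMap_comp_assoc, id_tensorHom, tensorHom_id, hA,
    hB]

/-- The left arcs are bent with daggers of caps, for which sliding a vertex is not the defining
property of its mate. It holds because duality commutes with the dagger. -/
lemma dag_ev_comp_mateIn {a b k : D.L} (f : D.obj k ⟶ D.obj a ⊗ D.obj b) :
    dag (D.ev k) ≫ _ ◁ f = nestedCup (dag (D.ev a)) (dag (D.ev b)) ≫ D.mateIn f ▷ _ := by
  have := congrArg dag (mateOut_ev (D := D) (dag f))
  rw [dag_comp, dag_comp, dag_whiskerLeft, dag_whiskerRight, dag_nestedCap, dag_mateOut,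
    dag_dag] at this
  exact this.symm

lemma bendDown_tensor {a a' b b' k s : D.L} (f : D.obj k ⟶ D.obj a ⊗ D.obj a')
    (g : D.obj s ⟶ D.obj b' ⊗ D.obj b) {X Z : C}
    (W : ((D.obj a ⊗ D.obj a') ⊗ X) ⊗ (D.obj b' ⊗ D.obj b) ⟶ Z) :
    D.bendDown k s (triMap f (𝟙 _) g ≫ W) =
      (D.bendDown a' b' (D.bendDown a b ((triAssoc _ _ _ _ _).hom ≫ W)) ≫
        (triAssoc _ _ _ _ _).hom) ≫ triMap (D.mateIn f) (𝟙 _) (D.mateIn g) := by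
  have h1 := triCup_slide (D.dag_ev_comp_mateIn f) (coev_mateIn g).symm X
  have h2 := triCup_nestedCup (dag (D.ev a)) (dag (D.ev a')) (D.coev b) (D.coev b') X
  have h3 : D.bendDown a' b' (D.bendDown a b ((triAssoc _ _ _ _ _).hom ≫ W)) ≫
      (triAssoc _ _ _ _ _).hom = triCup (nestedCup (dag (D.ev a)) (dag (D.ev a')))
        (nestedCup (D.coev b) (D.coev b')) X ≫ triMap (𝟙 _) W (𝟙 _) := by
    have h4 : triMap (𝟙 (D.obj (D.bar a') ⊗ D.obj (D.bar a))) W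
        (𝟙 (D.obj (D.bar b) ⊗ D.obj (D.bar b'))) =
        triMap (𝟙 _) (triAssoc _ _ _ _ _).inv (𝟙 _) ≫
          triMap (𝟙 _) ((triAssoc _ _ _ _ _).hom ≫ W) (𝟙 _) := by
      simp
    rw [h4, reassoc_of% h2, triAssoc_hom_triMap_mid]
    simp [bendDown]
  rw [h3]
  have h5 : triMap (𝟙 (D.obj (D.bar k))) (triMap f (𝟙 X) g ≫ W) (𝟙 (D.obj (D.bar s))) =
      triMap (𝟙 _) (triMap f (𝟙 X) g) (𝟙 _) ≫ triMap (𝟙 _) W (𝟙 _) := by simp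
  rw [bendDown, h5, reassoc_of% h1]
  simp

lemma bendUp_tensor {a a' b b' k s : D.L} (p : D.obj a ⊗ D.obj a' ⟶ D.obj k)
    (q : D.obj b' ⊗ D.obj b ⟶ D.obj s) {X Z : C}
    (V : Z ⟶ ((D.obj a ⊗ D.obj a') ⊗ X) ⊗ (D.obj b' ⊗ D.obj b)) :
    D.bendUp k s (V ≫ triMap p (𝟙 _) q) = triMap (D.mateOut p) (𝟙 _) (D.mateOut q) ≫
      (triAssoc _ _ _ _ _).inv ≫
        D.bendUp a' b' (D.bendUp a b (V ≫ (triAssoc _ _ _ _ _).inv)) := by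
  apply dag_injective
  simp only [dag_bendUp, dag_comp, dag_triMap, dag_id, dag_triAssoc_inv, dag_mateOut]
  exact D.bendDown_tensor (dag p) (dag q) (dag V)

/-- Resolving the fused arcs and bending turns the resolutions into their mates. These again resolve
the identity, so the antipode can be computed by bending the constituent arcs one after the other.
-/
lemma antipode_gdiag_tensor (a a' b b' c e f h : D.L)
    (V : D.obj c ⟶ ((D.obj a ⊗ D.obj a') ⊗ D.obj e) ⊗ (D.obj b' ⊗ D.obj b))
    (W : ((D.obj a ⊗ D.obj a') ⊗ D.obj f) ⊗ (D.obj b' ⊗ D.obj b) ⟶ D.obj h) :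
    D.antipode (D.gdiag _ _ c e f h V W) = ((D.dim f : ℂ) / D.dim h) • D.gdiag _ _ f h c e
      (D.bendDown a' b' (D.bendDown a b ((triAssoc _ _ _ _ _).hom ≫ W)) ≫
        (triAssoc _ _ _ _ _).hom)
      ((triAssoc _ _ _ _ _).inv ≫
        D.bendUp a' b' (D.bendUp a b (V ≫ (triAssoc _ _ _ _ _).inv))) := by
  set R := D.resolution (D.obj a ⊗ D.obj a')
  set S := D.resolution (D.obj b' ⊗ D.obj b)
  rw [D.gdiag_eq_sum R S]
  simp only [map_sum, ← gdiag_obj, antipode_gdiag_obj, bendDown_tensor, bendUp_tensor]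
  simp only [gdiag_dinatural, triMap_comp_assoc, Category.comp_id, ← Finset.smul_sum]
  simp only [← map_sum, ← Preadditive.sum_comp, ← triMap_sum_right, ← triMap_sum_left,
    sum_mateIn_mateOut, triMap_id, Category.id_comp]

lemma bendDown_comp (a b : D.L) {X X' Z Z' : C} (f : X ⟶ X') (w : (D.obj a ⊗ X') ⊗ D.obj b ⟶ Z)
    (g : Z ⟶ Z') : D.bendDown a b (triMap (𝟙 _) f (𝟙 _) ≫ w ≫ g) =
      f ≫ D.bendDown a b w ≫ triMap (𝟙 _) g (𝟙 _) := by
  have := triCup_naturality (dag (D.ev a)) (D.coev b) f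
  rw [bendDown, bendDown, Category.assoc, reassoc_of% this]
  simp

lemma bendUp_comp (a b : D.L) {X X' Z Z' : C} (g : Z' ⟶ Z) (v : Z ⟶ (D.obj a ⊗ X) ⊗ D.obj b)
    (f : X ⟶ X') : D.bendUp a b (g ≫ v ≫ triMap (𝟙 _) f (𝟙 _)) =
      triMap (𝟙 _) g (𝟙 _) ≫ D.bendUp a b v ≫ f := by
  have := triCap_naturality (D.ev a) (dag (D.coev b)) f
  rw [bendUp, bendUp, Category.assoc, this]
  simp

/-- Bending exchanges inside and outside, which reverses the nesting; the half-diagrams match by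
naturality of cups and caps. At the common wall `f = h'` the ratios of dimensions telescope. -/
lemma antipode_mul (x y : D.Tube) :
    D.antipode (D.mul x y) = D.mul (D.antipode y) (D.antipode x) := by
  induction x using D.tube_induction with
  | zero => simp
  | add x x' hx hx' => simp only [map_add, LinearMap.add_apply, hx, hx']
  | diag a b c e f h v w =>
  induction y using D.tube_induction with
  | zero => simp
  | add y y' hy hy' => simp only [map_add, LinearMap.add_apply, hy, hy']
  | diag a' b' c' e' f' h' v' w' =>
  by_cases hf : h' = f
  · subst hf
    rw [mul_gdiag, antipode_gdiag_tensor, antipode_gdiag_obj, antipode_gdiag_obj, map_smul,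
      map_smul, LinearMap.smul_apply, smul_smul, mul_gdiag]
    have hb := D.bendDown_comp a b w' w (𝟙 _)
    have hb' := D.bendDown_comp a' b' (𝟙 _) w' (D.bendDown a b w)
    have hu := D.bendUp_comp a b (𝟙 _) v (D.delta e c' ≫ v')
    have hu' := D.bendUp_comp a' b' (D.bendUp a b v ≫ D.delta e c') v' (𝟙 _)
    simp only [Category.comp_id, Category.id_comp, triMap_id] at hb hb' hu hu'
    simp only [delta_self, Category.comp_id, Category.id_comp, Category.assoc,
      Iso.hom_inv_id_assoc, Iso.hom_inv_id]
    rw [hb, hb', hu, ← Category.assoc, hu', Category.assoc]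
    congr 1
    have := D.dim_ne_zero h'
    field_simp
  · rw [D.mul_gdiag_top _ _ _ _ _ _ _ _ _ _ _ _ hf, map_zero, antipode_gdiag_obj,
      antipode_gdiag_obj, map_smul, map_smul, LinearMap.smul_apply,
      D.mul_gdiag_bot _ _ _ _ _ _ _ _ _ _ _ _ (Ne.symm hf), smul_zero, smul_zero]

lemma star_mul_tube (x y : D.Tube) : D.star (D.mul x y) = D.mul (D.star y) (D.star x) := by
  rw [star_eq, conj_mul, antipode_mul, star_eq, star_eq]

/-- Bending twice puts the double dual comparison on the arcs of the lower half and its dagger on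
the upper half. Sliding brings them together, where they cancel; the two ratios of dimensions are
inverse to each other. -/
lemma star_star_tube (x : D.Tube) : D.star (D.star x) = x := by
  induction x using D.tube_induction with
  | zero => simp
  | add x x' hx hx' => simp only [map_add, hx, hx']
  | diag a b c e f h v w =>
  rw [star_gdiag_obj, map_smulₛₗ, star_gdiag_obj, smul_smul, dag_bendDown, dag_bendUp, dag_dag,
    dag_dag, bendDown_bar_bendUp, bendUp_bar_bendDown, gdiag_dinatural, triMap_comp_assoc,
    doubleDual_isometry, doubleDual_isometry, Category.comp_id, triMap_id, Category.id_comp]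
  have h1 : (starRingEnd ℂ) ((D.dim e : ℂ) / D.dim c) * ((D.dim c : ℂ) / D.dim e) = 1 := by
    have := D.dim_ne_zero e
    have := D.dim_ne_zero c
    rw [map_div₀, Complex.conj_ofReal, Complex.conj_ofReal]
    field_simp
  rw [h1, one_smul]

/-- The resolution of `(ā ⊗ k) ⊗ b̄` obtained by bending. -/
noncomputable def bentResolution (a b k : D.L) :
    D.Resolution ((D.obj (D.bar a) ⊗ D.obj k) ⊗ D.obj (D.bar b)) where
  ι := Σ i, D.VtxPair a b i k
  lab n := n.1
  inc n := ((D.dim n.1 : ℂ) / D.dim k) • D.bendDown a b (dag (D.pairInc a b n.1 k n.2))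
  prj n := D.bendUp a b (dag (D.pairPrj a b n.1 k n.2))
  complete := by
    rw [Fintype.sum_sigma]
    have := congrArg dag (D.sum_bend a b k)
    simp only [dag_sum, dag_comp, dag_smul, dag_bendDown, dag_bendUp, dag_id, map_div₀,
      Complex.conj_ofReal, Linear.comp_smul] at this ⊢
    exact this

/-- The starred diagram is cut along the bent resolution of the one used for `x`. The weight `d_i /
d_k` in its inclusions is the factor in the star of the first piece, and `d_e / d_c` belongs to the
second. -/
lemma comul_star_tube (x : D.Tube) :
    D.comul (D.star x) = TensorProduct.map D.star D.star (D.comul x) := by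
  induction x using D.tube_induction with
  | zero => simp
  | add x x' hx hx' => simp only [map_add, hx, hx']
  | diag a b c e f h v w =>
  rw [star_gdiag_obj, map_smul, D.comul_gdiag _ _ (D.bentResolution a b), comul_gdiag_obj]
  simp only [map_sum, TensorProduct.map_tmul, star_gdiag_obj]
  rw [Finset.sum_comm, Finset.smul_sum]
  refine Finset.sum_congr rfl fun k _ => ?_
  rw [Finset.smul_sum]
  refine (Fintype.sum_sigma _).trans (Finset.sum_congr rfl fun i _ =>
    Finset.sum_congr rfl fun y _ => ?_)
  have hg := LinearMap.map_smul₂ (D.gdiag (D.obj (D.bar a)) (D.obj (D.bar b)) i k h f)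
    ((D.dim i : ℂ) / D.dim k) (D.bendDown a b (dag (D.pairInc a b i k y))) (D.bendUp a b (dag w))
  simp only [bentResolution, TensorProduct.tmul_smul]
  exact congrArg (fun t => ((D.dim e : ℂ) / D.dim c) • (t ⊗ₜ[ℂ] _)) hg

theorem isStarWeakHopfAlgebra :
    WeakHopf.IsStarWeakHopfAlgebra D.mul D.one D.comul D.counit D.antipode D.star where
  toIsWeakHopfAlgebra := D.isWeakHopfAlgebra
  star_star := D.star_star_tube
  star_mul := D.star_mul_tube
  comul_star := D.comul_star_tube

lemma antipode_conj_antipode (x : D.Tube) :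
    D.antipode (D.conj (D.antipode (D.conj x))) = x := by
  rw [← star_eq, ← star_eq, star_star_tube]

lemma conj_antipode_conj_antipode (x : D.Tube) :
    D.conj (D.antipode (D.conj (D.antipode x))) = x := by
  conv_lhs => rw [← D.conj_conj x, antipode_conj_antipode]
  exact D.conj_conj x

/-- The antipode is invertible, with inverse its conjugate. -/
theorem exists_antipode_equiv : ∃ T : D.Tube ≃ₗ[ℂ] D.Tube, T.toLinearMap = D.antipode ∧
    ∀ x : D.Tube, D.antipode (D.star x) = D.star (T.symm x) := by
  let T : D.Tube ≃ₗ[ℂ] D.Tube :=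
    { D.antipode with
      invFun := fun x => D.conj (D.antipode (D.conj x))
      left_inv := D.conj_antipode_conj_antipode
      right_inv := D.antipode_conj_antipode }
  refine ⟨T, rfl, fun x => ?_⟩
  change _ = D.star (D.conj (D.antipode (D.conj x)))
  rw [star_eq, star_eq, conj_conj]

end StringData

/-! ### A faithful `*`-representation from an orthonormal basis -/

namespace WeakHopf

/-- The left regular representation with respect to a basis which is orthonormal for the form
`φ (x* y)`. -/
theorem exists_faithful_rep_of_orthonormal {W : Type*} [AddCommGroup W] [Module ℂ W] {ι : Type}
    [Fintype ι] [DecidableEq ι] (mul : W →ₗ[ℂ] W →ₗ[ℂ] W) (one : W)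
    (star : W →ₛₗ[starRingEnd ℂ] W) (mul_assoc : ∀ x y z, mul (mul x y) z = mul x (mul y z))
    (one_mul : ∀ x, mul one x = x) (mul_one : ∀ x, mul x one = x)
    (star_mul : ∀ x y, star (mul x y) = mul (star y) (star x)) (φ : W →ₗ[ℂ] ℂ) (b : ι → W)
    (orthonormal : ∀ i j, φ (mul (star (b i)) (b j)) = if i = j then 1 else 0)
    (expand : ∀ x, ∑ i, φ (mul (star (b i)) x) • b i = x) :
    ∃ (H : Type) (_ : NormedAddCommGroup H) (_ : InnerProductSpace ℂ H)
    (_ : CompleteSpace H) (π : W →ₗ[ℂ] (H →L[ℂ] H)),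
    Function.Injective π ∧ π one = 1 ∧ (∀ x y, π (mul x y) = π x * π y) ∧
      ∀ x, π (star x) = ContinuousLinearMap.adjoint (π x) := by
  have hform : ∀ x y, φ (mul (star x) y) =
      ∑ i, (starRingEnd ℂ) (φ (mul (star (b i)) x)) * φ (mul (star (b i)) y) := by
    intro x y
    conv_lhs => rw [← expand x]
    simp only [map_sum, map_smulₛₗ, LinearMap.sum_apply, LinearMap.smul_apply, smul_eq_mul,
      RingHom.id_apply]
  have hherm : ∀ x y, φ (mul (star y) x) = (starRingEnd ℂ) (φ (mul (star x) y)) := by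
    intro x y
    rw [hform y x, hform x y, map_sum]
    refine Finset.sum_congr rfl fun i _ => ?_
    rw [map_mul, Complex.conj_conj, mul_comm]
  let M : W →ₗ[ℂ] Matrix ι ι ℂ :=
    { toFun := fun x => Matrix.of fun i j => φ (mul (star (b i)) (mul x (b j)))
      map_add' := fun x y => by ext i j; simp
      map_smul' := fun z x => by ext i j; simp }
  refine ⟨EuclideanSpace ℂ ι, inferInstance, inferInstance, inferInstance,
    (Matrix.toEuclideanCLM (n := ι) (𝕜 := ℂ)).toAlgEquiv.toLinearMap ∘ₗ M, ?_, ?_, ?_, ?_⟩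
  · rw [LinearMap.coe_comp]
    refine (Matrix.toEuclideanCLM (n := ι) (𝕜 := ℂ)).injective.comp ?_
    rw [← LinearMap.ker_eq_bot, LinearMap.ker_eq_bot']
    intro x hx
    -- A zero matrix makes `x` annihilate every basis element, hence the unit, which the basis
    -- spans.
    have h1 : ∀ j, mul x (b j) = 0 := by
      intro j
      rw [← expand (mul x (b j))]
      refine Finset.sum_eq_zero fun i _ => ?_
      have : φ (mul (star (b i)) (mul x (b j))) = 0 := congrFun (congrFun hx i) j
      rw [this, zero_smul]
    rw [← mul_one x, ← expand one]
    simp [h1]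
  · have : M one = 1 := by
      ext i j
      change φ (mul (star (b i)) (mul one (b j))) = _
      rw [one_mul, orthonormal, Matrix.one_apply]
    simp [this]
  · intro x y
    have : M (mul x y) = M x * M y := by
      ext i k
      rw [Matrix.mul_apply]
      change φ (mul (star (b i)) (mul (mul x y) (b k))) = ∑ j, φ (mul (star (b i)) (mul x (b j))) *
        φ (mul (star (b j)) (mul y (b k)))
      rw [mul_assoc x y]
      conv_lhs => rw [← expand (mul y (b k))]
      simp [mul_comm]
    simp [this]
  · intro x
    have : M (star x) = Star.star (M x) := by
      ext i j
      rw [Matrix.star_apply]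
      change φ (mul (star (b i)) (mul (star x) (b j))) =
        (starRingEnd ℂ) (φ (mul (star (b j)) (mul x (b i))))
      rw [← hherm, star_mul, mul_assoc]
    simp [this, map_star, ContinuousLinearMap.star_eq_adjoint]

end WeakHopf

namespace StringData

open DaggerCategory UnitaryMultifusionCategory TwoSided PartialTrace
open scoped TensorProduct

variable {C : Type u} [Category.{v} C] [Preadditive C] [Linear ℂ C] [MonoidalCategory C]
  [MonoidalPreadditive C] [MonoidalLinear ℂ C] [RigidCategory C] [DaggerCategory C]
  [UnitaryMultifusionCategory C] (D : StringData C)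

/-! #### The canonical functional and the regular representation -/

/-- Two isomorphic summands of `𝟙` would give noncommuting matrix units in `End 𝟙`, but
endomorphisms of a tensor unit commute. -/
lemma unit_injective : Function.Injective D.unit := by
  intro i j hij
  by_contra hne
  have hcomm : ∀ θ θ' : 𝟙_ C ⟶ 𝟙_ C, θ ≫ θ' = θ' ≫ θ := by
    have h1 : ∀ θ : 𝟙_ C ⟶ 𝟙_ C, leftScalar θ (𝟙_ C) = θ := by
      intro θ
      rw [leftScalar, unitors_equal, rightUnitor_naturality, unitors_inv_equal,
        Iso.inv_hom_id_assoc]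
    intro θ θ'
    have := leftScalar_naturality θ θ'
    rwa [h1] at this
  have hτ : ∀ {x y : D.L} (h : x = y), D.delta x y ≫ D.delta y x = 𝟙 _ := by
    intro x y h
    subst h
    simp [delta_self]
  have h1 := hcomm (dag (D.unitIncl i) ≫ D.delta _ (D.unit j) ≫ D.unitIncl j)
    (dag (D.unitIncl j) ≫ D.delta _ (D.unit i) ≫ D.unitIncl i)
  have h2 := congrArg (D.unitIncl i ≫ ·) h1
  simp only [Category.assoc] at h2
  rw [reassoc_of% (D.unitIncl_isometry i), reassoc_of% (D.unitIncl_isometry j),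
    reassoc_of% (hτ hij), reassoc_of% (D.unitIncl_orthogonal i j hne), Limits.zero_comp] at h2
  have h3 := D.unitIncl_isometry i
  rw [h2, Limits.zero_comp] at h3
  exact D.id_ne_zero _ h3.symm

/-- The inclusion of `a` into the tensor unit as the summand with index `i`, if there is one. -/
def toUnit (a : D.L) (i : D.I) : D.obj a ⟶ 𝟙_ C := D.delta a (D.unit i) ≫ D.unitIncl i

lemma sum_toUnit (a : D.L) (p : D.obj a ⟶ 𝟙_ C) :
    ∑ i, D.toUnit a i ≫ dag (D.toUnit a i) ≫ p = p := by
  have h0 : ∀ i, D.toUnit a i ≫ dag (D.toUnit a i) =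
      D.delta a (D.unit i) ≫ D.delta (D.unit i) a := by
    intro i
    rw [toUnit, dag_comp, Category.assoc, reassoc_of% (D.unitIncl_isometry i), dag_delta]
  simp only [← Category.assoc, h0]
  by_cases h : ∃ i, D.unit i = a
  · obtain ⟨i, rfl⟩ := h
    rw [Finset.sum_eq_single i]
    · simp [delta_self]
    · intro j _ hj
      rw [D.delta_of_ne (fun h => hj (D.unit_injective h).symm)]
      simp
    · simp
  · have hp : p = 0 := by
      rw [← D.unitResolution.sum_comp_right p]
      refine Finset.sum_eq_zero fun i _ => ?_
      have hi : p ≫ D.unitResolution.prj i = 0 :=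
        D.hom_eq_zero (y := D.unit i) (fun h' => h ⟨i, h'.symm⟩) _
      rw [hi, Limits.zero_comp]
    simp [hp]

/-- If the spaces of morphisms between `A` and the tensor unit are one-dimensional, a sum over the
summands of `A` isomorphic to summands of the tensor unit has only one term. -/
lemma sum_toUnit_resolution {A : C} (R : D.Resolution A) (p₀ : A ⟶ 𝟙_ C) (q₀ : 𝟙_ C ⟶ A)
    (hp : ∀ p : A ⟶ 𝟙_ C, ∃ z : ℂ, p = z • p₀) (hq : ∀ q : 𝟙_ C ⟶ A, ∃ z : ℂ, q = z • q₀)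
    (hp₀ : p₀ ≠ 0) {d : ℂ} (hpq : p₀ ≫ q₀ ≫ p₀ = d • p₀)
    (F : (A ⟶ 𝟙_ C) → (𝟙_ C ⟶ A) → ℂ) (hF : ∀ s t p q, F (s • p) (t • q) = s * t * F p q) :
    ∑ m, ∑ i, F (R.prj m ≫ D.toUnit (R.lab m) i) (dag (D.toUnit (R.lab m) i) ≫ R.inc m) =
      d⁻¹ * F p₀ q₀ := by
  choose s hs using fun m i => hp (R.prj m ≫ D.toUnit (R.lab m) i)
  -- In terms of `p₀` and `q₀` every summand is `s * t` times the same value. Composing the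
  -- completeness relation with `p₀` shows that the products `s * t` sum to `d⁻¹`.
  choose t ht using fun m i => hq (dag (D.toUnit (R.lab m) i) ≫ R.inc m)
  have h1 : ∑ m, ∑ i, (R.prj m ≫ D.toUnit (R.lab m) i) ≫
      (dag (D.toUnit (R.lab m) i) ≫ R.inc m) ≫ p₀ = p₀ := by
    conv_rhs => rw [← R.sum_comp_left p₀]
    refine Finset.sum_congr rfl fun m _ => ?_
    conv_rhs => rw [← D.sum_toUnit (R.lab m) (R.inc m ≫ p₀)]
    simp only [Preadditive.comp_sum, Category.assoc]
  simp only [hs, ht, hF, Linear.smul_comp, Linear.comp_smul, hpq, smul_smul] at h1 ⊢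
  simp only [← Finset.sum_smul, ← Finset.sum_mul] at h1 ⊢
  congr 1
  have h2 : ((∑ m, ∑ i, s m i * t m i) * d - 1) • p₀ = 0 := by
    rw [sub_smul, one_smul, Finset.sum_mul]
    simp only [Finset.sum_mul, mul_assoc, mul_left_comm (t _ _)] at h1 ⊢
    rw [h1, sub_self]
  rw [smul_eq_zero, sub_eq_zero] at h2
  exact eq_inv_of_mul_eq_one_left (h2.resolve_right hp₀)

/-- The canonical functional on diagrams with fixed labels: it vanishes unless the arcs are labelled
by summands of the tensor unit. -/
noncomputable def functionalSector (l : TubeLabel D.L) : D.Sector l →ₗ[ℂ] ℂ :=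
  ∑ i, ∑ j, TensorProduct.lift (LinearMap.mk₂ ℂ
    (fun v w => D.coeff l.e (D.delta l.e l.c ≫ v ≫
        triMap (D.toUnit l.a i) (𝟙 _) (D.toUnit l.b j) ≫ (triUnitor _).hom) *
      D.coeff l.h (D.delta l.h l.f ≫ (triUnitor _).inv ≫
        triMap (dag (D.toUnit l.a i)) (𝟙 _) (dag (D.toUnit l.b j)) ≫ w))
    (by intros; simp [add_mul]) (by intros; simp [mul_assoc]) (by intros; simp [mul_add])
    (by intros; simp [mul_left_comm]))

/-- The canonical functional on the tube algebra. -/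
noncomputable def functional : D.Tube →ₗ[ℂ] ℂ := ∑ l, D.functionalSector l ∘ₗ LinearMap.proj l

lemma functional_diagₗ (a b c e f h : D.L) (v : D.Bot a b c e) (w : D.Top a b f h) :
    D.functional (D.diagₗ a b c e f h v w) = ∑ i, ∑ j,
      D.coeff e (D.delta e c ≫ v ≫
        triMap (D.toUnit a i) (𝟙 _) (D.toUnit b j) ≫ (triUnitor _).hom) *
      D.coeff h (D.delta h f ≫ (triUnitor _).inv ≫
        triMap (dag (D.toUnit a i)) (𝟙 _) (dag (D.toUnit b j)) ≫ w) := by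
  rw [functional, LinearMap.sum_apply,
    Finset.sum_eq_single (⟨a, b, c, e, f, h⟩ : TubeLabel D.L)]
  · simp only [LinearMap.comp_apply, LinearMap.proj_apply, diagₗ_apply, diag, Pi.single_eq_same,
      functionalSector, LinearMap.sum_apply, TensorProduct.lift.tmul, LinearMap.mk₂_apply]
  · intro l _ hl
    simp only [LinearMap.comp_apply, LinearMap.proj_apply, diagₗ_apply, diag]
    rw [Pi.single_eq_of_ne hl, map_zero]
  · simp

lemma functional_gdiag {A B : C} (R : D.Resolution A) (S : D.Resolution B) (c e f h : D.L)
    (v : D.obj c ⟶ (A ⊗ D.obj e) ⊗ B) (w : (A ⊗ D.obj f) ⊗ B ⟶ D.obj h) :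
    D.functional (D.gdiag A B c e f h v w) = ∑ m, ∑ i, ∑ n, ∑ j,
      D.coeff e (D.delta e c ≫ v ≫ triMap (R.prj m ≫ D.toUnit (R.lab m) i) (𝟙 _)
        (S.prj n ≫ D.toUnit (S.lab n) j) ≫ (triUnitor _).hom) *
      D.coeff h (D.delta h f ≫ (triUnitor _).inv ≫
        triMap (dag (D.toUnit (R.lab m) i) ≫ R.inc m) (𝟙 _)
          (dag (D.toUnit (S.lab n) j) ≫ S.inc n) ≫ w) := by
  rw [D.gdiag_eq_sum R S]
  simp only [map_sum, functional_diagₗ, Category.assoc, triMap_comp_assoc, Category.comp_id]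
  exact Finset.sum_congr rfl fun m _ => Finset.sum_comm

/-- The functional on a diagram with arcs of the form `ā ⊗ a` and `b ⊗ b̄`. -/
lemma functional_gdiag_eq {A B : C} (p : A ⟶ 𝟙_ C) (q : 𝟙_ C ⟶ A) (p' : B ⟶ 𝟙_ C) (q' : 𝟙_ C ⟶ B)
    (hp : ∀ r : A ⟶ 𝟙_ C, ∃ z : ℂ, r = z • p) (hq : ∀ r : 𝟙_ C ⟶ A, ∃ z : ℂ, r = z • q)
    (hp₀ : p ≠ 0) {d : ℂ} (hpq : p ≫ q ≫ p = d • p)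
    (hp' : ∀ r : B ⟶ 𝟙_ C, ∃ z : ℂ, r = z • p') (hq' : ∀ r : 𝟙_ C ⟶ B, ∃ z : ℂ, r = z • q')
    (hp₀' : p' ≠ 0) {d' : ℂ} (hpq' : p' ≫ q' ≫ p' = d' • p') (c e f h : D.L)
    (v : D.obj c ⟶ (A ⊗ D.obj e) ⊗ B) (w : (A ⊗ D.obj f) ⊗ B ⟶ D.obj h) :
    D.functional (D.gdiag A B c e f h v w) = d⁻¹ * (d'⁻¹ *
      (D.coeff e (D.delta e c ≫ v ≫ triMap p (𝟙 _) p' ≫ (triUnitor _).hom) *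
      D.coeff h (D.delta h f ≫ (triUnitor _).inv ≫ triMap q (𝟙 _) q' ≫ w))) := by
  rw [D.functional_gdiag (D.resolution A) (D.resolution B)]
  have h1 : ∀ (r : A ⟶ 𝟙_ C) (t : 𝟙_ C ⟶ A), _ := fun r t =>
    D.sum_toUnit_resolution (D.resolution B) p' q' hp' hq' hp₀' hpq' (fun r' t' =>
      D.coeff e (D.delta e c ≫ v ≫ triMap r (𝟙 _) r' ≫ (triUnitor _).hom) *
      D.coeff h (D.delta h f ≫ (triUnitor _).inv ≫ triMap t (𝟙 _) t' ≫ w)) (by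
        intro s s' r' t'
        simp only [triMap_smul_right, Linear.smul_comp, Linear.comp_smul, map_smul, smul_eq_mul]
        ring)
  simp only [h1]
  rw [D.sum_toUnit_resolution (D.resolution A) p q hp hq hp₀ hpq (fun r t => d'⁻¹ *
      (D.coeff e (D.delta e c ≫ v ≫ triMap r (𝟙 _) p' ≫ (triUnitor _).hom) *
      D.coeff h (D.delta h f ≫ (triUnitor _).inv ≫ triMap t (𝟙 _) q' ≫ w)))]
  intro s s' r t
  simp only [triMap_smul_left, Linear.smul_comp, Linear.comp_smul, map_smul, smul_eq_mul]
  ring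

lemma functional_gdiag_eq_zero {A B : C} (hp : (∀ r : A ⟶ 𝟙_ C, r = 0) ∨ ∀ r : B ⟶ 𝟙_ C, r = 0)
    (c e f h : D.L) (v : D.obj c ⟶ (A ⊗ D.obj e) ⊗ B) (w : (A ⊗ D.obj f) ⊗ B ⟶ D.obj h) :
    D.functional (D.gdiag A B c e f h v w) = 0 := by
  rw [D.functional_gdiag (D.resolution A) (D.resolution B)]
  refine Finset.sum_eq_zero fun m _ => Finset.sum_eq_zero fun i _ => Finset.sum_eq_zero fun n _ =>
    Finset.sum_eq_zero fun j _ => ?_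
  rcases hp with hp | hp
  · rw [hp ((D.resolution A).prj m ≫ _), triMap_zero_left]
    simp
  · rw [hp ((D.resolution B).prj n ≫ _), triMap_zero_right]
    simp

end StringData

/-! ### Orthonormal bases of morphism spaces -/

namespace IsSimpleObject

open DaggerCategory UnitaryMultifusionCategory

variable {C : Type u} [Category.{v} C] [Preadditive C] [Linear ℂ C] [MonoidalCategory C]
  [MonoidalPreadditive C] [MonoidalLinear ℂ C] [RigidCategory C] [DaggerCategory C]
  [UnitaryMultifusionCategory C] {X : C}

/-- An orthonormal basis of the space of morphisms from a simple object. -/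
lemma exists_orthonormal (hX : IsSimpleObject X) (Z : C) : ∃ (n : ℕ) (u : Fin n → (X ⟶ Z)),
    (∀ i j, u i ≫ dag (u j) = if i = j then 𝟙 X else 0) ∧
      ∀ g : X ⟶ Z, ∑ i, (g ≫ dag (u i)) ≫ u i = g := by
  classical
  obtain ⟨n, S, ι, hS, hiso, horth, hc⟩ := semisimple Z
  -- The simple summands of `Z` receiving a nonzero morphism from `X` are unitarily isomorphic to
  -- `X`, and each contributes one basis vector; the others are orthogonal to all of `X ⟶ Z`.
  let T := {k : Fin n // ∃ f : X ⟶ S k, f ≠ 0}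
  choose g hg hg' using fun k : T => hX.exists_unitary (hS k) k.2.choose_spec
  let e := Fintype.equivFin T
  refine ⟨Fintype.card T, fun i => g (e.symm i) ≫ ι (e.symm i), fun i j => ?_, fun f => ?_⟩
  · split_ifs with h
    · subst h
      rw [dag_comp, Category.assoc, reassoc_of% (hiso (e.symm i)), hg]
    · have : (e.symm i : Fin n) ≠ e.symm j := fun h' => h (e.symm.injective (Subtype.ext h'))
      rw [dag_comp, Category.assoc, reassoc_of% (horth _ _ this)]
      simp
  · have h1 : ∀ k : T, (f ≫ dag (g k ≫ ι k)) ≫ g k ≫ ι k = f ≫ dag (ι k) ≫ ι k := by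
      intro k
      simp only [dag_comp, Category.assoc]
      rw [reassoc_of% (hg' k)]
    rw [e.symm.sum_comp (fun k : T => (f ≫ dag (g k ≫ ι k)) ≫ g k ≫ ι k)]
    simp only [h1]
    have h2 : ∑ k, f ≫ dag (ι k) ≫ ι k = f := by rw [← Preadditive.comp_sum, hc, Category.comp_id]
    conv_rhs => rw [← h2]
    rw [← Fintype.sum_subtype_add_sum_subtype (fun k => ∃ f : X ⟶ S k, f ≠ 0)
      (fun k => f ≫ dag (ι k) ≫ ι k)]
    refine (add_eq_left.2 (Finset.sum_eq_zero fun k _ => ?_)).symm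
    have : f ≫ dag (ι k) = 0 := by
      by_contra h
      exact k.2 ⟨_, h⟩
    rw [← Category.assoc, this, Limits.zero_comp]

end IsSimpleObject

/-! ### Orthogonality and positivity of the canonical form -/

namespace StringData

open DaggerCategory UnitaryMultifusionCategory TwoSided PartialTrace
open scoped TensorProduct

variable {C : Type u} [Category.{v} C] [Preadditive C] [Linear ℂ C] [MonoidalCategory C]
  [MonoidalPreadditive C] [MonoidalLinear ℂ C] [RigidCategory C] [DaggerCategory C]
  [UnitaryMultifusionCategory C] (D : StringData C)

lemma exists_eq_whiskerLeft_ev {a a' : D.L} (p : D.obj (D.bar a) ⊗ D.obj a' ⟶ 𝟙_ C) :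
    ∃ g : D.obj a' ⟶ D.obj a, p = _ ◁ g ≫ D.ev a :=
  ⟨_, (comparison_comp_evaluation _ _ (D.ev_zigzag a) p).symm⟩

lemma exists_eq_coev_whiskerRight {b b' : D.L} (q : 𝟙_ C ⟶ D.obj b' ⊗ D.obj (D.bar b)) :
    ∃ g : D.obj b ⟶ D.obj b', q = D.coev b ≫ g ▷ _ :=
  ⟨_, (coevaluation_comp_comparison _ _ (D.ev_zigzag b) q).symm⟩

lemma exists_eq_smul_ev {a : D.L} (p : D.obj (D.bar a) ⊗ D.obj a ⟶ 𝟙_ C) :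
    ∃ z : ℂ, p = z • D.ev a := by
  obtain ⟨g, rfl⟩ := D.exists_eq_whiskerLeft_ev p
  obtain ⟨z, rfl⟩ := (D.simple a).exists_smul g
  exact ⟨z, by simp⟩

lemma exists_eq_smul_coev {b : D.L} (q : 𝟙_ C ⟶ D.obj b ⊗ D.obj (D.bar b)) :
    ∃ z : ℂ, q = z • D.coev b := by
  obtain ⟨g, rfl⟩ := D.exists_eq_coev_whiskerRight q
  obtain ⟨z, rfl⟩ := (D.simple b).exists_smul g
  exact ⟨z, by simp⟩

lemma ev_dag_ev_ev (a : D.L) : D.ev a ≫ dag (D.ev a) ≫ D.ev a = (D.dim a : ℂ) • D.ev a := by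
  have h1 : ∀ θ : 𝟙_ C ⟶ 𝟙_ C, rightScalar θ (𝟙_ C) = θ := by
    intro θ
    rw [rightScalar, ← unitors_equal, leftUnitor_naturality, ← unitors_inv_equal,
      Iso.inv_hom_id_assoc]
  have h2 := rightScalar_naturality (dag (D.ev a) ≫ D.ev a) (D.ev a)
  rw [h1, rightScalar_tensor, rightScalar_ev, MonoidalLinear.whiskerLeft_smul, whiskerLeft_id,
    Linear.smul_comp, Category.id_comp] at h2
  exact h2.symm

lemma dag_coev_coev_dag_coev (b : D.L) :
    dag (D.coev b) ≫ D.coev b ≫ dag (D.coev b) = (D.dim b : ℂ) • dag (D.coev b) := by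
  have h1 : ∀ θ : 𝟙_ C ⟶ 𝟙_ C, leftScalar θ (𝟙_ C) = θ := by
    intro θ
    rw [leftScalar, unitors_equal, rightUnitor_naturality, unitors_inv_equal,
      Iso.inv_hom_id_assoc]
  have h2 := leftScalar_naturality (D.coev b ≫ dag (D.coev b)) (dag (D.coev b))
  rw [h1, leftScalar_tensor, leftScalar_coev, MonoidalLinear.smul_whiskerRight, id_whiskerRight,
    Linear.smul_comp, Category.id_comp] at h2
  exact h2.symm

/-- The product has arcs `ā ⊗ a` and `b ⊗ b̄`, whose morphisms to and from `𝟙` are multiples of the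
caps and cups. The functional therefore closes both halves separately, with one factor `d⁻¹` per
arc. -/
lemma functional_star_mul (a b c e f h e' f' : D.L) (v : D.Bot a b c e) (w : D.Top a b f h)
    (v' : D.Bot a b c e') (w' : D.Top a b f' h) :
    D.functional (D.mul (D.star (D.gdiag (D.obj a) (D.obj b) c e f h v w))
      (D.gdiag (D.obj a) (D.obj b) c e' f' h v' w')) = (D.dim e : ℂ) / D.dim c *
        ((D.dim a : ℂ)⁻¹ * ((D.dim b : ℂ)⁻¹ *
        (D.coeff e' (D.delta e' e ≫ D.bendDown a b (dag v) ≫ D.bendUp a b v') *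
          D.coeff f (D.delta f f' ≫ D.bendDown a b w' ≫ D.bendUp a b (dag w))))) := by
  rw [star_gdiag_obj, map_smul, LinearMap.smul_apply, map_smul, mul_gdiag_same,
    D.functional_gdiag_eq (D.ev a) (dag (D.ev a)) (dag (D.coev b)) (D.coev b)
      D.exists_eq_smul_ev ?_ (D.ev_ne_zero a) (D.ev_dag_ev_ev a) ?_ D.exists_eq_smul_coev
      ((dag_eq_zero_iff _).not.2 (D.coev_ne_zero b)) (D.dag_coev_coev_dag_coev b), smul_eq_mul]
  · have h1 : triMap (𝟙 (D.obj (D.bar a))) v' (𝟙 (D.obj (D.bar b))) ≫ (triAssoc _ _ _ _ _).hom ≫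
        triMap (D.ev a) (𝟙 _) (dag (D.coev b)) ≫ (triUnitor _).hom = D.bendUp a b v' := rfl
    have h2 : (triUnitor _).inv ≫ triMap (dag (D.ev a)) (𝟙 _) (D.coev b) ≫
        (triAssoc _ _ _ _ _).inv ≫ triMap (𝟙 _) w' (𝟙 _) = D.bendDown a b w' := by
      simp [bendDown, triCup]
    simp only [Category.assoc]
    rw [h1, reassoc_of% h2]
  · intro r
    obtain ⟨z, hz⟩ := D.exists_eq_smul_ev (dag r)
    exact ⟨(starRingEnd ℂ) z, by rw [← dag_dag r, hz, dag_smul]⟩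
  · intro r
    obtain ⟨z, hz⟩ := D.exists_eq_smul_coev (dag r)
    exact ⟨(starRingEnd ℂ) z, by rw [← dag_dag r, hz, dag_smul]⟩

lemma functional_star_mul_same (a b c e f h : D.L) (v v' : D.Bot a b c e) (w w' : D.Top a b f h) :
    D.functional (D.mul (D.star (D.gdiag (D.obj a) (D.obj b) c e f h v w))
      (D.gdiag (D.obj a) (D.obj b) c e f h v' w')) =
      (D.dim a * D.dim b * D.dim f / D.dim h : ℂ)⁻¹ *
        (D.coeff c (v' ≫ dag v) * D.coeff h (dag w ≫ w')) := by
  rw [functional_star_mul, bend_trace, bend_trace]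
  simp only [delta_self, Category.id_comp, map_smul, coeff_id, smul_eq_mul, mul_one]
  have := D.dim_ne_zero a
  have := D.dim_ne_zero b
  have := D.dim_ne_zero c
  have := D.dim_ne_zero e
  have := D.dim_ne_zero f
  have := D.dim_ne_zero h
  field_simp

/-- Different outer walls make the product vanish; different arcs leave no morphism to `𝟙`;
different inner walls make one of the two closures vanish. -/
lemma functional_star_mul_of_ne {a b c e f h a' b' c' e' f' h' : D.L}
    (hne : (⟨a, b, c, e, f, h⟩ : TubeLabel D.L) ≠ ⟨a', b', c', e', f', h'⟩)
    (v : D.Bot a b c e) (w : D.Top a b f h) (v' : D.Bot a' b' c' e') (w' : D.Top a' b' f' h') :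
    D.functional (D.mul (D.star (D.gdiag (D.obj a) (D.obj b) c e f h v w))
      (D.gdiag (D.obj a') (D.obj b') c' e' f' h' v' w')) = 0 := by
  by_cases hc : c' = c
  swap
  · rw [star_gdiag_obj, map_smul, LinearMap.smul_apply, map_smul,
      D.mul_gdiag_bot _ _ _ _ _ _ _ _ _ _ _ _ hc,
      map_zero, smul_zero]
  by_cases hh : h' = h
  swap
  · rw [star_gdiag_obj, map_smul, LinearMap.smul_apply, map_smul,
      D.mul_gdiag_top _ _ _ _ _ _ _ _ _ _ _ _ hh,
      map_zero, smul_zero]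
  subst hc hh
  by_cases ha : a' = a
  swap
  · rw [star_gdiag_obj, map_smul, LinearMap.smul_apply, map_smul, mul_gdiag_same,
      functional_gdiag_eq_zero _ (Or.inl fun r => ?_), smul_zero]
    obtain ⟨g, rfl⟩ := D.exists_eq_whiskerLeft_ev r
    rw [D.hom_eq_zero ha g]
    simp
  by_cases hb : b' = b
  swap
  · rw [star_gdiag_obj, map_smul, LinearMap.smul_apply, map_smul, mul_gdiag_same,
      functional_gdiag_eq_zero _ (Or.inr fun r => ?_), smul_zero]
    rw [← dag_eq_zero_iff]
    obtain ⟨g, hg⟩ := D.exists_eq_coev_whiskerRight (dag r)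
    rw [hg, D.hom_eq_zero (Ne.symm hb) g]
    simp
  subst ha hb
  rw [functional_star_mul]
  by_cases he : e' = e
  · have hf : f ≠ f' := by
      rintro rfl
      exact hne (by rw [he])
    simp [D.delta_of_ne hf]
  · simp [D.delta_of_ne he]

/-- The tube algebra has an orthonormal basis for the form given by the canonical functional. -/
theorem exists_orthonormal_basis :
    ∃ (ι : Type) (_ : Fintype ι) (_ : DecidableEq ι) (t : ι → D.Tube),
    (∀ i j, D.functional (D.mul (D.star (t i)) (t j)) = if i = j then 1 else 0) ∧
      ∀ x, ∑ i, D.functional (D.mul (D.star (t i)) x) • t i = x := by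
  choose n u hu hu' using fun l : TubeLabel D.L =>
    (D.simple l.c).exists_orthonormal ((D.obj l.a ⊗ D.obj l.e) ⊗ D.obj l.b)
  choose n' u' hv hv' using fun l : TubeLabel D.L =>
    (D.simple l.h).exists_orthonormal ((D.obj l.a ⊗ D.obj l.f) ⊗ D.obj l.b)
  -- This is the inverse of the weight in `functional_star_mul_same`, so scaling by its square root
  -- normalizes products of orthonormal halves.
  let r : TubeLabel D.L → ℝ := fun l => D.dim l.a * D.dim l.b * D.dim l.f / D.dim l.h
  have hr : ∀ l, 0 < r l := fun l =>
    div_pos (mul_pos (mul_pos (D.dim_pos _) (D.dim_pos _)) (D.dim_pos _)) (D.dim_pos _)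
  have hs : ∀ l, (Real.sqrt (r l) : ℂ) * Real.sqrt (r l) = r l := fun l => by
    rw [← Complex.ofReal_mul, Real.mul_self_sqrt (hr l).le]
  have hr' : ∀ l, (r l : ℂ) ≠ 0 := fun l => by exact_mod_cast (hr l).ne'
  let g : (Σ l, Fin (n l) × Fin (n' l)) → D.Tube := fun k =>
    D.gdiag (D.obj k.1.a) (D.obj k.1.b) k.1.c k.1.e k.1.f k.1.h (u k.1 k.2.1) (dag (u' k.1 k.2.2))
  have hgg : ∀ l k k' (v : D.Bot l.a l.b l.c l.e) (w : D.Top l.a l.b l.f l.h), 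
      D.functional (D.mul (D.star (g ⟨l, k, k'⟩))
        (D.gdiag (D.obj l.a) (D.obj l.b) l.c l.e l.f l.h v w)) = (r l : ℂ)⁻¹ *
          (D.coeff l.c (v ≫ dag (u l k)) * D.coeff l.h (u' l k' ≫ w)) := by
    intro l k k' v w
    rw [functional_star_mul_same, dag_dag]
    simp only [r]
    push_cast
    rfl
  refine ⟨Σ l, Fin (n l) × Fin (n' l), inferInstance, inferInstance,
    fun k => (Real.sqrt (r k.1) : ℂ) • g k, ?_, ?_⟩
  · rintro ⟨l, k, k'⟩ ⟨m, j, j'⟩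
    simp only [map_smulₛₗ, Complex.conj_ofReal, LinearMap.smul_apply, smul_eq_mul,
      RingHom.id_apply]
    by_cases hlm : l = m
    · subst hlm
      rw [hgg l k k' (u l j) (dag (u' l j')), hu, hv, ← mul_assoc, hs, mul_inv_cancel_left₀ (hr' l)]
      by_cases h1 : j = k
      · by_cases h2 : k' = j'
        · simp [h1, h2, coeff_id]
        · simp [h2]
      · have h3 : k ≠ j := Ne.symm h1
        simp [h1, h3]
    · rw [D.functional_star_mul_of_ne hlm]
      simp [hlm]
  · intro x
    induction x using D.tube_induction with
    | zero => simp
    | add x x' hx hx' =>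
      conv_rhs => rw [← hx, ← hx']
      simp only [map_add, add_smul, Finset.sum_add_distrib]
    | diag a b c e f h v w =>
    rw [Fintype.sum_sigma, Finset.sum_eq_single (⟨a, b, c, e, f, h⟩ : TubeLabel D.L)]
    · set l : TubeLabel D.L := ⟨a, b, c, e, f, h⟩
      have hv₁ : v = ∑ k, D.coeff c (v ≫ dag (u l k)) • u l k := by
        conv_lhs => rw [← hu' l v]
        refine Finset.sum_congr rfl fun k _ => ?_
        conv_lhs => rw [← D.coeff_smul_id c (v ≫ dag (u l k)), Linear.smul_comp, Category.id_comp]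
      have hw₁ : w = ∑ k, D.coeff h (u' l k ≫ w) • dag (u' l k) := by
        conv_lhs => rw [← dag_dag w, ← hv' l (dag w), dag_sum]
        refine Finset.sum_congr rfl fun k _ => ?_
        rw [dag_comp, dag_comp, dag_dag, dag_dag]
        conv_lhs => rw [← D.coeff_smul_id h (u' l k ≫ w), Linear.comp_smul, Category.comp_id]
      conv_rhs => rw [hv₁, hw₁]
      simp only [map_sum, LinearMap.sum_apply, map_smul, LinearMap.smul_apply]
      rw [Fintype.sum_prod_type, Finset.sum_comm]
      refine Finset.sum_congr rfl fun k' _ => ?_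
      rw [Finset.smul_sum]
      refine Finset.sum_congr rfl fun k _ => ?_
      rw [map_smulₛₗ, Complex.conj_ofReal, map_smul, LinearMap.smul_apply, map_smul,
        hgg l k k' v w, smul_smul, smul_eq_mul, smul_smul]
      congr 1
      rw [mul_comm, ← mul_assoc, hs, mul_inv_cancel_left₀ (hr' l), mul_comm]
    · intro l _ hl
      refine Finset.sum_eq_zero fun k _ => ?_
      simp only [map_smulₛₗ, LinearMap.smul_apply]
      rw [D.functional_star_mul_of_ne hl]
      simp
    · simp

theorem isCStarWeakHopfAlgebra :
    WeakHopf.IsCStarWeakHopfAlgebra D.mul D.one D.comul D.counit D.antipode D.star where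
  toIsStarWeakHopfAlgebra := D.isStarWeakHopfAlgebra
  exists_faithful_rep := by
    obtain ⟨ι, _, _, t, ht, ht'⟩ := D.exists_orthonormal_basis
    exact WeakHopf.exists_faithful_rep_of_orthonormal D.mul D.one D.star D.mul_assoc_tube
      D.one_mul_tube D.mul_one_tube D.star_mul_tube D.functional t ht ht'

end StringData

/-! ### Existence of string data -/

namespace UnitaryMultifusionCategory

open DaggerCategory PartialTrace

variable {C : Type u} [Category.{v} C] [Preadditive C] [Linear ℂ C] [MonoidalCategory C]
  [MonoidalPreadditive C] [MonoidalLinear ℂ C] [RigidCategory C] [DaggerCategory C]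
  [UnitaryMultifusionCategory C]

/-- There are representatives of the simple objects. -/
lemma exists_representatives : ∃ (L : Type) (_ : Fintype L) (_ : DecidableEq L) (obj : L → C),
    (∀ a, IsSimpleObject (obj a)) ∧ (∀ a b, Nonempty (obj a ≅ obj b) → a = b) ∧
      ∀ X : C, IsSimpleObject X → ∃ a, Nonempty (X ≅ obj a) := by
  classical
  obtain ⟨n, S, hS⟩ := finite_simples (C := C)
  let s : Setoid {k : Fin n // IsSimpleObject (S k)} :=
    { r := fun k l => Nonempty (S k ≅ S l)
      iseqv := ⟨fun k => ⟨Iso.refl _⟩, fun ⟨e⟩ => ⟨e.symm⟩, fun ⟨e⟩ ⟨e'⟩ => ⟨e ≪≫ e'⟩⟩ }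
  refine ⟨Quotient s, inferInstance, inferInstance, fun q => S q.out, fun q => q.out.2,
    fun q q' h => ?_, fun X hX => ?_⟩
  · exact Quotient.out_equiv_out.1 h
  · obtain ⟨k, ⟨e⟩⟩ := hS X hX
    obtain ⟨e'⟩ : Nonempty (
        S (Quotient.mk s ⟨k, hX.of_iso e⟩).out.1 ≅ S k) :=
      Quotient.mk_out (s := s) ⟨k, hX.of_iso e⟩
    exact ⟨_, ⟨e ≪≫ e'.symm⟩⟩

lemma whiskerRight_coevaluation_ne_zero {X Y : C} (hX : IsSimpleObject X) (p : ExactPairing X Y) :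
    p.coevaluation' ▷ X ≠ 0 := by
  intro h
  have h2 := p.evaluation_coevaluation'
  rw [h, Limits.zero_comp] at h2
  refine hX.id_ne_zero ?_
  have := congrArg (fun t => (λ_ _).inv ≫ t ≫ (ρ_ _).hom) h2
  simpa using this.symm

lemma whiskerLeft_evaluation_ne_zero {X Y : C} (hX : IsSimpleObject X) (p : ExactPairing X Y) :
    X ◁ p.evaluation' ≠ 0 := by
  intro h
  have h2 := p.evaluation_coevaluation'
  rw [h, Limits.comp_zero, Limits.comp_zero] at h2
  refine hX.id_ne_zero ?_
  have := congrArg (fun t => (λ_ _).inv ≫ t ≫ (ρ_ _).hom) h2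
  simpa using this.symm

/-- The pairing identifies endomorphisms of `Y` with cups into `X ⊗ Y`, hence with endomorphisms of
`X`, which are scalars. -/
lemma _root_.IsSimpleObject.of_pairing {X Y : C} (hX : IsSimpleObject X) (p : ExactPairing X Y) :
    IsSimpleObject Y := by
  have hc : p.coevaluation' ≠ 0 := fun h => whiskerRight_coevaluation_ne_zero hX p (by simp [h])
  have hY : 𝟙 Y ≠ 0 := fun h => hc <| by
    have : 𝟙 (X ⊗ Y) = 0 := by rw [← whiskerLeft_id, h, MonoidalPreadditive.whiskerLeft_zero]
    rw [← Category.comp_id p.coevaluation', this, Limits.comp_zero]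
  refine ⟨fun z w h => ?_, fun f => ?_⟩
  · have : (z - w) • 𝟙 Y = 0 := by rw [sub_smul, sub_eq_zero]; exact h
    rw [smul_eq_zero, sub_eq_zero] at this
    exact this.resolve_right hY
  · have h1 := coevaluation_comp_comparison _ _ p.coevaluation_evaluation'
      (p.coevaluation' ≫ X ◁ f)
    obtain ⟨z, hz⟩ := hX.exists_smul ((λ_ X).inv ≫ (p.coevaluation' ≫ X ◁ f) ▷ X ≫
      (α_ _ _ _).hom ≫ X ◁ p.evaluation' ≫ (ρ_ X).hom)
    rw [hz, MonoidalLinear.smul_whiskerRight, Linear.comp_smul, id_whiskerRight,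
      Category.comp_id] at h1
    have h2 : ∀ g : Y ⟶ Y, (ρ_ Y).inv ≫ Y ◁ (p.coevaluation' ≫ X ◁ g) ≫ (α_ _ _ _).inv ≫
        p.evaluation' ▷ Y ≫ (λ_ Y).hom = g := by
      intro g
      calc _ = 𝟙 _ ⊗≫ Y ◁ p.coevaluation' ⊗≫ ((Y ⊗ X) ◁ g ≫ p.evaluation' ▷ Y) ⊗≫ 𝟙 _ := by
            monoidal
        _ = 𝟙 _ ⊗≫ (Y ◁ p.coevaluation' ≫ (α_ _ _ _).inv ≫ p.evaluation' ▷ Y) ⊗≫ g := by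
            rw [whisker_exchange]; monoidal
        _ = _ := by rw [p.coevaluation_evaluation']; monoidal
    refine ⟨z, ?_⟩
    have h3 := h2 (z • 𝟙 Y)
    rw [MonoidalLinear.whiskerLeft_smul, Linear.comp_smul, whiskerLeft_id, Category.comp_id, h1,
      h2 f] at h3
    exact h3.symm

/-- Transport and rescaling of a pairing. -/
lemma exists_pairing_rescale {X Y Y' : C} (p : ExactPairing X Y) (e : Y ≅ Y') (s : ℂ)
    (hs : s ≠ 0) : ∃ q : ExactPairing X Y', q.coevaluation' = s • (p.coevaluation' ≫ X ◁ e.hom) ∧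
      q.evaluation' = s⁻¹ • (e.inv ▷ X ≫ p.evaluation') := by
  refine ⟨{
      coevaluation' := s • (p.coevaluation' ≫ X ◁ e.hom)
      evaluation' := s⁻¹ • (e.inv ▷ X ≫ p.evaluation')
      coevaluation_evaluation' := by
        simp only [MonoidalLinear.whiskerLeft_smul, MonoidalLinear.smul_whiskerRight,
          Linear.comp_smul, Linear.smul_comp, smul_smul, inv_mul_cancel₀ hs, one_smul]
        calc _ = 𝟙 _ ⊗≫ Y' ◁ p.coevaluation' ⊗≫ ((Y' ⊗ X) ◁ e.hom ≫ (e.inv ▷ X ≫ p.evaluation') ▷ Y')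
              ⊗≫ 𝟙 _ := by monoidal
          _ = 𝟙 _ ⊗≫ (Y' ◁ p.coevaluation' ≫ e.inv ▷ (X ⊗ Y)) ⊗≫ p.evaluation' ▷ Y ⊗≫ e.hom ⊗≫ 𝟙 _ := by
            rw [whisker_exchange]; monoidal
          _ = 𝟙 _ ⊗≫ e.inv ⊗≫ (Y ◁ p.coevaluation' ≫ (α_ _ _ _).inv ≫ p.evaluation' ▷ Y) ⊗≫ e.hom ⊗≫
              𝟙 _ := by
            rw [whisker_exchange]; monoidal
          _ = 𝟙 _ ⊗≫ (e.inv ≫ e.hom) ⊗≫ 𝟙 _ := by rw [p.coevaluation_evaluation']; monoidal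
          _ = _ := by rw [e.inv_hom_id]; monoidal
      evaluation_coevaluation' := by
        simp only [MonoidalLinear.whiskerLeft_smul, MonoidalLinear.smul_whiskerRight,
          Linear.comp_smul, Linear.smul_comp, smul_smul, inv_mul_cancel₀ hs, one_smul]
        calc _ = 𝟙 _ ⊗≫ p.coevaluation' ▷ X ⊗≫ X ◁ (e.hom ≫ e.inv) ▷ X ⊗≫ X ◁ p.evaluation' ⊗≫ 𝟙 _ := by
              monoidal
          _ = 𝟙 _ ⊗≫ (p.coevaluation' ▷ X ≫ (α_ _ _ _).hom ≫ X ◁ p.evaluation') ⊗≫ 𝟙 _ := by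
            rw [e.hom_inv_id]; monoidal
          _ = _ := by rw [p.evaluation_coevaluation']; monoidal }, rfl, rfl⟩

/-- A pairing of a simple object can be rescaled so that both loops have the same value. -/
lemma exists_spherical_pairing {X Y Y' : C} (hX : IsSimpleObject X) (p : ExactPairing X Y)
    (e : Y ≅ Y') : ∃ (q : ExactPairing X Y') (d : ℝ), 0 < d ∧
      leftScalar (q.coevaluation' ≫ dag q.coevaluation') X = (d : ℂ) • 𝟙 X ∧
      rightScalar (dag q.evaluation' ≫ q.evaluation') X = (d : ℂ) • 𝟙 X := by
  obtain ⟨q, -, -⟩ := exists_pairing_rescale p e 1 one_ne_zero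
  obtain ⟨x, hx, hx'⟩ := hX.exists_pos (f := (λ_ X).inv ≫ q.coevaluation' ▷ X) (fun h =>
    whiskerRight_coevaluation_ne_zero hX q (by simpa using h))
  obtain ⟨y, hy, hy'⟩ := hX.exists_pos (f := (ρ_ X).inv ≫ X ◁ dag q.evaluation') (fun h =>
    whiskerLeft_evaluation_ne_zero hX q (by
      have h1 : X ◁ dag q.evaluation' = 0 := by simpa using h
      rwa [← dag_whiskerLeft, dag_eq_zero_iff] at h1))
  have hleft : leftScalar (q.coevaluation' ≫ dag q.coevaluation') X = (x : ℂ) • 𝟙 X := by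
    rw [← hx', leftScalar, dag_comp, dag_whiskerRight, dag_leftUnitor_inv, comp_whiskerRight]
    simp only [Category.assoc]
  have hright : rightScalar (dag q.evaluation' ≫ q.evaluation') X = (y : ℂ) • 𝟙 X := by
    rw [← hy', rightScalar, dag_comp, dag_whiskerLeft, dag_rightUnitor_inv, dag_dag,
      whiskerLeft_comp]
    simp only [Category.assoc]
  -- Scaling the cup by `s` and the cap by `s⁻¹` preserves the zigzags and multiplies the loops `x`
  -- and `y` by `s²` and `s⁻²`. They agree when `s⁴ = y / x`.
  set s : ℝ := Real.sqrt (Real.sqrt (y / x))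
  have hs : 0 < s := Real.sqrt_pos.2 (Real.sqrt_pos.2 (div_pos hy hx))
  have hs2 : s * s = Real.sqrt (y / x) := Real.mul_self_sqrt (Real.sqrt_nonneg _)
  have hs4 : (s * s) * (s * s) * x = y := by
    rw [hs2, Real.mul_self_sqrt (div_pos hy hx).le, div_mul_cancel₀ _ hx.ne']
  have hsC : (s : ℂ) ≠ 0 := by exact_mod_cast hs.ne'
  obtain ⟨q', hc, he⟩ := exists_pairing_rescale q (Iso.refl _) s hsC
  refine ⟨q', s * s * x, by positivity, ?_, ?_⟩
  · rw [Iso.refl_hom, whiskerLeft_id, Category.comp_id] at hc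
    rw [hc, dag_smul, Complex.conj_ofReal, Linear.smul_comp, Linear.comp_smul, leftScalar_smul,
      leftScalar_smul, hleft, smul_smul, smul_smul]
    push_cast
    ring_nf
  · rw [Iso.refl_inv, id_whiskerRight, Category.id_comp] at he
    rw [he, dag_smul, map_inv₀, Complex.conj_ofReal, Linear.smul_comp, Linear.comp_smul,
      rightScalar_smul, rightScalar_smul, hright, smul_smul, smul_smul]
    congr 1
    rw [← hs4]
    push_cast
    field_simp

/-- Orthonormal bases of the spaces of morphisms from the simple objects resolve the identity. -/
lemma sum_orthonormal_eq_id {L : Type*} [Fintype L] {obj : L → C}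
    (simple : ∀ a, IsSimpleObject (obj a)) (eq_of_iso : ∀ a b, Nonempty (obj a ≅ obj b) → a = b)
    (exists_iso : ∀ X : C, IsSimpleObject X → ∃ a, Nonempty (X ≅ obj a)) {Z : C} {n : L → ℕ}
    (u : ∀ c, Fin (n c) → (obj c ⟶ Z))
    (hu : ∀ c (g : obj c ⟶ Z), ∑ i, (g ≫ dag (u c i)) ≫ u c i = g) :
    ∑ c, ∑ i, dag (u c i) ≫ u c i = 𝟙 Z := by
  have h1 : ∀ (c : L) (g : obj c ⟶ Z), g ≫ ∑ c, ∑ i, dag (u c i) ≫ u c i = g := by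
    intro c g
    rw [Preadditive.comp_sum, Finset.sum_eq_single c]
    · simpa only [Preadditive.comp_sum, Category.assoc] using hu c g
    · intro c' _ hc'
      rw [Preadditive.comp_sum]
      refine Finset.sum_eq_zero fun i _ => ?_
      have h0 : g ≫ dag (u c' i) = 0 := by
        by_contra hne
        obtain ⟨t, ht, ht'⟩ := (simple c).exists_unitary (simple c') hne
        exact hc' (eq_of_iso _ _ ⟨⟨t, dag t, ht, ht'⟩⟩).symm
      rw [← Category.assoc, h0, Limits.zero_comp]
    · simp
  obtain ⟨m, S, ι, hS, -, -, hc⟩ := semisimple Z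
  have h2 : ∀ k, ι k ≫ ∑ c, ∑ i, dag (u c i) ≫ u c i = ι k := by
    intro k
    obtain ⟨a, ⟨e⟩⟩ := exists_iso (S k) (hS k)
    have := h1 a (e.inv ≫ ι k)
    rwa [Category.assoc, Iso.cancel_iso_inv_left] at this
  calc _ = (∑ k, dag (ι k) ≫ ι k) ≫ ∑ c, ∑ i, dag (u c i) ≫ u c i := by
        rw [hc, Category.id_comp]
    _ = _ := by rw [Preadditive.sum_comp]; simp only [Category.assoc, h2, hc]

/-- The choices needed to draw string diagrams exist. -/
theorem nonempty_stringData : Nonempty (StringData C) := by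
  obtain ⟨L, _, _, obj, simple, eq_of_iso, exists_iso⟩ := exists_representatives (C := C)
  obtain ⟨m, S, ι, hS, hiso, horth, hcomplete⟩ := semisimple (𝟙_ C)
  choose unit hunit using fun i => exists_iso (S i) (hS i)
  -- The isomorphisms with the representatives need not be unitary. Nonvanishing suffices to replace
  -- them by unitary ones, which keeps the inclusions into `𝟙` isometric and orthogonal.
  have hne : ∀ i, (hunit i).some.inv ≠ 0 := fun i h => (hS i).id_ne_zero <| by
    rw [← (hunit i).some.hom_inv_id, h, Limits.comp_zero]
  choose g hg hg' using fun i => (simple (unit i)).exists_unitary (hS i) (hne i)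
  choose bar hbar using fun a => exists_iso ((obj a)ᘁ) ((simple a).of_pairing inferInstance)
  choose pairing dim dim_pos loop_left loop_right using fun a =>
    exists_spherical_pairing (simple a) (inferInstance : ExactPairing (obj a) (obj a)ᘁ)
      (hbar a).some
  choose N w hw hw' using fun a b c => (simple c).exists_orthonormal (obj a ⊗ obj b)
  have hY : ∀ a b c, 0 < Real.sqrt (dim a * dim b / dim c) := fun a b c =>
    Real.sqrt_pos.2 (div_pos (mul_pos (dim_pos a) (dim_pos b)) (dim_pos c))
  have hsq : ∀ a b c, ((Real.sqrt (Real.sqrt (dim a * dim b / dim c)) : ℝ) : ℂ) *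
      (Real.sqrt (Real.sqrt (dim a * dim b / dim c)) : ℝ) =
        (Real.sqrt (dim a * dim b / dim c) : ℝ) := fun a b c => by
    rw [← Complex.ofReal_mul, Real.mul_self_sqrt (hY a b c).le]
  exact ⟨{
    L := L
    obj := obj
    simple := simple
    eq_of_iso := eq_of_iso
    exists_iso := exists_iso
    I := Fin m
    unit := unit
    unitIncl := fun i => g i ≫ ι i
    unitIncl_isometry := fun i => by
      rw [dag_comp, Category.assoc, reassoc_of% (hiso i), hg]
    unitIncl_orthogonal := fun i j hij => by
      rw [dag_comp, Category.assoc, reassoc_of% (horth i j hij)]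
      simp
    unitIncl_complete := by
      rw [← hcomplete]
      refine Finset.sum_congr rfl fun i _ => ?_
      rw [dag_comp, Category.assoc, reassoc_of% (hg' i)]
    bar := bar
    pairing := pairing
    dim := dim
    loop_left := loop_left
    loop_right := loop_right
    N := N
    -- Orthonormal vectors are scaled by the square root of `Y`, so that a vertex followed by its
    -- dagger gives `Y`; this accounts for the double square root.
    vtx := fun a b c i => ((Real.sqrt (Real.sqrt (dim a * dim b / dim c)) : ℝ) : ℂ) • w a b c i
    loop_move := fun a b c i j => by
      rw [dag_smul, Complex.conj_ofReal, Linear.smul_comp, Linear.comp_smul, smul_smul, hsq, hw]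
      split_ifs
      · rfl
      · rw [smul_zero]
    parallel_move := fun a b => by
      refine Eq.trans ?_ (sum_orthonormal_eq_id simple eq_of_iso exists_iso (w a b) (hw' a b))
      refine Finset.sum_congr rfl fun c _ => Finset.sum_congr rfl fun i _ => ?_
      have : ((Real.sqrt (dim a * dim b / dim c) : ℝ) : ℂ) ≠ 0 := by
        exact_mod_cast (hY a b c).ne'
      rw [dag_smul, Complex.conj_ofReal, Linear.smul_comp, Linear.comp_smul, smul_smul, smul_smul,
        mul_assoc, hsq, inv_mul_cancel₀ this, one_smul] }⟩

end UnitaryMultifusionCategory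

theorem mainTheorem2 (C : Type u) [Category.{v} C] [Preadditive C] [Linear ℂ C]
    [MonoidalCategory C] [MonoidalPreadditive C] [MonoidalLinear ℂ C] [RigidCategory C]
    [DaggerCategory C] [UnitaryMultifusionCategory C] :
    Nonempty (StringData C) ∧
    ∀ D : StringData C,
      WeakHopf.IsCStarWeakHopfAlgebra D.mul D.one D.comul D.counit D.antipode D.star ∧
      ∃ T : D.Tube ≃ₗ[ℂ] D.Tube, T.toLinearMap = D.antipode ∧
        ∀ x : D.Tube, D.antipode (D.star x) = D.star (T.symm x) :=
  ⟨UnitaryMultifusionCategory.nonempty_stringData, fun D =>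
    ⟨D.isCStarWeakHopfAlgebra, D.exists_antipode_equiv⟩⟩
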